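/- Let $\Omega\subseteq\mathbb R^n$ be a non-empty open set. All functions and distributions are complex-valued unless stated otherwise; $\mathcal D(\Omega)$ carries its LF-topology, $\mathcal D'(\Omega)$ the strong topology, and for a locally convex space $F$ the space $C^\infty(\Omega,F)$ carries the topology of uniform convergence of all derivatives on compact sets ($C^\infty(\Omega)=C^\infty(\Omega,\mathbb C)$). A map between locally convex spaces is called smooth if it maps smooth curves to smooth curves, $C^\infty(E,F)$ denotes the set of smooth maps $E\to F$, and $\mathrm dR(x)(v)=\lim_{t\to0}t^{-1}(R(x+tv)-R(x))$. Put $SK(\Omega)=C^\infty(\Omega,\mathcal D(\Omega))$ and $\mathcal E(\Omega)=C^\infty(SK(\Omega),C^\infty(\Omega))$. An element $R\in\mathcal E(\Omega)$ is *local* if $\vec\varphi|_U=\vec\psi|_U$ implies $R(\vec\varphi)|_U=R(\vec\psi)|_U$ for all open $U\subseteq\Omega$; *point-local* if $\vec\varphi(x)=\vec\psi(x)$ implies $R(\vec\varphi)(x)=R(\vec\psi)(x)$ for all $x\in\Omega$; *point-independent* if $\vec\varphi(x)=\vec\psi(y)$ implies $R(\vec\varphi)(x)=R(\vec\psi)(y)$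 for all $x,y\in\Omega$. Let $\mathcal E_{loc},\mathcal E_{ploc},\mathcal E_{pi}$ be the corresponding subsets of $\mathcal E(\Omega)$, and $L_{loc},L_{ploc},L_{pi}$ those of the space $L(\Omega)$ of continuous linear maps $SK(\Omega)\to C^\infty(\Omega)$; let $L_{C^\infty}\subseteq L(\Omega)$ be the set of $C^\infty(\Omega)$-linear elements. Let $(\iota u)(\vec\varphi)=\langle u,\vec\varphi\rangle=[x\mapsto\langle u,\vec\varphi(x)\rangle]$ for $u\in\mathcal D'(\Omega)$ and $(\sigma f)(\vec\varphi)=f$ for $f\in C^\infty(\Omega)$. The smoothing operator corresponding to $\vec\varphi\in SK(\Omega)$ is $\Phi(u)=\langle u,\vec\varphi\rangle$. Let $X\in C^\infty(\Omega,\mathbb R^n)$ be a vector field. Put $\mathrm L_Xf=\sum_iX^i\partial_if$ for $f\in C^\infty(\Omega,F)$, $\mathrm L_X\varphi=\sum_iX^i\partial_i\varphi+(\operatorname{div}X)\varphi$ for $\varphi\in\mathcal D(\Omega)$, and $\mathrm L^{SK}_X\vec\varphi=\mathrm L_X\vec\varphi+\mathrm L_X\circ\vec\varphi$ for $\vec\varphi\in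 SK(\Omega)$. For maps $R\colon SK(\Omega)\to C^\infty(\Omega)$ let $$(\widehat{\mathrm L}_XR)(\vec\varphi)=-\mathrm dR(\vec\varphi)(\mathrm L^{SK}_X\vec\varphi)+\mathrm L_X(R(\vec\varphi)),\qquad \widetilde{\mathrm L}_XR=\mathrm L_X\circ R .$$ Further define $(\widehat{\mathrm L}_XS)(\varphi)=-\mathrm dS(\varphi)(\mathrm L_X\varphi)+\mathrm L_X(S(\varphi))$ for $S\in C^\infty(\mathcal D(\Omega),C^\infty(\Omega))$; $(\widehat{\mathrm L}_XS)(\varphi)=-\mathrm dS(\varphi)(\mathrm L_X\varphi)$ for $S\in C^\infty(\mathcal D(\Omega),\mathbb C)$; $(\widehat{\mathrm L}_XS)(x)(\varphi)=-\langle S(x),\mathrm L_X\varphi\rangle+\langle(\mathrm L_XS)(x),\varphi\rangle$ for $S\in C^\infty(\Omega,\mathcal D'(\Omega))$; and $\langle\widehat{\mathrm L}_Xu,\varphi\rangle=-\langle u,\mathrm L_X\varphi\rangle$ for $u\in\mathcal D'(\Omega)$. Then: 1. Each of $\mathcal E(\Omega),\mathcal E_{loc},\mathcal E_{ploc},\mathcal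 E_{pi},L(\Omega),L_{loc},L_{ploc},L_{pi}$ is mapped into itself by $\widehat{\mathrm L}_X$. 2. The formulas $R(\vec\varphi)(x)=S(\vec\varphi(x))(x)$, $R(\vec\varphi)(x)=S(\vec\varphi(x))$, $R(\vec\varphi)(x)=\langle S(x),\vec\varphi(x)\rangle$ and $R(\vec\varphi)(x)=\langle u,\vec\varphi(x)\rangle$ (for all $\vec\varphi\in SK(\Omega)$, $x\in\Omega$) define bijective correspondences $\mathcal E_{ploc}\cong C^\infty(\mathcal D(\Omega),C^\infty(\Omega))$, $\mathcal E_{pi}\cong C^\infty(\mathcal D(\Omega),\mathbb C)$, $L_{ploc}\cong C^\infty(\Omega,\mathcal D'(\Omega))$ and $L_{pi}\cong\mathcal D'(\Omega)$, and $L_{ploc}=L_{C^\infty}$. All these spaces are invariant under the respective $\widehat{\mathrm L}_X$, and the correspondences commute with $\widehat{\mathrm L}_X$. 3. $\widetilde{\mathrm L}_X$ maps $\mathcal E_{pi}$ and $\mathcal E_{ploc}$ into $\mathcal E_{loc}$, and maps each of $\mathcal E_{loc}$, $\mathcal E(\Omega)$ and $L(\Omega)$ into itself. 4. $\widehat{\mathrm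 L}_X(\iota u)=\iota(\widehat{\mathrm L}_Xu)$ for all $u\in\mathcal D'(\Omega)$ and $\widehat{\mathrm L}_X(\sigma f)=\sigma(\mathrm L_Xf)$ for all $f\in C^\infty(\Omega)$; but $\widehat{\mathrm L}_X$ is not $C^\infty(\Omega)$-linear in $X$: if $X\neq0$, there are a real-valued $f\in C^\infty(\Omega,\mathbb R)$ and $R\in\mathcal E(\Omega)$ with $\widehat{\mathrm L}_{fX}R\neq f\,\widehat{\mathrm L}_XR$. Likewise $\widetilde{\mathrm L}_X(\sigma f)=\sigma(\mathrm L_Xf)$ for all $f\in C^\infty(\Omega)$; but if $X\neq0$, there is $u\in\mathcal D'(\Omega)$ with $\widetilde{\mathrm L}_X(\iota u)\neq\iota(\widehat{\mathrm L}_Xu)$. Moreover $\widetilde{\mathrm L}_{X+Y}R=\widetilde{\mathrm L}_XR+\widetilde{\mathrm L}_YR$ and $\widetilde{\mathrm L}_{fX}R=f\,\widetilde{\mathrm L}_XR$ for all vector fields $Y$, all $f\in C^\infty(\Omega,\mathbb R)$ and all $R\colon SK(\Omega)\to C^\infty(\Omega)$. 5. Let $u\in\mathcal D'(\Omega)$,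 $R=\iota u$, and let $(\vec\varphi_k)_k$ be a sequence in $SK(\Omega)$ with corresponding smoothing operators $\Phi_k$ such that $\Phi_k\to\mathrm{id}$ in $\mathcal L_b(\mathcal D'(\Omega),\mathcal D'(\Omega))$, i.e. uniformly on bounded subsets of $\mathcal D'(\Omega)$. Then $(\widetilde{\mathrm L}_XR-\widehat{\mathrm L}_XR)(\vec\varphi_k)\to0$ in $\mathcal D'(\Omega)$. -/

import Mathlib

open TopologicalSpace Filter Topology
open scoped Distributions ContDiff

namespace Colombeau

/-- Euclidean space `ℝⁿ`. -/
abbrev Eu (n : ℕ) : Type := EuclideanSpace ℝ (Fin n)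

/-! ## Smooth functions on an open subset of `ℝⁿ` with values in a topological vector space -/

section Calculus

variable {n : ℕ} {F : Type*} [AddCommGroup F] [Module ℝ F] [TopologicalSpace F]

/-- `f` is (totally) differentiable at `x` with partial derivatives `p 0, …, p (n - 1)`:
`‖h‖⁻¹ (f (x + h) - f x - ∑ hᵢ pᵢ) → 0` in `F` as `h → 0`, `h ≠ 0`. -/
def HasPartialsAt (f : Eu n → F) (p : Fin n → F) (x : Eu n) : Prop :=
  Tendsto (fun h : Eu n => ‖h‖⁻¹ • (f (x + h) - f x - ∑ i, h i • p i)) (𝓝[≠] 0) (𝓝 0)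

/-- `f` is smooth on `Ω`: there is a family of iterated partial derivatives
`D [i₁, …, i_k] = ∂_{i₁} ⋯ ∂_{i_k} f`, of all orders, each of which is differentiable at every
point of `Ω` (and hence continuous on `Ω`). -/
def IsSmoothOn (Ω : Opens (Eu n)) (f : Eu n → F) : Prop :=
  ∃ D : List (Fin n) → Eu n → F, D [] = f ∧
    ∀ l, ∀ x ∈ Ω, HasPartialsAt (D l) (fun i => D (i :: l) x) x

theorem HasPartialsAt.congr {f g : Eu n → F} {p : Fin n → F} {x : Eu n}
    (h : HasPartialsAt f p x) (hfg : f =ᶠ[𝓝 x] g) : HasPartialsAt g p x := by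
  refine Tendsto.congr' ?_ h
  have hx : f x = g x := hfg.eq_of_nhds
  have h1 : Tendsto (fun h : Eu n => x + h) (𝓝[≠] 0) (𝓝 x) := by
    have : Tendsto (fun h : Eu n => x + h) (𝓝 0) (𝓝 (x + 0)) :=
      (continuous_const.add continuous_id).tendsto 0
    rw [add_zero] at this
    exact this.mono_left nhdsWithin_le_nhds
  filter_upwards [h1.eventually hfg] with h hh
  rw [hh, hx]

theorem IsSmoothOn.congr {Ω : Opens (Eu n)} {f g : Eu n → F} (hf : IsSmoothOn Ω f)
    (hfg : ∀ x ∈ Ω, f x = g x) : IsSmoothOn Ω g := by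
  obtain ⟨D, hD, h⟩ := hf
  refine ⟨fun l => match l with | [] => g | i :: l => D (i :: l), rfl, ?_⟩
  intro l x hx
  cases l with
  | nil =>
    refine (h [] x hx).congr ?_
    filter_upwards [Ω.isOpen.mem_nhds hx] with y hy
    rw [hD, hfg y hy]
  | cons i l => exact h (i :: l) x hx

theorem HasPartialsAt.zero (x : Eu n) :
    HasPartialsAt (fun _ : Eu n => (0 : F)) (fun _ => 0) x := by
  simpa [HasPartialsAt] using tendsto_const_nhds

theorem HasPartialsAt.const (v : F) (x : Eu n) :
    HasPartialsAt (fun _ : Eu n => v) (fun _ => 0) x := by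
  simpa [HasPartialsAt] using tendsto_const_nhds

theorem HasPartialsAt.comp_clm {G : Type*} [AddCommGroup G] [Module ℝ G] [TopologicalSpace G]
    {f : Eu n → F} {p : Fin n → F} {x : Eu n} (T : F →L[ℝ] G) (hf : HasPartialsAt f p x) :
    HasPartialsAt (fun y => T (f y)) (fun i => T (p i)) x := by
  have := (T.continuous.tendsto 0).comp hf
  rw [map_zero] at this
  refine this.congr fun h => ?_
  simp

theorem IsSmoothOn.const (Ω : Opens (Eu n)) (v : F) : IsSmoothOn Ω (fun _ => v) := by
  refine ⟨fun l _ => match l with | [] => v | _ :: _ => 0, rfl, fun l x _ => ?_⟩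
  cases l with
  | nil => exact HasPartialsAt.const v x
  | cons i l => exact HasPartialsAt.const 0 x

theorem IsSmoothOn.comp_clm {G : Type*} [AddCommGroup G] [Module ℝ G] [TopologicalSpace G]
    {Ω : Opens (Eu n)} {f : Eu n → F} (T : F →L[ℝ] G) (hf : IsSmoothOn Ω f) :
    IsSmoothOn Ω (fun y => T (f y)) := by
  obtain ⟨D, rfl, hD⟩ := hf
  exact ⟨fun l y => T (D l y), rfl, fun l x hx => (hD l x hx).comp_clm T⟩

theorem HasPartialsAt.const_smul {𝕜 : Type*} [Monoid 𝕜] [DistribMulAction 𝕜 F]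
    [SMulCommClass ℝ 𝕜 F] [ContinuousConstSMul 𝕜 F] {f : Eu n → F} {p : Fin n → F} {x : Eu n}
    (c : 𝕜) (hf : HasPartialsAt f p x) :
    HasPartialsAt (fun y => c • f y) (fun i => c • p i) x := by
  have : SMulCommClass 𝕜 ℝ F := SMulCommClass.symm ℝ 𝕜 F
  have := Tendsto.const_smul hf c
  rw [smul_zero] at this
  refine this.congr fun h => ?_
  have : ∑ i, h i • c • p i = c • ∑ i, h i • p i := by
    rw [Finset.smul_sum]
    exact Finset.sum_congr rfl fun i _ => smul_comm _ _ _
  rw [this, ← smul_sub, ← smul_sub, smul_comm]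

theorem IsSmoothOn.const_smul {𝕜 : Type*} [Monoid 𝕜] [DistribMulAction 𝕜 F]
    [SMulCommClass ℝ 𝕜 F] [ContinuousConstSMul 𝕜 F] {Ω : Opens (Eu n)} {f : Eu n → F}
    (c : 𝕜) (hf : IsSmoothOn Ω f) : IsSmoothOn Ω (fun y => c • f y) := by
  obtain ⟨D, rfl, hD⟩ := hf
  exact ⟨fun l y => c • D l y, rfl, fun l x hx => (hD l x hx).const_smul c⟩

variable [IsTopologicalAddGroup F]

theorem HasPartialsAt.add {f g : Eu n → F} {p q : Fin n → F} {x : Eu n}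
    (hf : HasPartialsAt f p x) (hg : HasPartialsAt g q x) :
    HasPartialsAt (fun y => f y + g y) (fun i => p i + q i) x := by
  have := Tendsto.add hf hg
  rw [add_zero] at this
  refine this.congr fun h => ?_
  simp only [smul_add, Finset.sum_add_distrib]
  rw [← smul_add]
  congr 1
  abel

theorem HasPartialsAt.tendsto_sub [ContinuousSMul ℝ F] {f : Eu n → F} {p : Fin n → F} {x : Eu n}
    (hf : HasPartialsAt f p x) :
    Tendsto (fun h : Eu n => f (x + h) - f x) (𝓝[≠] 0) (𝓝 0) := by
  have h1 : Tendsto (fun h : Eu n => ‖h‖) (𝓝[≠] 0) (𝓝 (0 : ℝ)) := by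
    have : Tendsto (fun h : Eu n => ‖h‖) (𝓝 0) (𝓝 ‖(0 : Eu n)‖) := continuous_norm.tendsto 0
    rw [norm_zero] at this
    exact this.mono_left nhdsWithin_le_nhds
  have h2 : Tendsto (fun h : Eu n => ∑ i, h i • p i) (𝓝[≠] 0) (𝓝 0) := by
    have : Continuous (fun h : Eu n => ∑ i, h i • p i) := by fun_prop
    have := this.tendsto 0
    simp only [PiLp.zero_apply, zero_smul, Finset.sum_const_zero] at this
    exact this.mono_left nhdsWithin_le_nhds
  have := (h1.smul hf).add h2
  simp only [zero_smul, add_zero] at this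
  refine this.congr' ?_
  filter_upwards [self_mem_nhdsWithin] with h hh
  have : ‖h‖ ≠ 0 := by simpa using hh
  rw [smul_smul, mul_inv_cancel₀ this, one_smul]
  abel

theorem HasPartialsAt.continuousAt [ContinuousSMul ℝ F] {f : Eu n → F} {p : Fin n → F} {x : Eu n}
    (hf : HasPartialsAt f p x) : ContinuousAt f x := by
  have h1 : Tendsto (fun h : Eu n => f (x + h) - f x) (𝓝 0) (𝓝 0) := by
    rw [← nhdsNE_sup_pure]
    refine Tendsto.sup hf.tendsto_sub ?_
    rw [tendsto_pure_left]
    intro s hs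
    simpa using mem_of_mem_nhds hs
  have h2 : Tendsto (fun y : Eu n => y - x) (𝓝 x) (𝓝 0) := by
    have : Tendsto (fun y : Eu n => y - x) (𝓝 x) (𝓝 (x - x)) :=
      (continuous_id.sub continuous_const).tendsto x
    rwa [sub_self] at this
  have h3 := (h1.comp h2).add_const (f x)
  simpa [Function.comp_def, ContinuousAt] using h3

/-- Partial derivatives in a Hausdorff space are unique. -/
theorem HasPartialsAt.unique [ContinuousSMul ℝ F] [T2Space F] {f : Eu n → F} {p q : Fin n → F}
    {x : Eu n} (hp : HasPartialsAt f p x) (hq : HasPartialsAt f q x) : p = q := by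
  funext j
  have h0 := Tendsto.sub hq hp
  rw [sub_zero] at h0
  have h1 : Tendsto (fun t : ℝ => t • EuclideanSpace.single j (1 : ℝ)) (𝓝[>] 0)
      (𝓝[≠] (0 : Eu n)) := by
    refine tendsto_nhdsWithin_iff.2 ⟨?_, ?_⟩
    · have : Continuous (fun t : ℝ => t • EuclideanSpace.single j (1 : ℝ)) := by fun_prop
      have := this.tendsto 0
      rw [zero_smul] at this
      exact this.mono_left nhdsWithin_le_nhds
    · filter_upwards [self_mem_nhdsWithin] with t ht
      have : t ≠ 0 := ne_of_gt ht
      simp [this]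
  have h2 := h0.comp h1
  have h3 : Tendsto (fun _ : ℝ => p j - q j) (𝓝[>] 0) (𝓝 0) := by
    refine h2.congr' ?_
    filter_upwards [self_mem_nhdsWithin] with t ht
    have ht' : (0 : ℝ) < t := ht
    simp only [Function.comp_def, norm_smul, PiLp.norm_single, norm_one, mul_one,
      Real.norm_eq_abs, abs_of_pos ht', PiLp.smul_apply, PiLp.single_apply, smul_eq_mul,
      mul_ite, mul_zero, ite_smul, zero_smul, Finset.sum_ite_eq', Finset.mem_univ, if_true]
    rw [← smul_sub]
    simp only [sub_sub_sub_cancel_left]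
    rw [← smul_sub, smul_smul, inv_mul_cancel₀ ht'.ne', one_smul]
  exact sub_eq_zero.1 (tendsto_nhds_unique tendsto_const_nhds h3)

theorem HasPartialsAt.smul {𝕜 : Type*} [NormedField 𝕜] [NormedSpace ℝ 𝕜] [Module 𝕜 F]
    [IsScalarTower ℝ 𝕜 F] [ContinuousSMul ℝ F] [ContinuousSMul 𝕜 F] [SMulCommClass ℝ 𝕜 F]
    {f : Eu n → 𝕜} {g : Eu n → F} {p : Fin n → 𝕜} {q : Fin n → F} {x : Eu n}
    (hf : HasPartialsAt f p x) (hg : HasPartialsAt g q x) :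
    HasPartialsAt (fun y => f y • g y) (fun i => p i • g x + f x • q i) x := by
  have : SMulCommClass 𝕜 ℝ F := SMulCommClass.symm ℝ 𝕜 F
  have h1 : Tendsto (fun h : Eu n => f (x + h)) (𝓝[≠] 0) (𝓝 (f x)) := by
    simpa using hf.tendsto_sub.add_const (f x)
  have t1 := h1.smul hg
  have t2 := Tendsto.smul_const hf (g x)
  have t3 : ∀ i : Fin n, Tendsto (fun h : Eu n => ((‖h‖⁻¹ * h i) • (f (x + h) - f x)) • q i)
      (𝓝[≠] 0) (𝓝 0) := by
    intro i
    have : Tendsto (fun h : Eu n => (‖h‖⁻¹ * h i) • (f (x + h) - f x)) (𝓝[≠] 0) (𝓝 0) := by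
      refine squeeze_zero_norm (fun h => ?_) (tendsto_zero_iff_norm_tendsto_zero.1 hf.tendsto_sub)
      rw [norm_smul]
      refine mul_le_of_le_one_left (norm_nonneg _) ?_
      rw [norm_mul, norm_inv, norm_norm]
      exact inv_mul_le_one_of_le₀ (PiLp.norm_apply_le h i) (norm_nonneg _)
    simpa using this.smul_const (q i)
  have t4 := tendsto_finsetSum Finset.univ fun i _ => t3 i
  have := (t1.add t2).add t4
  simp only [smul_zero, zero_smul, Finset.sum_const_zero, add_zero] at this
  refine this.congr fun h => ?_
  have e1 : ∑ i, ((‖h‖⁻¹ * h i) • (f (x + h) - f x)) • q i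
      = ‖h‖⁻¹ • ((f (x + h) - f x) • ∑ i, h i • q i) := by
    rw [Finset.smul_sum, Finset.smul_sum]
    refine Finset.sum_congr rfl fun i _ => ?_
    rw [smul_assoc, mul_smul, smul_comm (f (x + h) - f x) (h i) (q i)]
  have e2 : ∑ i, h i • (p i • g x + f x • q i)
      = (∑ i, h i • p i) • g x + f x • ∑ i, h i • q i := by
    rw [Finset.sum_smul, Finset.smul_sum, ← Finset.sum_add_distrib]
    refine Finset.sum_congr rfl fun i _ => ?_
    rw [smul_add, smul_assoc, smul_comm (f x) (h i) (q i)]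
  rw [e1, e2, smul_comm (f (x + h)) ‖h‖⁻¹, smul_assoc, ← smul_add, ← smul_add]
  congr 1
  simp only [smul_sub, sub_smul]
  abel

theorem IsSmoothOn.add {Ω : Opens (Eu n)} {f g : Eu n → F} (hf : IsSmoothOn Ω f)
    (hg : IsSmoothOn Ω g) : IsSmoothOn Ω (fun y => f y + g y) := by
  obtain ⟨D, rfl, hD⟩ := hf
  obtain ⟨D', rfl, hD'⟩ := hg
  exact ⟨fun l y => D l y + D' l y, rfl, fun l x hx => (hD l x hx).add (hD' l x hx)⟩

theorem HasPartialsAt.list_sum {ι : Type*} (s : List ι) {f : ι → Eu n → F} {p : ι → Fin n → F}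
    {x : Eu n} (h : ∀ a ∈ s, HasPartialsAt (f a) (p a) x) :
    HasPartialsAt (fun y => (s.map fun a => f a y).sum) (fun i => (s.map fun a => p a i).sum) x := by
  induction s with
  | nil => simpa using HasPartialsAt.zero x
  | cons a s ih =>
    simpa using (h a (by simp)).add (ih fun b hb => h b (by simp [hb]))

/-- The list of pairs `(a, b)` with `∂^l (f g) = ∑ (∂^a f) (∂^b g)`. -/
def leibnizList : List (Fin n) → List (List (Fin n) × List (Fin n))
  | [] => [([], [])]
  | i :: l => (leibnizList l).map (fun a => (i :: a.1, a.2)) ++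
      (leibnizList l).map (fun a => (a.1, i :: a.2))

theorem IsSmoothOn.smul {𝕜 : Type*} [NormedField 𝕜] [NormedSpace ℝ 𝕜] [Module 𝕜 F]
    [IsScalarTower ℝ 𝕜 F] [ContinuousSMul ℝ F] [ContinuousSMul 𝕜 F] [SMulCommClass ℝ 𝕜 F]
    {Ω : Opens (Eu n)} {f : Eu n → 𝕜} {g : Eu n → F}
    (hf : IsSmoothOn Ω f) (hg : IsSmoothOn Ω g) : IsSmoothOn Ω (fun y => f y • g y) := by
  obtain ⟨D, rfl, hD⟩ := hf
  obtain ⟨D', rfl, hD'⟩ := hg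
  refine ⟨fun l y => ((leibnizList l).map fun a => D a.1 y • D' a.2 y).sum, ?_, fun l x hx => ?_⟩
  · funext y
    simp [leibnizList]
  · have := HasPartialsAt.list_sum (leibnizList l)
      (fun a _ => (hD a.1 x hx).smul (hD' a.2 x hx))
    refine Eq.mp ?_ this
    congr 1
    funext i
    simp [leibnizList, List.sum_map_add, Function.comp_def]

end Calculus

/-- `C^∞(Ω, F)`. A function on `Ω` is represented by its extension by zero to `ℝⁿ`, so that two
elements are equal exactly when they agree on `Ω`. -/
structure SmoothMap {n : ℕ} (Ω : Opens (Eu n)) (F : Type*) [AddCommGroup F] [Module ℝ F]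
    [TopologicalSpace F] where
  /-- The function, extended by zero. -/
  toFun : Eu n → F
  zero_off : ∀ x, x ∉ Ω → toFun x = 0
  smooth : IsSmoothOn Ω toFun

namespace SmoothMap

section Basic

variable {n : ℕ} {Ω : Opens (Eu n)} {F : Type*} [AddCommGroup F] [Module ℝ F]
  [TopologicalSpace F]

instance : FunLike (SmoothMap Ω F) (Eu n) F where
  coe := SmoothMap.toFun
  coe_injective f g h := by cases f; cases g; congr

theorem ext_on {f g : SmoothMap Ω F} (h : ∀ x ∈ Ω, f x = g x) : f = g := by
  refine DFunLike.ext f g fun x => ?_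
  by_cases hx : x ∈ Ω
  · exact h x hx
  · exact (f.zero_off x hx).trans (g.zero_off x hx).symm

open Classical in
/-- The element of `C^∞(Ω, F)` given by a function which is smooth on `Ω`. -/
noncomputable def mk' (f : Eu n → F) (hf : IsSmoothOn Ω f) : SmoothMap Ω F where
  toFun x := if x ∈ Ω then f x else 0
  zero_off x hx := by simp [hx]
  smooth := hf.congr fun x hx => by simp [hx]

theorem mk'_apply {f : Eu n → F} {hf : IsSmoothOn Ω f} {x : Eu n} (hx : x ∈ Ω) :
    mk' f hf x = f x := if_pos hx

end Basic

section Algebra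

variable {n : ℕ} {Ω : Opens (Eu n)} {F : Type*} [AddCommGroup F] [Module ℝ F]
  [TopologicalSpace F] [IsTopologicalAddGroup F]

instance : Zero (SmoothMap Ω F) := ⟨⟨fun _ => 0, fun _ _ => rfl, IsSmoothOn.const Ω 0⟩⟩

instance : Add (SmoothMap Ω F) :=
  ⟨fun f g => ⟨fun x => f x + g x,
    fun x hx => by
      rw [show f x = 0 from f.zero_off x hx, show g x = 0 from g.zero_off x hx, add_zero],
    f.smooth.add g.smooth⟩⟩

instance {R : Type*} [Monoid R] [DistribMulAction R F] [SMulCommClass ℝ R F]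
    [ContinuousConstSMul R F] : SMul R (SmoothMap Ω F) :=
  ⟨fun c f => ⟨fun x => c • f x,
    fun x hx => by rw [show f x = 0 from f.zero_off x hx, smul_zero],
    f.smooth.const_smul c⟩⟩

instance : Neg (SmoothMap Ω F) :=
  ⟨fun f => ⟨fun x => -f x,
    fun x hx => by rw [show f x = 0 from f.zero_off x hx, neg_zero],
    (f.smooth.const_smul (-1 : ℤ)).congr fun x _ => by
      change (-1 : ℤ) • f x = - f x
      simp⟩⟩

instance : Sub (SmoothMap Ω F) :=
  ⟨fun f g => ⟨fun x => f x - g x,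
    fun x hx => by
      rw [show f x = 0 from f.zero_off x hx, show g x = 0 from g.zero_off x hx, sub_zero],
    (f.smooth.add (g.smooth.const_smul (-1 : ℤ))).congr fun x _ => by
      change f x + (-1 : ℤ) • g x = f x - g x
      simp [sub_eq_add_neg]⟩⟩

instance : AddCommGroup (SmoothMap Ω F) :=
  DFunLike.coe_injective.addCommGroup _ rfl (fun _ _ => rfl) (fun _ => rfl) (fun _ _ => rfl)
    (fun _ _ => rfl) (fun _ _ => rfl)

/-- Evaluation of functions as an additive homomorphism. -/
def coeHom : SmoothMap Ω F →+ (Eu n → F) where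
  toFun f := f
  map_zero' := rfl
  map_add' _ _ := rfl

instance {R : Type*} [Semiring R] [Module R F] [SMulCommClass ℝ R F] [ContinuousConstSMul R F] :
    Module R (SmoothMap Ω F) :=
  DFunLike.coe_injective.module R coeHom (fun _ _ => rfl)

/-- The constant function `x ↦ v` on `Ω`. -/
noncomputable def const (Ω : Opens (Eu n)) (v : F) : SmoothMap Ω F :=
  mk' (fun _ => v) (IsSmoothOn.const Ω v)

/-- Composition `x ↦ T (f x)` with a continuous linear map. -/
def postcomp {G : Type*} [AddCommGroup G] [Module ℝ G] [TopologicalSpace G] (T : F →L[ℝ] G)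
    (f : SmoothMap Ω F) : SmoothMap Ω G where
  toFun x := T (f x)
  zero_off x hx := by rw [show f x = 0 from f.zero_off x hx, map_zero]
  smooth := f.smooth.comp_clm T

/-- The product `f • g` of a scalar smooth function `f` and a smooth function `g`. -/
instance {𝕜 : Type*} [NormedField 𝕜] [NormedSpace ℝ 𝕜] [Module 𝕜 F]
    [IsScalarTower ℝ 𝕜 F] [ContinuousSMul ℝ F] [ContinuousSMul 𝕜 F] [SMulCommClass ℝ 𝕜 F] :
    SMul (SmoothMap Ω 𝕜) (SmoothMap Ω F) :=
  ⟨fun f g => ⟨fun x => f x • g x,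
    fun x hx => by rw [show g x = 0 from g.zero_off x hx, smul_zero],
    f.smooth.smul g.smooth⟩⟩

end Algebra

section Topology

variable {n : ℕ} {Ω : Opens (Eu n)} {F : Type*} [AddCommGroup F] [Module ℝ F]
  [TopologicalSpace F]

/-- The partial derivative `∂ᵢ f ∈ C^∞(Ω, F)`; see `hasPartialsAt_pd`. -/
noncomputable def pd (i : Fin n) (f : SmoothMap Ω F) : SmoothMap Ω F :=
  mk' (Classical.choose f.smooth [i]) ⟨fun l => Classical.choose f.smooth (l ++ [i]), rfl,
    fun l x hx => (Classical.choose_spec f.smooth).2 (l ++ [i]) x hx⟩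

theorem hasPartialsAt_pd (f : SmoothMap Ω F) {x : Eu n} (hx : x ∈ Ω) :
    HasPartialsAt f (fun i => pd i f x) x := by
  have h := (Classical.choose_spec f.smooth).2 [] x hx
  rw [(Classical.choose_spec f.smooth).1] at h
  refine Eq.mp ?_ h
  congr 1
  funext i
  exact (mk'_apply hx).symm

/-- The iterated partial derivative `∂_{i₁} ⋯ ∂_{i_k} f`. -/
noncomputable def iteratedPd (l : List (Fin n)) (f : SmoothMap Ω F) : SmoothMap Ω F :=
  l.foldr pd f

variable [IsTopologicalAddGroup F] [ContinuousSMul ℝ F]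

/-- The restriction of `f` to `Ω` as a continuous map. -/
def toContinuousMap (f : SmoothMap Ω F) : C(Ω, F) where
  toFun x := f x
  continuous_toFun := continuous_iff_continuousAt.2 fun x =>
    ContinuousAt.comp (f := ((↑) : Ω → Eu n)) (g := f)
      (f.hasPartialsAt_pd x.2).continuousAt continuous_subtype_val.continuousAt

/-- The topology of `C^∞(Ω, F)`: uniform convergence on compact subsets of `Ω` of all iterated
partial derivatives (Mathlib's topology on `C(Ω, F)` is the compact-open topology). -/
noncomputable instance : TopologicalSpace (SmoothMap Ω F) :=
  ⨅ l : List (Fin n), TopologicalSpace.induced (fun f => (iteratedPd l f).toContinuousMap)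
    inferInstance

end Topology

end SmoothMap

/-! ## Test functions, distributions, smoothing kernels -/

section Spaces

variable {n : ℕ}

/-- `𝓓(Ω)`, the complex-valued test functions with Mathlib's LF topology. -/
abbrev TestFn (Ω : Opens (Eu n)) : Type := 𝓓(Ω, ℂ)

noncomputable instance (Ω : Opens (Eu n)) : ContinuousSMul ℂ (TestFn Ω) where
  continuous_smul := by
    have hI : Continuous fun φ : TestFn Ω => Complex.I • φ := by
      have h := (TestFunction.postcompCLM (Ω := Ω) (n := ⊤)
        (Complex.I • ContinuousLinearMap.id ℂ ℂ)).continuous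
      refine h.congr fun φ => ?_
      ext x
      simp
    have h : Continuous fun p : ℂ × TestFn Ω => p.1.re • p.2 + p.1.im • (Complex.I • p.2) :=
      ((Complex.continuous_re.comp continuous_fst).smul continuous_snd).add
        ((Complex.continuous_im.comp continuous_fst).smul (hI.comp continuous_snd))
    refine h.congr fun p => ?_
    ext x
    have hp : (p.1.re : ℂ) * p.2 x + p.1.im * (Complex.I * p.2 x) = p.1 * p.2 x := by
      rw [← mul_assoc, ← add_mul, Complex.re_add_im]
    simpa using hp

/-- `𝓓'(Ω)`, the continuous complex-linear forms on `𝓓(Ω)`, with the strong topology (uniform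
convergence on bounded subsets of `𝓓(Ω)`). -/
abbrev Distr (Ω : Opens (Eu n)) : Type := TestFn Ω →L[ℂ] ℂ

/-- `C^∞(Ω)`, the complex-valued smooth functions. -/
abbrev CInf (Ω : Opens (Eu n)) : Type := SmoothMap Ω ℂ

/-- `C^∞(Ω, ℝ)`. -/
abbrev RealCInf (Ω : Opens (Eu n)) : Type := SmoothMap Ω ℝ

/-- Smooth vector fields `X ∈ C^∞(Ω, ℝⁿ)`. -/
abbrev VectorField (Ω : Opens (Eu n)) : Type := SmoothMap Ω (Eu n)

/-- The space `SK(Ω) = C^∞(Ω, 𝓓(Ω))` of smoothing kernels. -/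
abbrev SK (Ω : Opens (Eu n)) : Type := SmoothMap Ω (TestFn Ω)

noncomputable instance (Ω : Opens (Eu n)) : ContinuousSMul ℝ (Distr Ω) :=
  IsScalarTower.continuousSMul ℂ

theorem HasPartialsAt.hasFDerivAt {G : Type*} [NormedAddCommGroup G] [NormedSpace ℝ G]
    {f : Eu n → G} {p : Fin n → G} {x : Eu n} (h : HasPartialsAt f p x) :
    HasFDerivAt f (∑ i, (EuclideanSpace.proj i : Eu n →L[ℝ] ℝ).smulRight (p i)) x := by
  rw [hasFDerivAt_iff_isLittleO_nhds_zero, ← Asymptotics.isLittleO_norm_norm,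
    Asymptotics.isLittleO_iff_tendsto (by
      intro h hh
      have : h = 0 := by simpa using hh
      simp [this])]
  have h0 : ∀ h : Eu n, (∑ i, (EuclideanSpace.proj i : Eu n →L[ℝ] ℝ).smulRight (p i)) h
      = ∑ i, h i • p i := fun h => by simp
  simp only [h0]
  rw [← nhdsNE_sup_pure]
  refine Tendsto.sup ?_ ?_
  · refine (tendsto_zero_iff_norm_tendsto_zero.1 h).congr fun h => ?_
    rw [norm_smul, norm_inv, norm_norm, inv_mul_eq_div]
  · rw [tendsto_pure_left]
    intro s hs
    simpa using mem_of_mem_nhds hs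

theorem IsSmoothOn.contDiffOn {G : Type*} [NormedAddCommGroup G] [NormedSpace ℝ G]
    {Ω : Opens (Eu n)} {f : Eu n → G} (hf : IsSmoothOn Ω f) : ContDiffOn ℝ ∞ f Ω := by
  obtain ⟨D, rfl, hD⟩ := hf
  refine contDiffOn_infty.2 fun k => ?_
  suffices H : ∀ (k : ℕ) (l : List (Fin n)), ContDiffOn ℝ k (D l) Ω from H k []
  intro k
  induction k with
  | zero =>
    intro l
    exact contDiffOn_zero.2 fun x hx =>
      (hD l x hx).hasFDerivAt.continuousAt.continuousWithinAt
  | succ k ih =>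
    intro l
    push_cast
    rw [contDiffOn_succ_iff_fderiv_of_isOpen Ω.isOpen]
    refine ⟨fun x hx => (hD l x hx).hasFDerivAt.differentiableAt.differentiableWithinAt,
      by simp, ?_⟩
    have h1 : ContDiffOn ℝ k (fun x => ∑ i, (EuclideanSpace.proj i : Eu n →L[ℝ] ℝ).smulRight
        (D (i :: l) x)) Ω :=
      ContDiffOn.sum fun i _ => contDiffOn_const.smulRight (ih (i :: l))
    exact h1.congr fun x hx => (hD l x hx).hasFDerivAt.fderiv

theorem contDiff_smul_of_tsupport {Ω : Opens (Eu n)} {G : Type*} [NormedAddCommGroup G]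
    [NormedSpace ℝ G] {f : Eu n → ℝ} {g : Eu n → G}
    (hf : ContDiffOn ℝ ∞ f Ω) (hg : ContDiff ℝ ∞ g) (hs : tsupport g ⊆ Ω) :
    ContDiff ℝ ∞ (fun y => f y • g y) := by
  rw [contDiff_iff_contDiffAt]
  intro x
  by_cases hx : x ∈ Ω
  · exact (hf.contDiffAt (Ω.isOpen.mem_nhds hx)).smul hg.contDiffAt
  · have hx' : x ∉ tsupport g := fun h => hx (hs h)
    have h0 : (fun y => f y • g y) =ᶠ[𝓝 x] fun _ => 0 := by
      filter_upwards [notMem_tsupport_iff_eventuallyEq.1 hx'] with y hy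
      simp [hy]
    exact contDiffAt_const.congr_of_eventuallyEq h0

theorem exists_cutoff {Ω : Opens (Eu n)} {K : Set (Eu n)} (hK : IsCompact K)
    (hKΩ : K ⊆ Ω) : ∃ χ : Eu n → ℝ, ContDiff ℝ ∞ χ ∧ tsupport χ ⊆ Ω ∧ ∀ x ∈ K, χ x = 1 := by
  obtain ⟨L, hL, hKL, hLΩ⟩ := exists_compact_between hK Ω.isOpen hKΩ
  obtain ⟨χ, h1, -, h3, h4⟩ := exists_contMDiff_support_eq_eq_one_iff
    (modelWithCornersSelf ℝ (Eu n)) (n := ⊤) isOpen_interior hK.isClosed hKL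
  refine ⟨χ, contMDiff_iff_contDiff.1 h1, ?_, fun x hx => (h4 x).1 hx⟩
  rw [tsupport, h3]
  exact (closure_minimal interior_subset hL.isClosed).trans hLΩ

/-- Multiplication of a test function by a real smooth function. -/
noncomputable def mulTestFn {Ω : Opens (Eu n)} (f : RealCInf Ω) (φ : TestFn Ω) : TestFn Ω where
  toFun y := f y • φ y
  contDiff' := contDiff_smul_of_tsupport f.smooth.contDiffOn φ.contDiff φ.tsupport_subset
  hasCompactSupport' := φ.hasCompactSupport.smul_left (f := fun y => f y)
  tsupport_subset' := (tsupport_smul_subset_right (fun y => f y) φ).trans φ.tsupport_subset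

/-- Multiplication by a real smooth function as a continuous linear map of `𝓓(Ω)`. -/
noncomputable def mulTestFnCLM {Ω : Opens (Eu n)} (f : RealCInf Ω) : TestFn Ω →L[ℂ] TestFn Ω :=
  TestFunction.limitCLM ℂ (mulTestFn f)
    (fun K hK => TestFunction.ofSupportedInCLM ℂ hK ∘L
      ContDiffMapSupportedIn.bilinLeftCLM (ContinuousLinearMap.mul ℂ ℂ)
        (g := fun y => ((f y • (exists_cutoff K.isCompact hK).choose y : ℝ) : ℂ))
        (Complex.ofRealCLM.contDiff.comp (contDiff_smul_of_tsupport f.smooth.contDiffOn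
          (exists_cutoff K.isCompact hK).choose_spec.1
          (exists_cutoff K.isCompact hK).choose_spec.2.1)))
    (fun K hK φ => by
      ext y
      change f y • φ y = φ y * ((f y • (exists_cutoff K.isCompact hK).choose y : ℝ) : ℂ)
      by_cases hy : y ∈ (K : Set (Eu n))
      · rw [(exists_cutoff K.isCompact hK).choose_spec.2.2 y hy]
        simp [mul_comm]
      · have h0 : φ y = 0 := φ.zero_on_compl hy
        simp [h0])

theorem mulTestFnCLM_apply {Ω : Opens (Eu n)} (f : RealCInf Ω) (φ : TestFn Ω) (y : Eu n) :
    mulTestFnCLM f φ y = f y • φ y := rfl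

/-- The regular distribution `φ ↦ ∫ φ f` of a smooth function; see `toDistr_apply`. -/
noncomputable def toDistr {Ω : Opens (Eu n)} (f : CInf Ω) : Distr Ω :=
  TestFunction.integralAgainstBilinCLM (ContinuousLinearMap.mul ℂ ℂ) MeasureTheory.volume f

theorem toDistr_apply {Ω : Opens (Eu n)} (f : CInf Ω) (φ : TestFn Ω) :
    toDistr f φ = ∫ x, φ x * f x := by
  have h : MeasureTheory.LocallyIntegrableOn (f : Eu n → ℂ) Ω MeasureTheory.volume :=
    f.smooth.contDiffOn.continuousOn.locallyIntegrableOn Ω.isOpen.measurableSet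
  exact TestFunction.integralAgainstBilinCLM_eq_integral h

end Spaces

/-! ## Smooth maps between locally convex spaces (convenient calculus) -/

section Convenient

variable {V W : Type*} [AddCommGroup V] [Module ℝ V] [TopologicalSpace V]
  [AddCommGroup W] [Module ℝ W] [TopologicalSpace W]

/-- A curve `c : ℝ → V` is smooth: its derivatives of all orders exist (as limits of difference
quotients in `V`). -/
def IsSmoothCurve (c : ℝ → V) : Prop :=
  ∃ D : ℕ → ℝ → V, D 0 = c ∧ ∀ k t,
    Tendsto (fun h : ℝ => h⁻¹ • (D k (t + h) - D k t)) (𝓝[≠] 0) (𝓝 (D (k + 1) t))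

/-- A map is smooth if it maps smooth curves to smooth curves. -/
def ConvSmooth (f : V → W) : Prop := ∀ c : ℝ → V, IsSmoothCurve c → IsSmoothCurve (f ∘ c)

/-- The differential `df(x)(v) = lim_{t → 0} t⁻¹ (f (x + t v) - f x)`. -/
noncomputable def differential (f : V → W) (x v : V) : W :=
  limUnder (𝓝[≠] (0 : ℝ)) fun t : ℝ => t⁻¹ • (f (x + t • v) - f x)

end Convenient

section Main

variable {n : ℕ} {Ω : Opens (Eu n)}

/-! ## The basic space and its subspaces -/

/-- The basic space `𝓔(Ω) = C^∞(SK(Ω), C^∞(Ω))`. -/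
def basE (Ω : Opens (Eu n)) : Set (SK Ω → CInf Ω) := {R | ConvSmooth R}

/-- `R` is local. -/
def IsLocal (R : SK Ω → CInf Ω) : Prop :=
  ∀ U : Opens (Eu n), U ≤ Ω → ∀ φ ψ : SK Ω, (∀ x ∈ U, φ x = ψ x) → ∀ x ∈ U, R φ x = R ψ x

/-- `R` is point-local. -/
def IsPointLocal (R : SK Ω → CInf Ω) : Prop :=
  ∀ x ∈ Ω, ∀ φ ψ : SK Ω, φ x = ψ x → R φ x = R ψ x

/-- `R` is point-independent. -/
def IsPointIndep (R : SK Ω → CInf Ω) : Prop :=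
  ∀ x ∈ Ω, ∀ y ∈ Ω, ∀ φ ψ : SK Ω, φ x = ψ y → R φ x = R ψ y

/-- `𝓔_loc(Ω)`. -/
def basEloc (Ω : Opens (Eu n)) : Set (SK Ω → CInf Ω) := {R | R ∈ basE Ω ∧ IsLocal R}

/-- `𝓔_ploc(Ω)`. -/
def basEploc (Ω : Opens (Eu n)) : Set (SK Ω → CInf Ω) := {R | R ∈ basE Ω ∧ IsPointLocal R}

/-- `𝓔_pi(Ω)`. -/
def basEpi (Ω : Opens (Eu n)) : Set (SK Ω → CInf Ω) := {R | R ∈ basE Ω ∧ IsPointIndep R}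

/-- `L(Ω)`, the continuous (complex-)linear maps `SK(Ω) → C^∞(Ω)`. -/
def basL (Ω : Opens (Eu n)) : Set (SK Ω → CInf Ω) := {R | ∃ T : SK Ω →L[ℂ] CInf Ω, ⇑T = R}

/-- `L_loc(Ω)`. -/
def basLloc (Ω : Opens (Eu n)) : Set (SK Ω → CInf Ω) := {R | R ∈ basL Ω ∧ IsLocal R}

/-- `L_ploc(Ω)`. -/
def basLploc (Ω : Opens (Eu n)) : Set (SK Ω → CInf Ω) := {R | R ∈ basL Ω ∧ IsPointLocal R}

/-- `L_pi(Ω)`. -/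
def basLpi (Ω : Opens (Eu n)) : Set (SK Ω → CInf Ω) := {R | R ∈ basL Ω ∧ IsPointIndep R}

/-- The `C^∞(Ω)`-linear elements of `L(Ω)`. -/
def basLCinf (Ω : Opens (Eu n)) : Set (SK Ω → CInf Ω) :=
  {R | R ∈ basL Ω ∧ ∀ (f : CInf Ω) (φ : SK Ω), R (f • φ) = f • R φ}

/-- `⟨u, φ⃗⟩ = [x ↦ ⟨u, φ⃗(x)⟩]`; as a function of `u` this is the smoothing operator
`Φ : 𝓓'(Ω) → C^∞(Ω)` which corresponds to the smoothing kernel `φ⃗`. -/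
noncomputable def pairing (u : Distr Ω) (φ : SK Ω) : CInf Ω := φ.postcomp (u.restrictScalars ℝ)

/-- The embedding `ι : 𝓓'(Ω) → 𝓔(Ω)`. -/
noncomputable def iota (u : Distr Ω) : SK Ω → CInf Ω := fun φ => pairing u φ

/-- The embedding `σ : C^∞(Ω) → 𝓔(Ω)`. -/
def sigma (f : CInf Ω) : SK Ω → CInf Ω := fun _ => f

/-! ## Lie derivatives -/

/-- The `i`-th component of a vector field. -/
noncomputable def component (i : Fin n) (X : VectorField Ω) : RealCInf Ω :=
  X.postcomp (EuclideanSpace.proj i : Eu n →L[ℝ] ℝ)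

/-- The divergence `∑ᵢ ∂ᵢ Xⁱ`. -/
noncomputable def divergence (X : VectorField Ω) : RealCInf Ω := ∑ i, SmoothMap.pd i (component i X)

/-- The directional derivative `L_X f = ∑ᵢ Xⁱ ∂ᵢ f` of `f ∈ C^∞(Ω, F)`. -/
noncomputable def lieDir {F : Type*} [AddCommGroup F] [Module ℝ F] [TopologicalSpace F]
    [IsTopologicalAddGroup F] [ContinuousSMul ℝ F] (X : VectorField Ω) (f : SmoothMap Ω F) :
    SmoothMap Ω F :=
  ∑ i, component i X • SmoothMap.pd i f

/-- The `n`-form derivative `L_X φ = ∑ᵢ Xⁱ ∂ᵢ φ + (div X) φ` of test functions. -/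
noncomputable def lieForm (X : VectorField Ω) : TestFn Ω →L[ℂ] TestFn Ω :=
  (∑ i, mulTestFnCLM (component i X) ∘L
    TestFunction.lineDerivCLM ℂ (EuclideanSpace.single i (1 : ℝ))) + mulTestFnCLM (divergence X)

/-- The Lie derivative `L_X^SK φ⃗ = L_X φ⃗ + L_X ∘ φ⃗` of smoothing kernels. -/
noncomputable def lieSK (X : VectorField Ω) (φ : SK Ω) : SK Ω :=
  lieDir X φ + φ.postcomp ((lieForm X).restrictScalars ℝ)

/-- The geometric Lie derivative
`(L̂_X R)(φ⃗) = -dR(φ⃗)(L_X^SK φ⃗) + L_X (R(φ⃗))`. -/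
noncomputable def lieHat (X : VectorField Ω) (R : SK Ω → CInf Ω) : SK Ω → CInf Ω :=
  fun φ => -differential R φ (lieSK X φ) + lieDir X (R φ)

/-- The componentwise Lie derivative `L̃_X R = L_X ∘ R`. -/
noncomputable def lieTilde (X : VectorField Ω) (R : SK Ω → CInf Ω) : SK Ω → CInf Ω :=
  fun φ => lieDir X (R φ)

/-- `L̂_X` on maps `𝓓(Ω) → C^∞(Ω)`. -/
noncomputable def lieHatPloc (X : VectorField Ω) (S : TestFn Ω → CInf Ω) : TestFn Ω → CInf Ω :=
  fun φ => -differential S φ (lieForm X φ) + lieDir X (S φ)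

/-- `L̂_X` on functions `𝓓(Ω) → ℂ`. -/
noncomputable def lieHatPi (X : VectorField Ω) (S : TestFn Ω → ℂ) : TestFn Ω → ℂ :=
  fun φ => -differential S φ (lieForm X φ)

/-- `L̂_X` on distributions: `⟨L̂_X u, φ⟩ = -⟨u, L_X φ⟩`. -/
noncomputable def lieHatDistr (X : VectorField Ω) (u : Distr Ω) : Distr Ω := -(u ∘L lieForm X)

/-- `L̂_X` on `C^∞(Ω, 𝓓'(Ω))`: `(L̂_X S)(x)(φ) = -⟨S(x), L_X φ⟩ + ⟨(L_X S)(x), φ⟩`. -/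
noncomputable def lieHatKer (X : VectorField Ω) (S : SmoothMap Ω (Distr Ω)) :
    SmoothMap Ω (Distr Ω) :=
  -S.postcomp (((lieForm X).precomp ℂ).restrictScalars ℝ) + lieDir X S

/-! ## Isomorphisms and convergence of smoothing operators -/

/-- The relation `C` is (the graph of) a bijection between `A` and `B`. -/
def IsCorrespondence {α β : Type*} (A : Set α) (B : Set β) (C : α → β → Prop) : Prop :=
  (∀ a ∈ A, ∃! b, b ∈ B ∧ C a b) ∧ ∀ b ∈ B, ∃! a, a ∈ A ∧ C a b

/-- The bijection `C` between `A` and `B` commutes with the operators `S` on `A` and `T` on `B`. -/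
def CorrespondenceCommutes {α β : Type*} (A : Set α) (B : Set β) (C : α → β → Prop)
    (S : α → α) (T : β → β) : Prop :=
  IsCorrespondence A B C ∧ (∀ a ∈ A, S a ∈ A) ∧ (∀ b ∈ B, T b ∈ B) ∧
    ∀ a ∈ A, ∀ b ∈ B, C a b → C (S a) (T b)

/-- The smoothing operators `Φ_k` given by the smoothing kernels `φ⃗_k` converge to the identity in
`𝓛_b(𝓓'(Ω), 𝓓'(Ω))`, that is, uniformly on bounded subsets of `𝓓'(Ω)`. -/
def OperatorsTendToId (φ : ℕ → SK Ω) : Prop :=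
  ∀ B : Set (Distr Ω), Bornology.IsVonNBounded ℂ B →
    TendstoUniformlyOn (fun k u => toDistr (pairing u (φ k))) id atTop B

end Main

end Colombeau

open Colombeau

/-! The algebraic core is one cancellation. If `R(φ⃗)(x) = S(φ⃗(x))(x)`, the variable `x` enters
through the kernel and through the point of evaluation. The chain rule therefore puts `dS(φ⃗(x))(Xⁱ
∂ᵢφ⃗(x))` into `L_X(R(φ⃗))(x)`, and the summand `L_X φ⃗` of `L_X^SK φ⃗` contributes the same terms
with the opposite sign. What survives is `L̂_X S` at `φ⃗(x)`, which again depends on `φ⃗(x)` only.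
This gives invariance and commutation together; see `lieHat_ploc`, `lieHat_kernel` and
`lieHat_iota`. Plain locality is preserved because difference quotients and partial derivatives are
local.

The analytic work lies in the correspondences. From `R` one recovers `S` on constant kernels.
Conversely `S(φ⃗(x))(x)` must be smooth in `x` and in `φ⃗`, while smoothness of `S` is tested on
curves only. The tool is Boman's theorem `contDiffOn_of_curves`: smoothness along smooth curves
implies smoothness on open subsets of finite-dimensional spaces. With `isSmoothCurve_of_contDiffOn`,
which turns functions of `(t, x)` into curves of functions, it yields smoothness of `plocMap`,
linearity of scalar differentials and `ConvSmooth.differential_curve`. Hadamard's lemma for curves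
adds the chain rule. Boman's theorem itself rests on curves that pass through prescribed points at
prescribed speeds: they force directional derivatives to be locally bounded. Finite differences then
give rapid decay of the Fourier transform, and Fourier inversion gives smoothness.

For linear maps, a smooth `S` with values in `𝓓'(Ω)` acts continuously because it is bounded on
compact sets and bounded linear maps on `𝓓(Ω)` are continuous. Conversely, Taylor estimates that are
uniform on bounded sets make the kernel of an operator smooth for the strong topology. A
`C^∞(Ω)`-linear operator is point-local by a dilation argument: the derivative of a dilated kernel
in the dilation factor is a combination of kernels with coefficients vanishing at the centre.

The statements on `L̃_X` hold because `L_X` is a continuous local operator. The negative statements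
are tested on Dirac distributions and constant kernels. For the last assertion, integration by parts
shows that `L_X` on smooth functions corresponds to `L̂_X` on distributions, so both `L̂_X(Φ_k u)`
and `Φ_k(L̂_X u)` tend to `L̂_X u`. -/

set_option linter.unusedSectionVars false

namespace Colombeau

/-! ## Differentiable curves in topological vector spaces -/

section Curves

variable {V W : Type*} [AddCommGroup V] [Module ℝ V] [TopologicalSpace V]
  [AddCommGroup W] [Module ℝ W] [TopologicalSpace W]

/-- The curve `c` has derivative `v` at `t`. -/
def HasCurveDeriv (c : ℝ → V) (v : V) (t : ℝ) : Prop :=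
  Tendsto (fun h : ℝ => h⁻¹ • (c (t + h) - c t)) (𝓝[≠] 0) (𝓝 v)

/-- Carathéodory's characterization of differentiability. -/
theorem hasCurveDeriv_iff_exists {c : ℝ → V} {v : V} {t : ℝ} :
    HasCurveDeriv c v t ↔ ∃ q : ℝ → V, ContinuousAt q 0 ∧ q 0 = v ∧
      ∀ h, c (t + h) - c t = h • q h := by
  constructor
  · intro H
    refine ⟨Function.update (fun h : ℝ => h⁻¹ • (c (t + h) - c t)) 0 v, ?_, by simp, fun h => ?_⟩
    · rwa [continuousAt_update_same]
    · by_cases hh : h = 0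
      · simp [hh]
      · rw [Function.update_of_ne hh, smul_smul, mul_inv_cancel₀ hh, one_smul]
  · rintro ⟨q, hq, rfl, h⟩
    refine (hq.tendsto.mono_left nhdsWithin_le_nhds).congr' ?_
    filter_upwards [self_mem_nhdsWithin] with s hs
    have hs' : s ≠ 0 := hs
    rw [h, smul_smul, inv_mul_cancel₀ hs', one_smul]

theorem HasCurveDeriv.unique [T2Space V] {c : ℝ → V} {v w : V} {t : ℝ} (hv : HasCurveDeriv c v t)
    (hw : HasCurveDeriv c w t) : v = w := tendsto_nhds_unique hv hw

theorem HasCurveDeriv.congr {c d : ℝ → V} {v : V} {t : ℝ} (hc : HasCurveDeriv c v t)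
    (h : c =ᶠ[𝓝 t] d) : HasCurveDeriv d v t := by
  refine Tendsto.congr' ?_ hc
  have h1 : Tendsto (fun s : ℝ => t + s) (𝓝[≠] 0) (𝓝 t) := by
    have : Tendsto (fun s : ℝ => t + s) (𝓝 0) (𝓝 (t + 0)) :=
      (continuous_const.add continuous_id).tendsto 0
    rw [add_zero] at this
    exact this.mono_left nhdsWithin_le_nhds
  filter_upwards [h1.eventually h] with s hs
  rw [hs, h.eq_of_nhds]

theorem hasCurveDeriv_iff_hasDerivAt {G : Type*} [NormedAddCommGroup G] [NormedSpace ℝ G]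
    {c : ℝ → G} {v : G} {t : ℝ} : HasCurveDeriv c v t ↔ HasDerivAt c v t :=
  hasDerivAt_iff_tendsto_slope_zero.symm

theorem HasCurveDeriv.const (v : V) (t : ℝ) : HasCurveDeriv (fun _ => v) 0 t := by
  simpa [HasCurveDeriv] using tendsto_const_nhds

theorem HasCurveDeriv.clm {c : ℝ → V} {v : V} {t : ℝ} (T : V →L[ℝ] W) (hc : HasCurveDeriv c v t) :
    HasCurveDeriv (fun s => T (c s)) (T v) t := by
  refine ((T.continuous.tendsto v).comp hc).congr fun h => ?_
  simp

variable [IsTopologicalAddGroup V]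

theorem HasCurveDeriv.add {c d : ℝ → V} {v w : V} {t : ℝ} (hc : HasCurveDeriv c v t)
    (hd : HasCurveDeriv d w t) : HasCurveDeriv (fun s => c s + d s) (v + w) t := by
  refine (Tendsto.add hc hd).congr fun h => ?_
  simp only [smul_add, smul_sub]
  abel

variable [ContinuousSMul ℝ V]

theorem HasCurveDeriv.continuousAt {c : ℝ → V} {v : V} {t : ℝ} (hc : HasCurveDeriv c v t) :
    ContinuousAt c t := by
  obtain ⟨q, hq, -, h⟩ := hasCurveDeriv_iff_exists.1 hc
  have e : c = fun s => c t + (s - t) • q (s - t) := by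
    funext s
    rw [← h]
    simp
  have h0 : ContinuousAt (fun s : ℝ => s - t) t := by fun_prop
  have h1 : ContinuousAt (fun s : ℝ => q (s - t)) t :=
    ContinuousAt.comp (g := q) (by rwa [sub_self]) h0
  rw [e]
  exact continuousAt_const.add (h0.smul h1)

theorem HasCurveDeriv.smul {a : ℝ → ℝ} {a' : ℝ} {c : ℝ → V} {v : V} {t : ℝ} (ha : HasDerivAt a a' t)
    (hc : HasCurveDeriv c v t) : HasCurveDeriv (fun s => a s • c s) (a' • c t + a t • v) t := by
  have h1 : Tendsto (fun h : ℝ => a (t + h)) (𝓝[≠] 0) (𝓝 (a t)) := by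
    have : Tendsto (fun h : ℝ => t + h) (𝓝[≠] 0) (𝓝 t) := by
      have : Tendsto (fun s : ℝ => t + s) (𝓝 0) (𝓝 (t + 0)) :=
        (continuous_const.add continuous_id).tendsto 0
      rw [add_zero] at this
      exact this.mono_left nhdsWithin_le_nhds
    exact ha.continuousAt.tendsto.comp this
  have h2 := (hasDerivAt_iff_tendsto_slope_zero.1 ha).smul_const (c t)
  refine (h2.add (h1.smul hc)).congr fun h => ?_
  rw [smul_comm (a (t + h)), smul_assoc, ← smul_add, sub_smul, smul_sub]
  congr 1
  abel

/-- The increment `a (t + h) - a t` may vanish for `h ≠ 0`, so the outer difference quotient cannot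
be used directly; the Carathéodory factor is defined there too. -/
theorem HasCurveDeriv.comp {a : ℝ → ℝ} {a' : ℝ} {c : ℝ → V} {v : V} {t : ℝ}
    (ha : HasDerivAt a a' t) (hc : HasCurveDeriv c v (a t)) :
    HasCurveDeriv (fun s => c (a s)) (a' • v) t := by
  obtain ⟨q, hq, rfl, h⟩ := hasCurveDeriv_iff_exists.1 hc
  have h2 := hasDerivAt_iff_tendsto_slope_zero.1 ha
  have h1 : Tendsto (fun h : ℝ => a (t + h) - a t) (𝓝[≠] 0) (𝓝 0) := by
    have : Tendsto (fun h : ℝ => t + h) (𝓝[≠] 0) (𝓝 t) := by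
      have : Tendsto (fun s : ℝ => t + s) (𝓝 0) (𝓝 (t + 0)) :=
        (continuous_const.add continuous_id).tendsto 0
      rw [add_zero] at this
      exact this.mono_left nhdsWithin_le_nhds
    simpa using (ha.continuousAt.tendsto.comp this).sub_const (a t)
  refine (h2.smul (hq.tendsto.comp h1)).congr fun s => ?_
  have := h (a (t + s) - a t)
  rw [add_sub_cancel] at this
  rw [this, smul_assoc]
  rfl

/-! ### Curves of class `C^k` -/

/-- Curves of class `C^k`. -/
def IsCk : ℕ → (ℝ → V) → Prop
  | 0, c => Continuous c
  | k + 1, c => ∃ d : ℝ → V, (∀ t, HasCurveDeriv c (d t) t) ∧ IsCk k d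

theorem IsCk.continuous {k : ℕ} {c : ℝ → V} (hc : IsCk k c) : Continuous c := by
  cases k with
  | zero => exact hc
  | succ k =>
    obtain ⟨d, hd, -⟩ := hc
    exact continuous_iff_continuousAt.2 fun t => (hd t).continuousAt

theorem IsCk.of_succ {k : ℕ} {c : ℝ → V} (hc : IsCk (k + 1) c) : IsCk k c := by
  induction k generalizing c with
  | zero => exact hc.continuous
  | succ k ih =>
    obtain ⟨d, hd, hd'⟩ := hc
    exact ⟨d, hd, ih hd'⟩

theorem IsSmoothCurve.isCk {c : ℝ → V} (hc : IsSmoothCurve c) (k : ℕ) : IsCk k c := by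
  obtain ⟨D, rfl, hD⟩ := hc
  suffices H : ∀ j, IsCk k (D j) from H 0
  induction k with
  | zero => exact fun j => continuous_iff_continuousAt.2 fun t =>
      HasCurveDeriv.continuousAt (hD j t)
  | succ k ih => exact fun j => ⟨D (j + 1), hD j, ih _⟩

/-- A family of curves which is closed under differentiation consists of smooth curves. -/
theorem IsSmoothCurve.of_closed (P : (ℝ → V) → Prop)
    (hP : ∀ c, P c → ∃ d, P d ∧ ∀ t, HasCurveDeriv c (d t) t) {c : ℝ → V} (hc : P c) :
    IsSmoothCurve c := by
  choose! d hd hd' using hP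
  have H : ∀ k, P (d^[k] c) := fun k => by
    induction k with
    | zero => exact hc
    | succ k ih =>
      rw [Function.iterate_succ_apply']
      exact hd _ ih
  refine ⟨fun k => d^[k] c, rfl, fun k t => ?_⟩
  beta_reduce
  rw [Function.iterate_succ_apply']
  exact hd' _ (H k) t

/-- Each order may come with its own derivative, but derivatives are unique in a Hausdorff space.
Thus products and compositions can be treated by induction on the order, without closed formulas for
higher derivatives. -/
theorem isSmoothCurve_of_isCk [T2Space V] {c : ℝ → V} (hc : ∀ k, IsCk k c) : IsSmoothCurve c := by
  refine IsSmoothCurve.of_closed (fun c => ∀ k, IsCk k c) (fun c hc => ?_) hc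
  obtain ⟨d, hd, -⟩ := hc 1
  refine ⟨d, fun k => ?_, hd⟩
  obtain ⟨d', hd', hk⟩ := hc (k + 1)
  have : d = d' := funext fun t => (hd t).unique (hd' t)
  rwa [this]

theorem IsSmoothCurve.exists_deriv {c : ℝ → V} (hc : IsSmoothCurve c) :
    ∃ d : ℝ → V, IsSmoothCurve d ∧ ∀ t, HasCurveDeriv c (d t) t := by
  obtain ⟨D, rfl, hD⟩ := hc
  exact ⟨D 1, ⟨fun k => D (k + 1), rfl, fun k => hD (k + 1)⟩, hD 0⟩

theorem IsCk.add {k : ℕ} {c d : ℝ → V} (hc : IsCk k c) (hd : IsCk k d) :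
    IsCk k (fun t => c t + d t) := by
  induction k generalizing c d with
  | zero => exact Continuous.add hc hd
  | succ k ih =>
    obtain ⟨c', h1, h2⟩ := hc
    obtain ⟨d', h3, h4⟩ := hd
    exact ⟨_, fun t => (h1 t).add (h3 t), ih h2 h4⟩

theorem IsCk.zero (k : ℕ) : IsCk k (fun _ : ℝ => (0 : V)) := by
  induction k with
  | zero => exact continuous_const
  | succ k ih => exact ⟨_, fun t => HasCurveDeriv.const 0 t, ih⟩

theorem IsCk.sum {ι : Type*} (s : Finset ι) {k : ℕ} {c : ι → ℝ → V} (h : ∀ i ∈ s, IsCk k (c i)) :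
    IsCk k (fun t => ∑ i ∈ s, c i t) := by
  classical
  induction s using Finset.induction_on with
  | empty => simpa using IsCk.zero k
  | insert a s ha ih =>
    simp only [Finset.sum_insert ha]
    exact (h a (by simp)).add (ih fun i hi => h i (by simp [hi]))

theorem hasDerivAt_of_contDiff {a : ℝ → ℝ} (ha : ContDiff ℝ ∞ a) (t : ℝ) :
    HasDerivAt a (deriv a t) t :=
  ((ha.differentiable (by simp)) t).hasDerivAt

theorem contDiff_deriv_infty {G : Type*} [NormedAddCommGroup G] [NormedSpace ℝ G] {a : ℝ → G}
    (ha : ContDiff ℝ ∞ a) : ContDiff ℝ ∞ (deriv a) :=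
  (contDiff_infty_iff_deriv.1 ha).2

theorem IsCk.smul {k : ℕ} {a : ℝ → ℝ} {c : ℝ → V} (ha : ContDiff ℝ ∞ a) (hc : IsCk k c) :
    IsCk k (fun t => a t • c t) := by
  induction k generalizing a c with
  | zero => exact ha.continuous.smul hc
  | succ k ih =>
    have hc' := hc.of_succ
    obtain ⟨d, h1, h2⟩ := hc
    exact ⟨_, fun t => (h1 t).smul (hasDerivAt_of_contDiff ha t),
      (ih (contDiff_deriv_infty ha) hc').add (ih ha h2)⟩

theorem IsCk.comp {k : ℕ} {a : ℝ → ℝ} {c : ℝ → V} (ha : ContDiff ℝ ∞ a) (hc : IsCk k c) :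
    IsCk k (fun t => c (a t)) := by
  induction k generalizing c with
  | zero => exact Continuous.comp hc ha.continuous
  | succ k ih =>
    obtain ⟨d, h1, h2⟩ := hc
    exact ⟨_, fun t => (h1 _).comp (hasDerivAt_of_contDiff ha t),
      (ih h2).smul (contDiff_deriv_infty ha)⟩

theorem IsSmoothCurve.clm {c : ℝ → V} (T : V →L[ℝ] W) (hc : IsSmoothCurve c) :
    IsSmoothCurve (fun t => T (c t)) := by
  obtain ⟨D, rfl, hD⟩ := hc
  exact ⟨fun k t => T (D k t), rfl, fun k t => HasCurveDeriv.clm T (hD k t)⟩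

theorem IsSmoothCurve.add {c d : ℝ → V} (hc : IsSmoothCurve c) (hd : IsSmoothCurve d) :
    IsSmoothCurve (fun t => c t + d t) := by
  obtain ⟨D, rfl, hD⟩ := hc
  obtain ⟨D', rfl, hD'⟩ := hd
  exact ⟨fun k t => D k t + D' k t, rfl, fun k t => HasCurveDeriv.add (hD k t) (hD' k t)⟩

theorem IsSmoothCurve.const (v : V) : IsSmoothCurve (fun _ : ℝ => v) :=
  IsSmoothCurve.of_closed (fun c => ∃ v, c = fun _ => v)
    (by rintro _ ⟨v, rfl⟩; exact ⟨fun _ => 0, ⟨0, rfl⟩, HasCurveDeriv.const v⟩) ⟨v, rfl⟩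

theorem IsSmoothCurve.smul [T2Space V] {a : ℝ → ℝ} {c : ℝ → V} (ha : ContDiff ℝ ∞ a)
    (hc : IsSmoothCurve c) : IsSmoothCurve (fun t => a t • c t) :=
  isSmoothCurve_of_isCk fun k => (hc.isCk k).smul ha

theorem IsSmoothCurve.comp [T2Space V] {a : ℝ → ℝ} {c : ℝ → V} (ha : ContDiff ℝ ∞ a)
    (hc : IsSmoothCurve c) : IsSmoothCurve (fun t => c (a t)) :=
  isSmoothCurve_of_isCk fun k => (hc.isCk k).comp ha

theorem isCk_iff_contDiff {G : Type*} [NormedAddCommGroup G] [NormedSpace ℝ G] {k : ℕ} {c : ℝ → G} :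
    IsCk k c ↔ ContDiff ℝ k c := by
  induction k generalizing c with
  | zero => exact contDiff_zero.symm
  | succ k ih =>
    push_cast
    rw [contDiff_succ_iff_deriv]
    constructor
    · rintro ⟨d, h1, h2⟩
      have h1' := fun t => hasCurveDeriv_iff_hasDerivAt.1 (h1 t)
      refine ⟨fun t => (h1' t).differentiableAt, by simp, ?_⟩
      rw [show deriv c = d from funext fun t => (h1' t).deriv]
      exact ih.1 h2
    · rintro ⟨h1, -, h2⟩
      exact ⟨deriv c, fun t => hasCurveDeriv_iff_hasDerivAt.2 (h1 t).hasDerivAt, ih.2 h2⟩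

theorem isSmoothCurve_iff_contDiff {G : Type*} [NormedAddCommGroup G] [NormedSpace ℝ G]
    {c : ℝ → G} : IsSmoothCurve c ↔ ContDiff ℝ ∞ c :=
  ⟨fun h => contDiff_infty.2 fun k => isCk_iff_contDiff.1 (h.isCk k),
    fun h => isSmoothCurve_of_isCk fun k => isCk_iff_contDiff.2 (contDiff_infty.1 h k)⟩

/-- The mean value theorem in a locally convex space. -/
theorem mean_value_mem [LocallyConvexSpace ℝ V] {C : Set V} (hC : Convex ℝ C) (hC' : IsClosed C)
    {c d : ℝ → V} {a b : ℝ} (hab : a < b) (hc : ContinuousOn c (Set.Icc a b))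
    (hd : ∀ t ∈ Set.Ioo a b, HasCurveDeriv c (d t) t) (h : ∀ t ∈ Set.Ioo a b, d t ∈ C) :
    (b - a)⁻¹ • (c b - c a) ∈ C := by
  by_contra hn
  -- A functional separating the slope from `C` reduces the claim to the scalar mean value theorem.
  obtain ⟨f, u, h1, h2⟩ := geometric_hahn_banach_closed_point hC hC' hn
  obtain ⟨t, ht, e⟩ := exists_hasDerivAt_eq_slope (fun s => f (c s)) (fun s => f (d s)) hab
    (f.continuous.comp_continuousOn hc)
    (fun t ht => hasCurveDeriv_iff_hasDerivAt.1 ((hd t ht).clm f))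
  have h3 := h1 _ (h t ht)
  rw [e] at h3
  rw [map_smul, map_sub, smul_eq_mul, inv_mul_eq_div] at h2
  exact lt_asymm h2 h3

end Curves

/-! ## The topology of `C^∞(Ω, F)` -/

namespace SmoothMap

section Apply

variable {n : ℕ} {Ω : Opens (Eu n)} {F : Type*} [AddCommGroup F] [Module ℝ F]
  [TopologicalSpace F] [IsTopologicalAddGroup F]

theorem add_apply (f g : SmoothMap Ω F) (x : Eu n) : (f + g) x = f x + g x := rfl
theorem sub_apply (f g : SmoothMap Ω F) (x : Eu n) : (f - g) x = f x - g x := rfl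
theorem neg_apply (f : SmoothMap Ω F) (x : Eu n) : (-f) x = -f x := rfl
theorem zero_apply (x : Eu n) : (0 : SmoothMap Ω F) x = 0 := rfl

theorem const_smul_apply {R : Type*} [Monoid R] [DistribMulAction R F] [SMulCommClass ℝ R F]
    [ContinuousConstSMul R F] (c : R) (f : SmoothMap Ω F) (x : Eu n) : (c • f) x = c • f x := rfl

theorem smul_apply {𝕜 : Type*} [NormedField 𝕜] [NormedSpace ℝ 𝕜] [Module 𝕜 F]
    [IsScalarTower ℝ 𝕜 F] [ContinuousSMul ℝ F] [ContinuousSMul 𝕜 F] [SMulCommClass ℝ 𝕜 F]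
    (f : SmoothMap Ω 𝕜) (g : SmoothMap Ω F) (x : Eu n) : (f • g) x = f x • g x := rfl

theorem sum_apply {ι : Type*} (s : Finset ι) (f : ι → SmoothMap Ω F) (x : Eu n) :
    (∑ i ∈ s, f i) x = ∑ i ∈ s, f i x := by
  have := map_sum (coeHom (Ω := Ω) (F := F)) f s
  have h := congrFun this x
  rw [Finset.sum_apply] at h
  exact h

theorem list_sum_apply {ι : Type*} (s : List ι) (f : ι → SmoothMap Ω F) (x : Eu n) :
    (s.map f).sum x = (s.map fun a => f a x).sum := by
  induction s with
  | nil => rfl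
  | cons a s ih => simp only [List.map_cons, List.sum_cons, add_apply, ih]

theorem postcomp_apply {G : Type*} [AddCommGroup G] [Module ℝ G] [TopologicalSpace G]
    (T : F →L[ℝ] G) (f : SmoothMap Ω F) (x : Eu n) : postcomp T f x = T (f x) := rfl

theorem const_apply (v : F) {x : Eu n} (hx : x ∈ Ω) : const Ω v x = v := mk'_apply hx

theorem apply_of_notMem (f : SmoothMap Ω F) {x : Eu n} (hx : x ∉ Ω) : f x = 0 := f.zero_off x hx

instance {R S : Type*} [Semiring R] [Semiring S] [Module R F] [Module S F] [SMulCommClass ℝ R F]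
    [SMulCommClass ℝ S F] [ContinuousConstSMul R F] [ContinuousConstSMul S F] [SMul R S]
    [IsScalarTower R S F] : IsScalarTower R S (SmoothMap Ω F) :=
  ⟨fun a b f => DFunLike.ext _ _ fun x => smul_assoc a b (f x)⟩

end Apply

section Derivatives

variable {n : ℕ} {Ω : Opens (Eu n)} {F : Type*} [AddCommGroup F] [Module ℝ F]
  [TopologicalSpace F] [IsTopologicalAddGroup F] [ContinuousSMul ℝ F] [T2Space F]

/-- `pd` comes from an arbitrary choice of derivative family; the Hausdorff property lets any
partial derivatives compute it. -/
theorem pd_apply_eq {f : SmoothMap Ω F} {p : Fin n → F} {x : Eu n} (hx : x ∈ Ω)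
    (h : HasPartialsAt f p x) (i : Fin n) : pd i f x = p i :=
  congrFun ((f.hasPartialsAt_pd hx).unique h) i

theorem iteratedPd_nil (f : SmoothMap Ω F) : iteratedPd [] f = f := rfl

theorem iteratedPd_cons (i : Fin n) (l : List (Fin n)) (f : SmoothMap Ω F) :
    iteratedPd (i :: l) f = pd i (iteratedPd l f) := rfl

theorem iteratedPd_append (l l' : List (Fin n)) (f : SmoothMap Ω F) :
    iteratedPd (l ++ l') f = iteratedPd l (iteratedPd l' f) := List.foldr_append

/-- The iterated partial derivatives are the members of any family of iterated derivatives. -/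
theorem iteratedPd_apply_eq {f : SmoothMap Ω F} {D : List (Fin n) → Eu n → F}
    (h0 : ∀ x ∈ Ω, f x = D [] x)
    (h : ∀ l, ∀ x ∈ Ω, HasPartialsAt (D l) (fun i => D (i :: l) x) x) (l : List (Fin n)) :
    ∀ x ∈ Ω, iteratedPd l f x = D l x := by
  induction l with
  | nil => exact h0
  | cons i l ih =>
    intro x hx
    rw [iteratedPd_cons]
    refine pd_apply_eq (p := fun i => D (i :: l) x) hx ((h l x hx).congr ?_) i
    filter_upwards [Ω.isOpen.mem_nhds hx] with y hy
    exact (ih y hy).symm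

theorem pd_add (i : Fin n) (f g : SmoothMap Ω F) : pd i (f + g) = pd i f + pd i g :=
  ext_on fun x hx => by
    have h := (f.hasPartialsAt_pd hx).add (g.hasPartialsAt_pd hx)
    exact pd_apply_eq (f := f + g) (p := fun i => pd i f x + pd i g x) hx h i

theorem pd_const_smul {R : Type*} [Monoid R] [DistribMulAction R F] [SMulCommClass ℝ R F]
    [ContinuousConstSMul R F] (c : R) (i : Fin n) (f : SmoothMap Ω F) :
    pd i (c • f) = c • pd i f :=
  ext_on fun x hx => by
    have h := (f.hasPartialsAt_pd hx).const_smul c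
    exact pd_apply_eq (f := c • f) (p := fun i => c • pd i f x) hx h i

theorem pd_const (i : Fin n) (v : F) : pd i (const Ω v) = 0 :=
  ext_on fun x hx => pd_apply_eq (p := fun _ => 0) hx ((HasPartialsAt.const v x).congr (by
    filter_upwards [Ω.isOpen.mem_nhds hx] with y hy
    exact (const_apply v hy).symm)) i

theorem pd_postcomp {G : Type*} [AddCommGroup G] [Module ℝ G] [TopologicalSpace G]
    [IsTopologicalAddGroup G] [ContinuousSMul ℝ G] [T2Space G]
    (T : F →L[ℝ] G) (i : Fin n) (f : SmoothMap Ω F) :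
    pd i (postcomp T f) = postcomp T (pd i f) :=
  ext_on fun x hx => by
    have h := (f.hasPartialsAt_pd hx).comp_clm T
    exact pd_apply_eq (f := postcomp T f) (p := fun i => T (pd i f x)) hx h i

theorem pd_smul {𝕜 : Type*} [NormedField 𝕜] [NormedSpace ℝ 𝕜] [Module 𝕜 F]
    [IsScalarTower ℝ 𝕜 F] [ContinuousSMul 𝕜 F] [SMulCommClass ℝ 𝕜 F]
    (i : Fin n) (f : SmoothMap Ω 𝕜) (g : SmoothMap Ω F) :
    pd i (f • g) = pd i f • g + f • pd i g :=
  ext_on fun x hx => by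
    have h := (f.hasPartialsAt_pd hx).smul (g.hasPartialsAt_pd hx)
    exact pd_apply_eq (f := f • g) (p := fun i => pd i f x • g x + f x • pd i g x) hx h i

theorem pd_congr {f g : SmoothMap Ω F} {U : Opens (Eu n)} (hU : U ≤ Ω) (h : ∀ x ∈ U, f x = g x)
    (i : Fin n) {x : Eu n} (hx : x ∈ U) : pd i f x = pd i g x :=
  pd_apply_eq (hU hx) ((g.hasPartialsAt_pd (hU hx)).congr (by
    filter_upwards [U.isOpen.mem_nhds hx] with y hy
    exact (h y hy).symm)) i

variable {𝕜 : Type*} [NormedField 𝕜] [Module 𝕜 F] [SMulCommClass ℝ 𝕜 F] [ContinuousSMul 𝕜 F]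

variable (𝕜) in
/-- Iterated partial derivatives as linear maps to continuous maps. -/
noncomputable def derivMap (l : List (Fin n)) : SmoothMap Ω F →ₗ[𝕜] C(Ω, F) where
  toFun f := (iteratedPd l f).toContinuousMap
  map_add' f g := by
    have : iteratedPd l (f + g) = iteratedPd l f + iteratedPd l g := by
      induction l with
      | nil => rfl
      | cons i l ih => rw [iteratedPd_cons, ih, pd_add]; rfl
    rw [this]
    rfl
  map_smul' c f := by
    have : iteratedPd l (c • f) = c • iteratedPd l f := by
      induction l with
      | nil => rfl
      | cons i l ih => rw [iteratedPd_cons, ih, pd_const_smul]; rfl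
    rw [this]
    rfl

/-- The topology is an infimum of topologies induced by linear maps into `C(Ω, F)`, so it inherits
compatibility with the vector space operations. -/
instance : IsTopologicalAddGroup (SmoothMap Ω F) :=
  topologicalAddGroup_iInf fun l =>
    topologicalAddGroup_induced (derivMap ℝ l : SmoothMap Ω F →ₗ[ℝ] C(Ω, F))

instance : ContinuousSMul 𝕜 (SmoothMap Ω F) :=
  continuousSMul_iInf fun l =>
    continuousSMul_induced (derivMap 𝕜 l : SmoothMap Ω F →ₗ[𝕜] C(Ω, F))

theorem continuous_iff {α : Type*} [TopologicalSpace α] {f : α → SmoothMap Ω F} :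
    Continuous f ↔ ∀ l, Continuous fun a => (iteratedPd l (f a)).toContinuousMap := by
  rw [continuous_iInf_rng]
  exact forall_congr' fun l => continuous_induced_rng

theorem continuous_derivMap (l : List (Fin n)) :
    Continuous fun f : SmoothMap Ω F => (iteratedPd l f).toContinuousMap :=
  continuous_iff.1 continuous_id l

theorem tendsto_iff {α : Type*} {u : Filter α} {f : α → SmoothMap Ω F} {g : SmoothMap Ω F} :
    Tendsto f u (𝓝 g) ↔ ∀ l, Tendsto (fun a => (iteratedPd l (f a)).toContinuousMap) u
      (𝓝 (iteratedPd l g).toContinuousMap) := by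
  rw [nhds_iInf, tendsto_iInf]
  refine forall_congr' fun l => ?_
  rw [nhds_induced, tendsto_comap_iff]
  rfl

/-- Convergence in `C(Ω, F)` in terms of neighbourhoods of zero. -/
theorem tendsto_continuousMap_iff {α X : Type*} [TopologicalSpace X] {u : Filter α}
    {f : α → C(X, F)} {g : C(X, F)} : Tendsto f u (𝓝 g) ↔
      ∀ K : Set X, IsCompact K → ∀ N ∈ 𝓝 (0 : F), ∀ᶠ a in u, ∀ x ∈ K, f a x - g x ∈ N := by
  let _ : UniformSpace F := IsTopologicalAddGroup.rightUniformSpace F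
  have : IsUniformAddGroup F := isUniformAddGroup_of_addCommGroup
  rw [ContinuousMap.tendsto_iff_forall_isCompact_tendstoUniformlyOn]
  refine forall₂_congr fun K _ => ?_
  constructor
  · intro h N hN
    have hU : (fun p : F × F => p.2 - p.1) ⁻¹' N ∈ uniformity F := by
      rw [uniformity_eq_comap_nhds_zero]
      exact preimage_mem_comap hN
    exact h _ hU
  · intro h U hU
    rw [uniformity_eq_comap_nhds_zero] at hU
    obtain ⟨N, hN, hNU⟩ := hU
    filter_upwards [h N hN] with a ha x hx
    exact hNU (ha x hx)

/-- Iterated partial derivatives are jointly continuous in the function and the point. -/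
theorem continuous_iteratedPd_apply (l : List (Fin n)) :
    Continuous fun p : SmoothMap Ω F × Ω => iteratedPd l p.1 p.2 := by
  have : LocallyCompactSpace Ω := Ω.isOpen.locallyCompactSpace
  exact (ContinuousEval.continuous_eval (F := C(Ω, F))).comp
    ((continuous_derivMap l).prodMap continuous_id)

theorem continuous_of_uncurry {α : Type*} [TopologicalSpace α] {f : α → SmoothMap Ω F}
    (h : ∀ l, Continuous fun p : α × Ω => iteratedPd l (f p.1) p.2) : Continuous f :=
  continuous_iff.2 fun l => ContinuousMap.continuous_of_continuous_uncurry _ (h l)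

theorem continuous_eval (x : Eu n) : Continuous fun f : SmoothMap Ω F => f x := by
  by_cases hx : x ∈ Ω
  · exact (ContinuousEvalConst.continuous_eval_const (⟨x, hx⟩ : Ω)).comp (continuous_derivMap [])
  · simp only [apply_of_notMem _ hx]
    exact continuous_const

variable (𝕜) in
/-- Evaluation at a point as a continuous linear map. -/
def evalCLM (x : Eu n) : SmoothMap Ω F →L[𝕜] F where
  toFun f := f x
  map_add' _ _ := rfl
  map_smul' _ _ := rfl
  cont := continuous_eval x

instance : T2Space (SmoothMap Ω F) :=
  T2Space.of_injective_continuous (f := fun (f : SmoothMap Ω F) (x : Eu n) => f x)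
    DFunLike.coe_injective (continuous_pi continuous_eval)

variable (𝕜) in
/-- Partial derivatives as continuous linear maps. -/
noncomputable def pdCLM (i : Fin n) : SmoothMap Ω F →L[𝕜] SmoothMap Ω F where
  toFun := pd i
  map_add' := pd_add i
  map_smul' c := pd_const_smul c i
  cont := continuous_iff.2 fun l => by
    have := continuous_derivMap (Ω := Ω) (F := F) (l ++ [i])
    simp only [iteratedPd_append] at this
    exact this

theorem pdCLM_apply (i : Fin n) (f : SmoothMap Ω F) : pdCLM 𝕜 i f = pd i f := rfl

theorem continuous_postcomp {G : Type*} [AddCommGroup G] [Module ℝ G] [TopologicalSpace G]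
    [IsTopologicalAddGroup G] [ContinuousSMul ℝ G] [T2Space G] (T : F →L[ℝ] G) :
    Continuous (postcomp T : SmoothMap Ω F → SmoothMap Ω G) := by
  refine continuous_iff.2 fun l => ?_
  have h : ∀ f : SmoothMap Ω F, iteratedPd l (postcomp T f) = postcomp T (iteratedPd l f) := by
    intro f
    induction l with
    | nil => rfl
    | cons i l ih => rw [iteratedPd_cons, ih, pd_postcomp]; rfl
  simp only [h]
  exact (ContinuousMap.continuous_postcomp (T : C(F, G))).comp (continuous_derivMap l)

theorem iteratedPd_smul {𝕜 : Type*} [NormedField 𝕜] [NormedSpace ℝ 𝕜] [Module 𝕜 F]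
    [IsScalarTower ℝ 𝕜 F] [ContinuousSMul 𝕜 F] [SMulCommClass ℝ 𝕜 F]
    (l : List (Fin n)) (f : SmoothMap Ω 𝕜) (g : SmoothMap Ω F) :
    iteratedPd l (f • g) =
      ((leibnizList l).map fun a => iteratedPd a.1 f • iteratedPd a.2 g).sum := by
  induction l with
  | nil => simp [leibnizList, iteratedPd_nil]
  | cons i l ih =>
    rw [iteratedPd_cons, ih]
    have h := map_list_sum (pdCLM ℝ i : SmoothMap Ω F →L[ℝ] SmoothMap Ω F)
      ((leibnizList l).map fun a => iteratedPd a.1 f • iteratedPd a.2 g)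
    rw [pdCLM_apply] at h
    rw [h]
    simp only [leibnizList, List.map_map, List.map_append, List.sum_append, Function.comp_def,
      pdCLM_apply, pd_smul, iteratedPd_cons, List.sum_map_add]

theorem continuous_smul_left {𝕜 : Type*} [NormedField 𝕜] [NormedSpace ℝ 𝕜] [Module 𝕜 F]
    [IsScalarTower ℝ 𝕜 F] [ContinuousSMul 𝕜 F] [SMulCommClass ℝ 𝕜 F] (f : SmoothMap Ω 𝕜) :
    Continuous fun g : SmoothMap Ω F => f • g := by
  refine continuous_of_uncurry fun l => ?_
  simp only [iteratedPd_smul, list_sum_apply]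
  induction leibnizList l with
  | nil => exact continuous_const
  | cons a s ih =>
    simp only [List.map_cons, List.sum_cons]
    exact (((iteratedPd a.1 f).toContinuousMap.continuous.comp continuous_snd).smul
      (continuous_iteratedPd_apply a.2)).add ih

theorem continuous_const_map : Continuous (const Ω : F → SmoothMap Ω F) := by
  refine continuous_iff.2 fun l => ?_
  have h : ∀ (i : Fin n) (l : List (Fin n)) (v : F), iteratedPd (i :: l) (const Ω v) = 0 := by
    intro i l v
    induction l generalizing i with
    | nil => exact pd_const i v
    | cons j l ih =>
      rw [iteratedPd_cons, ih]
      exact map_zero (pdCLM ℝ i)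
  cases l with
  | nil =>
    refine (ContinuousMap.continuous_const' (X := Ω) (Y := F)).congr (fun v => ?_)
    ext x
    exact (const_apply v x.2).symm
  | cons i l =>
    simp only [h]
    exact continuous_const

variable (𝕜) in
/-- The map which sends `v` to the constant function `v`, as a continuous linear map. -/
noncomputable def constCLM : F →L[𝕜] SmoothMap Ω F where
  toFun := const Ω
  map_add' v w := ext_on fun x hx => by
    rw [add_apply, const_apply _ hx, const_apply _ hx, const_apply _ hx]
  map_smul' c v := ext_on fun x hx => by
    rw [RingHom.id_apply, const_smul_apply, const_apply _ hx, const_apply _ hx]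
  cont := continuous_const_map

end Derivatives

end SmoothMap

/-! ### Evaluation along curves, and differentiability of curves in `C^∞(Ω, F)`. -/

section EvalCurves

variable {n : ℕ} {Ω : Opens (Eu n)} {F : Type*} [AddCommGroup F] [Module ℝ F]
  [TopologicalSpace F] [IsTopologicalAddGroup F] [ContinuousSMul ℝ F]

theorem tendsto_add_punctured {A : Type*} [AddMonoid A] [TopologicalSpace A] [ContinuousAdd A]
    (t : A) : Tendsto (fun s : A => t + s) (𝓝[≠] 0) (𝓝 t) := by
  have : Tendsto (fun s : A => t + s) (𝓝 0) (𝓝 (t + 0)) :=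
    (continuous_const.add continuous_id).tendsto 0
  rw [add_zero] at this
  exact this.mono_left nhdsWithin_le_nhds

theorem HasPartialsAt.comp_curve {f : Eu n → F} {p : Fin n → F} {γ : ℝ → Eu n} {γ' : Eu n} {t : ℝ}
    (hf : HasPartialsAt f p (γ t)) (hγ : HasDerivAt γ γ' t) :
    HasCurveDeriv (fun s => f (γ s)) (∑ i, γ' i • p i) t := by
  -- The normalised remainder, set to `0` at `0`, so that the expansion `hfr` also holds at times
  -- when the curve returns to `γ t`.
  set r : Eu n → F := Function.update
    (fun h : Eu n => ‖h‖⁻¹ • (f (γ t + h) - f (γ t) - ∑ i, h i • p i)) 0 0 with hr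
  have hr0 : ContinuousAt r 0 := continuousAt_update_same.2 hf
  have hfr : ∀ h : Eu n, f (γ t + h) - f (γ t) = ∑ i, h i • p i + ‖h‖ • r h := by
    intro h
    by_cases hh : h = 0
    · simp [hh]
    · rw [hr, Function.update_of_ne hh, smul_smul, mul_inv_cancel₀ (norm_ne_zero_iff.2 hh),
        one_smul]
      abel
  have hk : Tendsto (fun s : ℝ => γ (t + s) - γ t) (𝓝[≠] 0) (𝓝 0) := by
    simpa using (hγ.continuousAt.tendsto.comp (tendsto_add_punctured t)).sub_const (γ t)
  have hs := hasDerivAt_iff_tendsto_slope_zero.1 hγ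
  have hrk : Tendsto (fun s : ℝ => r (γ (t + s) - γ t)) (𝓝[≠] 0) (𝓝 0) := by
    have := hr0.tendsto.comp hk
    rwa [hr, Function.update_self] at this
  -- Dividing `‖γ (t + s) - γ t‖` by `s` yields the norm of the difference quotient up to the sign
  -- of `s`; that sign is moved into the remainder.
  have hrk' : Tendsto (fun s : ℝ => if 0 < s then r (γ (t + s) - γ t) else -r (γ (t + s) - γ t))
      (𝓝[≠] 0) (𝓝 0) := by
    have := hrk.neg
    rw [neg_zero] at this
    exact Tendsto.if' hrk this
  have h1 : Tendsto (fun s : ℝ => ∑ i, (s⁻¹ • (γ (t + s) - γ t)) i • p i) (𝓝[≠] 0)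
      (𝓝 (∑ i, γ' i • p i)) := by
    have : Continuous fun y : Eu n => ∑ i, y i • p i := by fun_prop
    exact (this.tendsto γ').comp hs
  have h2 := hs.norm.smul hrk'
  rw [smul_zero] at h2
  have h3 := h1.add h2
  rw [add_zero] at h3
  refine h3.congr' ?_
  filter_upwards [self_mem_nhdsWithin] with s hs
  have hs0 : s ≠ 0 := hs
  have := hfr (γ (t + s) - γ t)
  rw [add_sub_cancel] at this
  rw [this, smul_add, Finset.smul_sum]
  congr 1
  · exact Finset.sum_congr rfl fun i _ => by simp [smul_smul]
  · rw [norm_smul, Real.norm_eq_abs, smul_smul]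
    split_ifs with h
    · rw [abs_of_pos (inv_pos.2 h)]
    · have : s < 0 := lt_of_le_of_ne (not_lt.1 h) hs0
      rw [abs_of_neg (inv_lt_zero.2 this)]
      simp

variable [T2Space F]

/-- The increment splits into `(c (t + s) - c t)(γ (t + s))` and the increment of the fixed function
`c t` along `γ`. The first part converges because evaluation is jointly continuous. -/
theorem HasCurveDeriv.eval_curve {c : ℝ → SmoothMap Ω F} {c' : SmoothMap Ω F} {γ : ℝ → Eu n}
    {γ' : Eu n} {t : ℝ} (hc : HasCurveDeriv c c' t) (hγ : HasDerivAt γ γ' t) (hΩ : ∀ s, γ s ∈ Ω) :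
    HasCurveDeriv (fun s => c s (γ s))
      (c' (γ t) + ∑ i, γ' i • SmoothMap.pd i (c t) (γ t)) t := by
  have h1 := ((c t).hasPartialsAt_pd (hΩ t)).comp_curve hγ
  have h2 : Tendsto (fun s : ℝ => (s⁻¹ • (c (t + s) - c t) : SmoothMap Ω F) (γ (t + s))) (𝓝[≠] 0)
      (𝓝 (c' (γ t))) := by
    have h3 : Tendsto (fun s : ℝ => (⟨γ (t + s), hΩ _⟩ : Ω)) (𝓝[≠] 0) (𝓝 ⟨γ t, hΩ t⟩) := by
      rw [tendsto_subtype_rng]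
      exact hγ.continuousAt.tendsto.comp (tendsto_add_punctured t)
    exact ((SmoothMap.continuous_iteratedPd_apply (Ω := Ω) (F := F) []).tendsto
      (c', ⟨γ t, hΩ t⟩)).comp (hc.prodMk_nhds h3)
  refine (h2.add h1).congr fun s => ?_
  rw [SmoothMap.const_smul_apply, SmoothMap.sub_apply, ← smul_add]
  congr 1
  abel

theorem contDiff_apply_eu {γ : ℝ → Eu n} (hγ : ContDiff ℝ ∞ γ) (i : Fin n) :
    ContDiff ℝ ∞ fun t => γ t i :=
  (EuclideanSpace.proj i : Eu n →L[ℝ] ℝ).contDiff.comp hγ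

/-- Evaluation of a smooth curve of smooth functions along a smooth curve. -/
theorem IsCk.eval_curve {k : ℕ} {c : ℝ → SmoothMap Ω F} {γ : ℝ → Eu n} (hc : IsCk k c)
    (hγ : ContDiff ℝ ∞ γ) (hΩ : ∀ s, γ s ∈ Ω) : IsCk k (fun s => c s (γ s)) := by
  induction k generalizing c with
  | zero =>
    exact (SmoothMap.continuous_iteratedPd_apply (Ω := Ω) (F := F) []).comp
      (Continuous.prodMk (Y := Ω) hc (hγ.continuous.subtype_mk hΩ))
  | succ k ih =>
    have hc0 := hc.of_succ
    obtain ⟨d, h1, h2⟩ := hc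
    refine ⟨_, fun t => (h1 t).eval_curve ((hγ.differentiable (by simp)) t).hasDerivAt hΩ, ?_⟩
    refine (ih h2).add (IsCk.sum _ fun i _ => ?_)
    refine IsCk.smul (contDiff_apply_eu (contDiff_deriv_infty hγ) i) (ih ?_)
    have H : ∀ {k : ℕ} {c : ℝ → SmoothMap Ω F}, IsCk k c →
        IsCk k fun s => SmoothMap.pd i (c s) := by
      intro k
      induction k with
      | zero => exact fun h => (SmoothMap.pdCLM ℝ i : SmoothMap Ω F →L[ℝ] _).continuous.comp h
      | succ k ih' =>
        rintro c ⟨d, h3, h4⟩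
        exact ⟨_, fun t => (h3 t).clm (SmoothMap.pdCLM ℝ i : SmoothMap Ω F →L[ℝ] _), ih' h4⟩
    exact H hc0

theorem IsSmoothCurve.eval_curve {c : ℝ → SmoothMap Ω F} {γ : ℝ → Eu n} (hc : IsSmoothCurve c)
    (hγ : ContDiff ℝ ∞ γ) (hΩ : ∀ s, γ s ∈ Ω) : IsSmoothCurve (fun s => c s (γ s)) :=
  isSmoothCurve_of_isCk fun k => (hc.isCk k).eval_curve hγ hΩ

theorem exists_convex_isClosed_nhds_zero {V : Type*} [AddCommGroup V] [Module ℝ V]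
    [TopologicalSpace V] [IsTopologicalAddGroup V] [ContinuousSMul ℝ V] [LocallyConvexSpace ℝ V]
    {N : Set V} (hN : N ∈ 𝓝 0) : ∃ C ∈ 𝓝 (0 : V), C ⊆ N ∧ Convex ℝ C ∧ IsClosed C := by
  obtain ⟨N', ⟨h1, h2⟩, h3⟩ := (closed_nhds_basis (0 : V)).mem_iff.1 hN
  obtain ⟨U, ⟨hU, hU'⟩, hUN⟩ := (LocallyConvexSpace.convex_basis_zero ℝ V).mem_iff.1 h1
  exact ⟨closure U, mem_of_superset hU subset_closure,
    (closure_minimal hUN h2).trans h3, hU'.closure, isClosed_closure⟩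

/-- A curve in `C^∞(Ω, F)` is differentiable if all its iterated partial derivatives are
differentiable pointwise and the derivative is continuous. -/
theorem hasCurveDeriv_smoothMap [LocallyConvexSpace ℝ F] {c d : ℝ → SmoothMap Ω F}
    (h : ∀ l, ∀ x ∈ Ω, ∀ t, HasCurveDeriv (fun s => SmoothMap.iteratedPd l (c s) x)
      (SmoothMap.iteratedPd l (d t) x) t)
    (hd : Continuous d) (t : ℝ) : HasCurveDeriv c (d t) t := by
  refine SmoothMap.tendsto_iff.2 fun l => SmoothMap.tendsto_continuousMap_iff.2 fun K hK N hN => ?_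
  obtain ⟨C, hC, hCN, hC1, hC2⟩ := exists_convex_isClosed_nhds_zero hN
  have h1 := SmoothMap.tendsto_continuousMap_iff.1
    ((SmoothMap.tendsto_iff.1 (hd.tendsto t)) l) K hK C hC
  obtain ⟨δ, hδ, hδ'⟩ := Metric.eventually_nhds_iff.1 h1
  -- The mean value theorem is applied to `s ↦ ∂^l (c s) x - s • ∂^l (d t) x`. Its derivative lies
  -- in `C` near `t`, with a `δ` that serves all `x ∈ K` at once.
  have key : ∀ a b, a < b → dist a t < δ → dist b t < δ → ∀ x ∈ K,
      (b - a)⁻¹ • (SmoothMap.iteratedPd l (c b) x - SmoothMap.iteratedPd l (c a) x) -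
        SmoothMap.iteratedPd l (d t) x ∈ C := by
    intro a b hab ha hb x hx
    have hderiv : ∀ s, HasCurveDeriv (fun s => SmoothMap.iteratedPd l (c s) x
        + (-s) • SmoothMap.iteratedPd l (d t) x)
        (SmoothMap.iteratedPd l (d s) x - SmoothMap.iteratedPd l (d t) x) s := by
      intro s
      have := (h l x x.2 s).add
        ((HasCurveDeriv.const (SmoothMap.iteratedPd l (d t) x) s).smul (hasDerivAt_neg s))
      simpa [sub_eq_add_neg] using this
    have := mean_value_mem hC1 hC2 hab
      (fun s _ => (hderiv s).continuousAt.continuousWithinAt) (fun s _ => hderiv s)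
      (fun s hs => hδ' (y := s) (by
        rw [Real.dist_eq, abs_lt] at *
        constructor <;> linarith [hs.1, hs.2]) x hx)
    have hba : b - a ≠ 0 := (sub_pos.2 hab).ne'
    have e : SmoothMap.iteratedPd l (c b) x + -b • SmoothMap.iteratedPd l (d t) x -
        (SmoothMap.iteratedPd l (c a) x + -a • SmoothMap.iteratedPd l (d t) x) =
        (SmoothMap.iteratedPd l (c b) x - SmoothMap.iteratedPd l (c a) x) -
        (b - a) • SmoothMap.iteratedPd l (d t) x := by
      simp only [neg_smul, sub_smul]
      abel
    rwa [e, smul_sub, smul_smul, inv_mul_cancel₀ hba, one_smul] at this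
  have h2 : ∀ᶠ s in 𝓝[≠] (0 : ℝ), dist s 0 < δ :=
    (Metric.eventually_nhds_iff.2 ⟨δ, hδ, fun _ h => h⟩ : ∀ᶠ s in 𝓝 (0 : ℝ), dist s 0 < δ).filter_mono
      nhdsWithin_le_nhds
  filter_upwards [h2, self_mem_nhdsWithin] with s hs hs0 x hx
  have hs0' : s ≠ 0 := hs0
  apply hCN
  have e : (SmoothMap.iteratedPd l (s⁻¹ • (c (t + s) - c t))).toContinuousMap x =
      s⁻¹ • (SmoothMap.iteratedPd l (c (t + s)) x - SmoothMap.iteratedPd l (c t) x) := by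
    have := congrArg (fun f : C(Ω, F) => f x)
      (((SmoothMap.derivMap ℝ l).map_smul s⁻¹ (c (t + s) - c t)).trans
      (congrArg (s⁻¹ • ·) ((SmoothMap.derivMap ℝ l).map_sub (c (t + s)) (c t))))
    exact this
  rw [e]
  rcases lt_or_gt_of_ne hs0' with hneg | hpos
  · have := key (t + s) t (by linarith) (by simpa using hs) (by simpa using hδ) x hx
    have e2 : (t - (t + s))⁻¹ = -s⁻¹ := by rw [sub_add_cancel_left, inv_neg]
    rwa [e2, neg_smul, ← smul_neg, neg_sub] at this
  · have := key t (t + s) (by linarith) (by simpa using hδ) (by simpa using hs) x hx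
    rwa [add_sub_cancel_left] at this

end EvalCurves

/-! ## Smooth functions of several variables -/

section Directional

variable {E G : Type*} [NormedAddCommGroup E] [NormedSpace ℝ E] [NormedAddCommGroup G]
  [NormedSpace ℝ G]

/-- The directional derivative in the direction `v`. -/
noncomputable def dirDeriv (v : E) (f : E → G) : E → G := fun x => fderiv ℝ f x v

theorem contDiffOn_dirDeriv {W : Set E} (hW : IsOpen W) {f : E → G} (hf : ContDiffOn ℝ ∞ f W)
    (v : E) : ContDiffOn ℝ ∞ (dirDeriv v f) W :=
  (hf.fderiv_of_isOpen hW (by simp)).clm_apply contDiffOn_const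

theorem dirDeriv_comm {W : Set E} (hW : IsOpen W) {f : E → G} (hf : ContDiffOn ℝ ∞ f W)
    (v w : E) {x : E} (hx : x ∈ W) : dirDeriv v (dirDeriv w f) x = dirDeriv w (dirDeriv v f) x := by
  have h1 : ContDiffAt ℝ ∞ f x := hf.contDiffAt (hW.mem_nhds hx)
  have h2 : DifferentiableAt ℝ (fderiv ℝ f) x :=
    ((hf.fderiv_of_isOpen hW (m := ∞) (by simp)).contDiffAt (hW.mem_nhds hx)).differentiableAt
      (by simp)
  have h3 : ∀ v w, dirDeriv v (dirDeriv w f) x = fderiv ℝ (fderiv ℝ f) x v w := by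
    intro v w
    have := (h2.hasFDerivAt.clm_apply (hasFDerivAt_const w x)).fderiv
    change fderiv ℝ (fun y => fderiv ℝ f y w) x v = _
    rw [this]
    simp
  rw [h3, h3]
  have h4 : IsSymmSndFDerivAt ℝ f x :=
    h1.isSymmSndFDerivAt (by simpa using WithTop.coe_le_coe.2 (le_top : (2 : ℕ∞) ≤ ⊤))
  exact h4 v w

theorem dirDeriv_congr {W : Set E} (hW : IsOpen W) {f g : E → G} (h : Set.EqOn f g W) (v : E) :
    Set.EqOn (dirDeriv v f) (dirDeriv v g) W := fun x hx => by
  simp only [dirDeriv]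
  rw [(h.eventuallyEq_of_mem (hW.mem_nhds hx)).fderiv_eq]

end Directional

/-! ### From smooth functions of `(t, x)` to smooth curves of functions. -/

section Exponential

variable {n : ℕ} {Ω : Opens (Eu n)} {G : Type*} [NormedAddCommGroup G] [NormedSpace ℝ G]

theorem HasFDerivAt.hasPartialsAt {f : Eu n → G} {f' : Eu n →L[ℝ] G} {x : Eu n}
    (h : HasFDerivAt f f' x) :
    HasPartialsAt f (fun i => f' (EuclideanSpace.single i 1)) x := by
  have h0 : ∀ h : Eu n, ∑ i, h i • f' (EuclideanSpace.single i 1) = f' h := by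
    intro h
    conv_rhs => rw [← (EuclideanSpace.basisFun (Fin n) ℝ).sum_repr h]
    simp
  refine tendsto_zero_iff_norm_tendsto_zero.2 ?_
  refine ((hasFDerivAt_iff_tendsto.1 h).comp (tendsto_add_punctured x)).congr fun k => ?_
  rw [norm_smul, norm_inv, norm_norm, h0]
  simp

theorem isSmoothOn_of_contDiffOn {f : Eu n → G} (hf : ContDiffOn ℝ ∞ f Ω) : IsSmoothOn Ω f := by
  have H : ∀ l : List (Fin n),
      ContDiffOn ℝ ∞ (l.foldr (fun i g => dirDeriv (EuclideanSpace.single i (1 : ℝ)) g) f) Ω := by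
    intro l
    induction l with
    | nil => exact hf
    | cons i l ih => exact contDiffOn_dirDeriv Ω.isOpen ih _
  refine ⟨fun l => l.foldr (fun i g => dirDeriv (EuclideanSpace.single i (1 : ℝ)) g) f, rfl,
    fun l x hx => ?_⟩
  have h := HasFDerivAt.hasPartialsAt
    (((H l).contDiffAt (Ω.isOpen.mem_nhds hx)).differentiableAt (by simp)).hasFDerivAt
  exact h

/-- The iterated partial derivatives of a function of `(t, x)` with respect to `x`. -/
noncomputable def iterDir (l : List (Fin n)) (g : ℝ × Eu n → G) : ℝ × Eu n → G :=
  l.foldr (fun i g => dirDeriv ((0 : ℝ), EuclideanSpace.single i (1 : ℝ)) g) g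

theorem isOpen_univ_prod (Ω : Opens (Eu n)) :
    IsOpen ((Set.univ : Set ℝ) ×ˢ (Ω : Set (Eu n))) := isOpen_univ.prod Ω.isOpen

theorem contDiffOn_iterDir {g : ℝ × Eu n → G} (hg : ContDiffOn ℝ ∞ g (Set.univ ×ˢ (Ω : Set (Eu n))))
    (l : List (Fin n)) : ContDiffOn ℝ ∞ (iterDir l g) (Set.univ ×ˢ (Ω : Set (Eu n))) := by
  induction l with
  | nil => exact hg
  | cons i l ih => exact contDiffOn_dirDeriv (isOpen_univ_prod Ω) ih _

/-- By symmetry of second derivatives, any directional derivative passes through the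
`x`-derivatives. With the `t`-direction this identifies the time derivative of each `∂^l` of a slice
with `∂^l` of the slice of `∂_t g`. -/
theorem iterDir_dirDeriv {g : ℝ × Eu n → G} (hg : ContDiffOn ℝ ∞ g (Set.univ ×ˢ (Ω : Set (Eu n))))
    (l : List (Fin n)) (v : ℝ × Eu n) : Set.EqOn (iterDir l (dirDeriv v g))
      (dirDeriv v (iterDir l g)) (Set.univ ×ˢ (Ω : Set (Eu n))) := by
  induction l with
  | nil => exact fun _ _ => rfl
  | cons i l ih =>
    intro p hp
    exact (dirDeriv_congr (isOpen_univ_prod Ω) ih _ hp).trans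
      (dirDeriv_comm (isOpen_univ_prod Ω) (contDiffOn_iterDir hg l) _ _ hp)

theorem contDiffOn_slice {g : ℝ × Eu n → G} (hg : ContDiffOn ℝ ∞ g (Set.univ ×ˢ (Ω : Set (Eu n))))
    (t : ℝ) : ContDiffOn ℝ ∞ (fun x => g (t, x)) Ω :=
  hg.comp (contDiff_prodMk_right t).contDiffOn fun _ hx => ⟨Set.mem_univ _, hx⟩

theorem iteratedPd_slice {g : ℝ × Eu n → G}
    (hg : ContDiffOn ℝ ∞ g (Set.univ ×ˢ (Ω : Set (Eu n)))) {t : ℝ} {f : SmoothMap Ω G}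
    (hf : ∀ x ∈ Ω, f x = g (t, x)) (l : List (Fin n)) :
    ∀ x ∈ Ω, SmoothMap.iteratedPd l f x = iterDir l g (t, x) := by
  refine SmoothMap.iteratedPd_apply_eq (D := fun l x => iterDir l g (t, x)) hf (fun l x hx => ?_) l
  have h1 : HasFDerivAt (iterDir l g) _ (t, x) := (((contDiffOn_iterDir hg l).contDiffAt
    ((isOpen_univ_prod Ω).mem_nhds ⟨Set.mem_univ _, hx⟩)).differentiableAt (by simp)).hasFDerivAt
  have h2 := HasFDerivAt.hasPartialsAt (h1.comp x (hasFDerivAt_prodMk_right t x))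
  exact h2

/-- A function which is smooth in `(t, x)` defines a smooth curve in `C^∞(Ω, G)`. -/
theorem isSmoothCurve_of_contDiffOn {g : ℝ × Eu n → G}
    (hg : ContDiffOn ℝ ∞ g (Set.univ ×ˢ (Ω : Set (Eu n)))) {c : ℝ → SmoothMap Ω G}
    (hc : ∀ t, ∀ x ∈ Ω, c t x = g (t, x)) : IsSmoothCurve c := by
  -- The class of all curves of slices of smooth functions is closed under differentiation, since
  -- `∂_t g` is again smooth.
  refine IsSmoothCurve.of_closed (fun c : ℝ → SmoothMap Ω G => ∃ g : ℝ × Eu n → G,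
    ContDiffOn ℝ ∞ g (Set.univ ×ˢ (Ω : Set (Eu n))) ∧ ∀ t, ∀ x ∈ Ω, c t x = g (t, x)) ?_ ⟨g, hg, hc⟩
  clear hc hg c g
  rintro c ⟨g, hg, hc⟩
  have hg' := contDiffOn_dirDeriv (isOpen_univ_prod Ω) hg ((1 : ℝ), (0 : Eu n))
  have hd : ∀ t, ∀ x ∈ Ω, SmoothMap.mk' (Ω := Ω) (fun x => dirDeriv ((1 : ℝ), (0 : Eu n)) g (t, x))
      (isSmoothOn_of_contDiffOn (contDiffOn_slice hg' t)) x = dirDeriv ((1 : ℝ), (0 : Eu n)) g (t, x) :=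
    fun t x hx => SmoothMap.mk'_apply hx
  refine ⟨fun t => SmoothMap.mk' (Ω := Ω) (fun x => dirDeriv ((1 : ℝ), (0 : Eu n)) g (t, x))
      (isSmoothOn_of_contDiffOn (contDiffOn_slice hg' t)), ⟨_, hg', hd⟩, ?_⟩
  refine hasCurveDeriv_smoothMap (fun l x hx t => ?_) ?_
  · rw [iteratedPd_slice hg' (hd t) l x hx,
      iterDir_dirDeriv hg l _ (Set.mk_mem_prod (Set.mem_univ t) hx)]
    simp only [fun s => iteratedPd_slice hg (hc s) l x hx]
    rw [hasCurveDeriv_iff_hasDerivAt]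
    have h1 : HasFDerivAt (iterDir l g) _ (t, x) := (((contDiffOn_iterDir hg l).contDiffAt
      ((isOpen_univ_prod Ω).mem_nhds ⟨Set.mem_univ _, hx⟩)).differentiableAt (by simp)).hasFDerivAt
    exact h1.comp_hasDerivAt t ((hasDerivAt_id t).prodMk (hasDerivAt_const t x))
  · refine SmoothMap.continuous_of_uncurry fun l => ?_
    have : (fun p : ℝ × Ω => SmoothMap.iteratedPd l (SmoothMap.mk' (Ω := Ω)
        (fun x => dirDeriv ((1 : ℝ), (0 : Eu n)) g (p.1, x))
        (isSmoothOn_of_contDiffOn (contDiffOn_slice hg' p.1))) p.2) =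
        fun p : ℝ × Ω => iterDir l (dirDeriv ((1 : ℝ), (0 : Eu n)) g) (p.1, p.2) :=
      funext fun p => iteratedPd_slice hg' (hd p.1) l p.2 p.2.2
    rw [this]
    exact (contDiffOn_iterDir hg' l).continuousOn.comp_continuous
      (continuous_fst.prodMk (continuous_subtype_val.comp continuous_snd))
      (fun p => ⟨Set.mem_univ _, p.2.2⟩)

end Exponential

/-! ## Functions which are smooth along smooth curves (Boman's theorem) -/

section SpecialCurve

variable {E : Type*} [NormedAddCommGroup E] [NormedSpace ℝ E]

/-- The derivatives of order at most `m` of a smooth compactly supported function are bounded. -/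
theorem exists_bound_iteratedFDeriv {b : ℝ → ℝ} (hb : ContDiff ℝ ∞ b) (hs : HasCompactSupport b)
    (m : ℕ) : ∃ C, ∀ k ≤ m, ∀ t, ‖iteratedFDeriv ℝ k b t‖ ≤ C := by
  have h : ∀ k : ℕ, ∃ C, ∀ t, ‖iteratedFDeriv ℝ k b t‖ ≤ C := fun k =>
    (hs.iteratedFDeriv k).exists_bound_of_continuous (hb.continuous_iteratedFDeriv (by
      exact_mod_cast le_top))
  choose C hC using h
  refine ⟨∑ k ∈ Finset.range (m + 1), |C k|, fun k hk t => (hC k t).trans ((le_abs_self _).trans ?_)⟩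
  exact Finset.single_le_sum (f := fun k => |C k|) (fun _ _ => abs_nonneg _)
    (Finset.mem_range.2 (Nat.lt_succ_of_le hk))

theorem norm_iteratedFDeriv_smul_const_le {b : ℝ → ℝ} (hb : ContDiff ℝ ∞ b) (a : E) (k : ℕ) (t : ℝ) :
    ‖iteratedFDeriv ℝ k (fun t => b t • a) t‖ ≤ ‖a‖ * ‖iteratedFDeriv ℝ k b t‖ := by
  have h := ContinuousLinearMap.norm_iteratedFDeriv_comp_left
    (ContinuousLinearMap.toSpanSingleton ℝ a) (f := b) (x := t) (N := ∞) (n := k)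
    (hb.contDiffAt) (by exact_mod_cast le_top)
  rw [ContinuousLinearMap.norm_toSpanSingleton] at h
  exact h

/-- The centers `2⁻ᵐ` of a sequence of bumps. -/
noncomputable def bumpCenter (m : ℕ) : ℝ := (1 / 2) ^ m

theorem bumpCenter_pos (m : ℕ) : 0 < bumpCenter m := by unfold bumpCenter; positivity

/-- Smooth bump functions around `2⁻ᵐ` with disjoint supports. -/
noncomputable def bumpAt (m : ℕ) : ContDiffBump (bumpCenter m) where
  rIn := bumpCenter m / 8
  rOut := bumpCenter m / 4
  rIn_pos := by have := bumpCenter_pos m; positivity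
  rIn_lt_rOut := by have := bumpCenter_pos m; linarith

theorem bumpCenter_succ (m : ℕ) : bumpCenter (m + 1) = bumpCenter m / 2 := by
  unfold bumpCenter; rw [pow_succ]; ring

theorem bumpCenter_le {m k : ℕ} (h : m < k) : bumpCenter k ≤ bumpCenter m / 2 := by
  rw [← bumpCenter_succ]
  exact pow_le_pow_of_le_one (by norm_num) (by norm_num) h

/-- The bump at `2⁻ᵏ` lives between `3/4` and `5/4` of its centre. Distinct centres differ at least
by a factor of two, and `5/8 < 3/4`. -/
theorem bumpAt_eq_zero {m k : ℕ} (h : k ≠ m) {t : ℝ} (ht : |t - bumpCenter m| < bumpCenter m / 4) :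
    bumpAt k t = 0 := by
  refine (bumpAt k).zero_of_le_dist ?_
  change bumpCenter k / 4 ≤ |t - bumpCenter k|
  have h1 := bumpCenter_pos k
  have h2 := bumpCenter_pos m
  rw [abs_lt] at ht
  rcases lt_or_gt_of_ne h with h | h
  · have := bumpCenter_le h
    rw [le_abs]
    right
    linarith
  · have := bumpCenter_le h
    rw [le_abs]
    left
    linarith

/-- A special curve: there are positive `ε_m` such that for points `a_m` of norm at most `ε_m` there
is a smooth curve which near `2⁻ᵐ` is given by `x + a_m + (t - 2⁻ᵐ) ε_m v`. -/
theorem exists_special_curve (x v : E) : ∃ ε : ℕ → ℝ, (∀ m, 0 < ε m) ∧ ∀ a : ℕ → E,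
    (∀ m, ‖a m‖ ≤ ε m) → [CompleteSpace E] → ∃ c : ℝ → E, ContDiff ℝ ∞ c ∧
      ∀ m, ∀ᶠ t in 𝓝 (bumpCenter m), c t = x + a m + (ε m * (t - bumpCenter m)) • v := by
  have hb1 : ∀ m, ContDiff ℝ ∞ (bumpAt m) := fun m => (bumpAt m).contDiff
  have hb2 : ∀ m, ContDiff ℝ ∞ fun t => bumpAt m t * (t - bumpCenter m) := fun m =>
    (hb1 m).mul (contDiff_id.sub contDiff_const)
  choose C hC using fun m => exists_bound_iteratedFDeriv (hb1 m) (bumpAt m).hasCompactSupport m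
  choose D hD using fun m => exists_bound_iteratedFDeriv (hb2 m)
    ((bumpAt m).hasCompactSupport.mul_right) m
  have hK : ∀ m, 0 < 1 + |C m| + |D m| := fun m => by positivity
  -- This `ε_m` absorbs the bounds for all derivatives of order at most `m` of the `m`-th bump and
  -- of its product with `t - 2⁻ᵐ`. For a fixed order `k`, all terms with `m ≥ k` are then dominated
  -- by a geometric series.
  refine ⟨fun m => (1 / 2) ^ m / (1 + |C m| + |D m|), fun m => by have := hK m; positivity,
    fun a ha _ => ?_⟩
  set ε : ℕ → ℝ := fun m => (1 / 2) ^ m / (1 + |C m| + |D m|) with hε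
  have hε0 : ∀ m, 0 < ε m := fun m => by have := hK m; positivity
  have hεK : ∀ m, ε m * (1 + |C m| + |D m|) = (1 / 2) ^ m := fun m => by
    rw [hε]; exact div_mul_cancel₀ _ (hK m).ne'
  set f : ℕ → ℝ → E := fun m t => bumpAt m t • a m +
    (bumpAt m t * (t - bumpCenter m)) • (ε m • v) with hf
  have hfs : ∀ m, ContDiff ℝ ∞ (f m) := fun m =>
    ((hb1 m).smul contDiff_const).add ((hb2 m).smul contDiff_const)
  refine ⟨fun t => x + ∑' m, f m t, contDiff_const.add ?_, fun m => ?_⟩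
  · refine contDiff_tsum_of_eventually (v := fun _ m => (1 + ‖v‖) * (1 / 2) ^ m) hfs ?_ ?_
    · intro k _
      exact (summable_geometric_of_lt_one (by norm_num) (by norm_num)).mul_left _
    · intro k _
      rw [Nat.cofinite_eq_atTop]
      filter_upwards [eventually_ge_atTop k] with m hm t
      have h1 := (norm_iteratedFDeriv_smul_const_le (hb1 m) (a m) k t).trans
        (mul_le_mul (ha m) ((hC m k hm t).trans (le_abs_self _)) (norm_nonneg _) (hε0 m).le)
      have h2 := (norm_iteratedFDeriv_smul_const_le (hb2 m) (ε m • v) k t).trans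
        (mul_le_mul_of_nonneg_left ((hD m k hm t).trans (le_abs_self _)) (norm_nonneg _))
      rw [norm_smul, Real.norm_eq_abs, abs_of_pos (hε0 m)] at h2
      have e : iteratedFDeriv ℝ k (f m) t = iteratedFDeriv ℝ k (fun t => bumpAt m t • a m) t +
          iteratedFDeriv ℝ k (fun t => (bumpAt m t * (t - bumpCenter m)) • (ε m • v)) t := by
        have hk : ((k : ℕ∞) : WithTop ℕ∞) ≤ ∞ := by exact_mod_cast le_top
        exact iteratedFDeriv_add_apply (((hb1 m).smul contDiff_const).contDiffAt.of_le hk)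
          (((hb2 m).smul contDiff_const).contDiffAt.of_le hk)
      rw [e]
      refine (norm_add_le _ _).trans ((add_le_add h1 h2).trans ?_)
      rw [← hεK]
      have := (hε0 m).le
      have := abs_nonneg (C m)
      have := abs_nonneg (D m)
      have := norm_nonneg v
      have : 0 ≤ ε m * (1 + ‖v‖ + ‖v‖ * |C m| + |D m|) := by positivity
      nlinarith
  · have h1 : ∀ᶠ t in 𝓝 (bumpCenter m), bumpAt m t = 1 := (bumpAt m).eventuallyEq_one
    have h2 : ∀ᶠ t in 𝓝 (bumpCenter m), |t - bumpCenter m| < bumpCenter m / 4 :=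
      Metric.eventually_nhds_iff.2 ⟨bumpCenter m / 4, by have := bumpCenter_pos m; positivity,
        fun _ h => h⟩
    filter_upwards [h1, h2] with t h1 h2
    rw [tsum_eq_single m]
    · simp only [hf, h1, one_smul, one_mul, smul_smul]
      rw [mul_comm (t - bumpCenter m), add_assoc]
    · intro k hk
      simp only [hf, bumpAt_eq_zero hk h2]
      simp

/-- The `p`-th derivative of `f` at `y` in the direction `v`. -/
noncomputable def lineDerivN (p : ℕ) (v : E) (f : E → ℂ) (y : E) : ℂ :=
  iteratedDeriv p (fun t : ℝ => f (y + t • v)) 0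

theorem iteratedDeriv_line (p : ℕ) (v : E) (f : E → ℂ) (y : E) (t : ℝ) :
    iteratedDeriv p (fun t : ℝ => f (y + t • v)) t = lineDerivN p v f (y + t • v) := by
  have h := congrFun (iteratedDeriv_comp_add_const (n := p) (s := t)
    (f := fun t : ℝ => f (y + t • v))) 0
  simp only [zero_add] at h
  rw [← h, lineDerivN]
  congr 1
  funext s
  rw [add_smul, add_assoc, add_comm (s • v)]

/-- The function `f` is smooth along all smooth curves. -/
def CurveSmooth (f : E → ℂ) : Prop := ∀ γ : ℝ → E, ContDiff ℝ ∞ γ → ContDiff ℝ ∞ (f ∘ γ)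

theorem CurveSmooth.line {f : E → ℂ} (hf : CurveSmooth f) (v y : E) :
    ContDiff ℝ ∞ fun t : ℝ => f (y + t • v) :=
  hf _ (contDiff_const.add (contDiff_id.smul contDiff_const))

/-- If the bound fails, there are points `y m` within `ε m` of `x` where the derivative exceeds `m /
ε m ^ p`. A special curve passes through `y m` at time `2⁻ᵐ` with velocity `ε m • v`, which costs
the factor `ε m ^ p`. So the `p`-th derivative of `f ∘ c` has norm larger than `m` at `2⁻ᵐ`,
contradicting its continuity at `0`. -/
theorem CurveSmooth.locally_bounded [CompleteSpace E] {f : E → ℂ} (hf : CurveSmooth f) (p : ℕ)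
    (v x : E) : ∃ r > 0, ∃ M : ℝ, ∀ y ∈ Metric.ball x r, ‖lineDerivN p v f y‖ ≤ M := by
  by_contra! H
  obtain ⟨ε, hε, hc⟩ := exists_special_curve x v
  choose y hy hyM using fun m : ℕ => H (ε m) (hε m) (m / ε m ^ p)
  obtain ⟨c, hcs, hc⟩ := hc (fun m => y m - x) (fun m => by
    have := hy m
    rw [Metric.mem_ball, dist_eq_norm] at this
    exact this.le)
  have hfc := hf c hcs
  have hcont : Continuous (iteratedDeriv p (f ∘ c)) :=
    hfc.continuous_iteratedDeriv p (by exact_mod_cast le_top)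
  have hval : ∀ m, iteratedDeriv p (f ∘ c) (bumpCenter m) = ε m ^ p • lineDerivN p v f (y m) := by
    intro m
    have e1 : f ∘ c =ᶠ[𝓝 (bumpCenter m)]
        fun t => (fun s : ℝ => f (y m + (ε m * s) • v)) (t + -bumpCenter m) := by
      filter_upwards [hc m] with t ht
      simp only [Function.comp_apply, ht]
      rw [add_sub_cancel, sub_eq_add_neg]
    rw [e1.iteratedDeriv_eq p, congrFun (iteratedDeriv_comp_add_const (n := p)
      (s := -bumpCenter m) (f := fun s : ℝ => f (y m + (ε m * s) • v))) (bumpCenter m)]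
    have e2 := iteratedDeriv_comp_const_smul (n := p) (f := fun t : ℝ => f (y m + t • v))
      ((hf.line v (y m)).of_le (by exact_mod_cast le_top)) (ε m)
    simp only [add_neg_cancel]
    rw [e2]
    simp [lineDerivN]
  have ht : Tendsto bumpCenter atTop (𝓝 0) :=
    tendsto_pow_atTop_nhds_zero_of_lt_one (by norm_num) (by norm_num)
  have h1 := ((hcont.tendsto 0).comp ht).norm
  obtain ⟨m, hm1, hm2⟩ := ((h1.eventually_lt_const (lt_add_one _)).and
    (eventually_ge_atTop (⌈‖iteratedDeriv p (f ∘ c) 0‖ + 1⌉₊))).exists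
  simp only [Function.comp_def] at hm1
  have h2 := hval m
  simp only [Function.comp_def] at h2
  rw [h2, norm_smul, Real.norm_eq_abs, abs_of_pos (pow_pos (hε m) p)] at hm1
  have h3 := hyM m
  rw [div_lt_iff₀ (pow_pos (hε m) p), mul_comm] at h3
  have h4 := Nat.ceil_le.1 hm2
  simp only [Function.comp_def] at h4
  linarith

theorem CurveSmooth.bounded [CompleteSpace E] {f : E → ℂ} (hf : CurveSmooth f)
    (hs : HasCompactSupport f) (p : ℕ) (v : E) : ∃ M : ℝ, ∀ y, ‖lineDerivN p v f y‖ ≤ M := by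
  have h : ∃ M : ℝ, ∀ y ∈ tsupport f, ‖lineDerivN p v f y‖ ≤ M := by
    refine IsCompact.induction_on (p := fun s => ∃ M : ℝ, ∀ y ∈ s, ‖lineDerivN p v f y‖ ≤ M) hs
      ⟨0, by simp⟩ ?_ ?_ ?_
    · rintro s t hst ⟨M, hM⟩
      exact ⟨M, fun y hy => hM y (hst hy)⟩
    · rintro s t ⟨M, hM⟩ ⟨M', hM'⟩
      refine ⟨max M M', fun y hy => ?_⟩
      rcases hy with hy | hy
      · exact (hM y hy).trans (le_max_left _ _)
      · exact (hM' y hy).trans (le_max_right _ _)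
    · intro x _
      obtain ⟨r, hr, M, hM⟩ := hf.locally_bounded p v x
      exact ⟨_, mem_nhdsWithin_of_mem_nhds (Metric.ball_mem_nhds x hr), M, hM⟩
  obtain ⟨M, hM⟩ := h
  refine ⟨max M 0, fun y => ?_⟩
  by_cases hy : y ∈ tsupport f
  · exact (hM y hy).trans (le_max_left _ _)
  · have h0 : (fun t : ℝ => f (y + t • v)) =ᶠ[𝓝 0] fun _ => (0 : ℂ) := by
      have h1 : Tendsto (fun t : ℝ => y + t • v) (𝓝 0) (𝓝 y) := by
        have : Continuous fun t : ℝ => y + t • v := by fun_prop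
        simpa using this.tendsto 0
      exact h1.eventually (notMem_tsupport_iff_eventuallyEq.1 hy)
    have : lineDerivN p v f y = 0 := by
      rw [lineDerivN, h0.iteratedDeriv_eq p]
      simp
    rw [this, norm_zero]
    exact le_max_right _ _

end SpecialCurve

/-! ### Decay of the Fourier transform, and smoothness in the compactly supported case. -/

section Fourier

open MeasureTheory FourierTransform

/-- Iterated differences are bounded by derivatives. -/
theorem norm_fwdDiff_iterate_le (p : ℕ) {g : ℝ → ℂ} (hg : ContDiff ℝ ∞ g) {M : ℝ}
    (hM : ∀ s, ‖iteratedDeriv p g s‖ ≤ M) (t s : ℝ) : ‖(fwdDiff t)^[p] g s‖ ≤ |t| ^ p * M := by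
  induction p generalizing g M s with
  | zero => simpa using hM s
  | succ p ih =>
    rw [Function.iterate_succ_apply]
    have hg' : ContDiff ℝ ∞ (fwdDiff t g) := (hg.comp (contDiff_id.add contDiff_const)).sub hg
    have hp : ((p : ℕ∞) : WithTop ℕ∞) ≤ ∞ := by exact_mod_cast le_top
    have hd : ∀ s, iteratedDeriv p (fwdDiff t g) s =
        iteratedDeriv p g (s + t) - iteratedDeriv p g s := by
      intro s
      have e := congrFun (iteratedDeriv_comp_add_const (n := p) (s := t) (f := g)) s
      rw [← e]
      exact iteratedDeriv_fun_sub
        (((hg.comp (contDiff_id.add contDiff_const)).contDiffAt).of_le hp)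
        (hg.contDiffAt.of_le hp)
    have hb : ∀ s, ‖iteratedDeriv p (fwdDiff t g) s‖ ≤ M * |t| := by
      intro s
      rw [hd]
      have h1 : ∀ s, HasDerivAt (iteratedDeriv p g) (iteratedDeriv (p + 1) g s) s := by
        intro s
        rw [iteratedDeriv_succ]
        exact ((hg.differentiable_iteratedDeriv p
          (by exact_mod_cast ENat.natCast_lt_top p)) s).hasDerivAt
      have := Convex.norm_image_sub_le_of_norm_hasDerivWithin_le (s := Set.univ)
        (fun x _ => (h1 x).hasDerivWithinAt) (fun x _ => hM x) convex_univ (Set.mem_univ s)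
        (Set.mem_univ (s + t))
      simpa using this
    refine (ih hg' hb s).trans (le_of_eq ?_)
    ring

variable {n : ℕ}

theorem fwdDiff_iterate_line {E : Type*} [NormedAddCommGroup E] [NormedSpace ℝ E] (p : ℕ)
    (f : E → ℂ) (y v : E) (t s : ℝ) :
    (fwdDiff (t • v))^[p] f (y + s • v) = (fwdDiff t)^[p] (fun s : ℝ => f (y + s • v)) s := by
  induction p generalizing f with
  | zero => rfl
  | succ p ih =>
    rw [Function.iterate_succ_apply, Function.iterate_succ_apply, ih]
    have e : (fun s : ℝ => fwdDiff (t • v) f (y + s • v)) =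
        fwdDiff t fun s : ℝ => f (y + s • v) := by
      funext s
      simp only [fwdDiff, add_smul, add_assoc]
    rw [e]

theorem fwdDiff_iterate_support {E : Type*} [NormedAddCommGroup E] [NormedSpace ℝ E] (p : ℕ)
    {f : E → ℂ} {R : ℝ} (hf : ∀ y, R < ‖y‖ → f y = 0) {h : E} (hh : ‖h‖ ≤ 1) (y : E)
    (hy : R + p < ‖y‖) : (fwdDiff h)^[p] f y = 0 := by
  induction p generalizing f R with
  | zero => exact hf y (by simpa using hy)
  | succ p ih =>
    rw [Function.iterate_succ_apply]
    refine ih (R := R + 1) (fun z hz => ?_) (by push_cast at hy; linarith)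
    have h1 : ‖z‖ ≤ ‖z + h‖ + ‖h‖ := by
      have := norm_sub_le (z + h) h
      rwa [add_sub_cancel_right] at this
    rw [fwdDiff, hf z (by linarith), hf (z + h) (by linarith), sub_zero]

/-- Differences replace derivatives in the decay estimate: translations act by a multiplier on any
integrable function, so no integrability of the line derivatives has to be known. -/
theorem fourier_fwdDiff {f : Eu n → ℂ} (hf : Integrable f) (h ξ : Eu n) :
    𝓕 (fwdDiff h f) ξ = ((Real.fourierChar (inner ℝ h ξ) : ℂ) - 1) * 𝓕 f ξ := by
  have h1 := congrFun (VectorFourier.fourierIntegral_comp_add_right Real.fourierChar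
    (volume : Measure (Eu n)) (innerₗ (Eu n)) f h) ξ
  have h2 : Integrable (fun y => f (y + h)) := hf.comp_add_right h
  have h3 : 𝓕 (fwdDiff h f) ξ = 𝓕 (fun y => f (y + h)) ξ - 𝓕 f ξ := by
    simp only [Real.fourier_eq, fwdDiff, smul_sub]
    exact integral_sub ((Real.fourierIntegral_convergent_iff ξ).2 h2)
      ((Real.fourierIntegral_convergent_iff ξ).2 hf)
  have h4 : 𝓕 (fun y => f (y + h)) ξ = (Real.fourierChar (inner ℝ h ξ)) • 𝓕 f ξ := h1
  rw [h3, h4, Circle.smul_def, smul_eq_mul]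
  ring

theorem fourier_fwdDiff_iterate {f : Eu n → ℂ} (hf : Integrable f) (h ξ : Eu n) (p : ℕ) :
    𝓕 ((fwdDiff h)^[p] f) ξ = ((Real.fourierChar (inner ℝ h ξ) : ℂ) - 1) ^ p * 𝓕 f ξ := by
  induction p generalizing f with
  | zero => simp
  | succ p ih =>
    have h1 : Integrable (fwdDiff h f) := (hf.comp_add_right h).sub hf
    rw [Function.iterate_succ_apply, ih h1, fourier_fwdDiff hf]
    ring

theorem norm_fourier_le_integral (f : Eu n → ℂ) (ξ : Eu n) : ‖𝓕 f ξ‖ ≤ ∫ y, ‖f y‖ :=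
  VectorFourier.norm_fourierIntegral_le_integral_norm _ _ _ _ _

/-- Bounded first derivatives along the coordinate axes give a Lipschitz estimate in each
coordinate, and moving one coordinate at a time adds these estimates up. -/
theorem CurveSmooth.continuous_of_bounded {f : Eu n → ℂ} (hf : CurveSmooth f)
    (hs : HasCompactSupport f) : Continuous f := by
  choose M hM using fun i : Fin n => hf.bounded hs 1 (EuclideanSpace.single i (1 : ℝ))
  have h1 : ∀ i y (t : ℝ), ‖f (y + t • EuclideanSpace.single i (1 : ℝ)) - f y‖ ≤ M i * |t| := by
    intro i y t
    have hd : ∀ s, HasDerivAt (fun t : ℝ => f (y + t • EuclideanSpace.single i (1 : ℝ)))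
        (lineDerivN 1 (EuclideanSpace.single i (1 : ℝ)) f
          (y + s • EuclideanSpace.single i (1 : ℝ))) s := by
      intro s
      rw [← iteratedDeriv_line, iteratedDeriv_one]
      exact (((hf.line _ y).differentiable (by simp)) s).hasDerivAt
    have := Convex.norm_image_sub_le_of_norm_hasDerivWithin_le (s := Set.univ)
        (fun x _ => (hd x).hasDerivWithinAt) (fun x _ => hM i _) convex_univ (Set.mem_univ 0)
        (Set.mem_univ t)
    simpa using this
  have h2 : ∀ (s : Finset (Fin n)) (y h : Eu n),
      ‖f (y + ∑ i ∈ s, h i • EuclideanSpace.single i (1 : ℝ)) - f y‖ ≤ ∑ i ∈ s, M i * |h i| := by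
    classical
    intro s y h
    induction s using Finset.induction_on with
    | empty => simp
    | insert a s ha ih =>
      rw [Finset.sum_insert ha, Finset.sum_insert ha, add_comm (h a • _), ← add_assoc]
      have := h1 a (y + ∑ i ∈ s, h i • EuclideanSpace.single i (1 : ℝ)) (h a)
      calc _ = ‖(f (y + ∑ i ∈ s, h i • EuclideanSpace.single i (1 : ℝ) +
              h a • EuclideanSpace.single a (1 : ℝ)) -
              f (y + ∑ i ∈ s, h i • EuclideanSpace.single i (1 : ℝ))) +
              (f (y + ∑ i ∈ s, h i • EuclideanSpace.single i (1 : ℝ)) - f y)‖ := by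
            rw [sub_add_sub_cancel]
        _ ≤ _ := (norm_add_le _ _).trans (add_le_add this ih)
  have h3 : ∀ y h : Eu n, ‖f (y + h) - f y‖ ≤ ∑ i, M i * |h i| := by
    intro y h
    have := h2 Finset.univ y h
    have e := (EuclideanSpace.basisFun (Fin n) ℝ).sum_repr h
    simp only [EuclideanSpace.basisFun_repr, EuclideanSpace.basisFun_apply] at e
    rwa [e] at this
  refine continuous_iff_continuousAt.2 fun y => ?_
  have h4 : Tendsto (fun z : Eu n => ∑ i, M i * |(z - y) i|) (𝓝 y) (𝓝 0) := by
    have : Continuous fun z : Eu n => ∑ i, M i * |(z - y) i| := by fun_prop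
    simpa using this.tendsto y
  refine tendsto_iff_norm_sub_tendsto_zero.2 (squeeze_zero (fun _ => norm_nonneg _)
    (fun z => ?_) h4)
  have := h3 y (z - y)
  rwa [add_sub_cancel] at this

/-- Decay of the Fourier transform in a coordinate direction. -/
theorem CurveSmooth.fourier_decay_coord {f : Eu n → ℂ} (hf : CurveSmooth f)
    (hs : HasCompactSupport f) (p : ℕ) (i : Fin n) :
    ∃ C, ∀ ξ : Eu n, |ξ i| ^ p * ‖𝓕 f ξ‖ ≤ C := by
  have hcont := hf.continuous_of_bounded hs
  have hint : Integrable f := hcont.integrable_of_hasCompactSupport hs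
  obtain ⟨M, hM⟩ := hf.bounded hs p (EuclideanSpace.single i (1 : ℝ))
  obtain ⟨R, hR⟩ := hs.isBounded.exists_norm_le
  have hR' : ∀ y, R < ‖y‖ → f y = 0 := fun y hy => by
    by_contra h0
    exact absurd (hR y (subset_tsupport f h0)) (not_le.2 hy)
  have hM0 : 0 ≤ M := (norm_nonneg _).trans (hM 0)
  set V : ℝ := (volume : Measure (Eu n)).real (Metric.closedBall 0 (R + p)) with hV
  have hV0 : 0 ≤ V := measureReal_nonneg
  refine ⟨max (∫ y, ‖f y‖) (M * V), fun ξ => ?_⟩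
  rcases le_total (|ξ i|) 1 with h1 | h1
  · refine le_trans ?_ (le_max_left _ _)
    refine le_trans ?_ (norm_fourier_le_integral f ξ)
    exact mul_le_of_le_one_left (norm_nonneg _) (pow_le_one₀ (abs_nonneg _) h1)
  · refine le_trans ?_ (le_max_right _ _)
    have hξ : ξ i ≠ 0 := fun h0 => by rw [h0, abs_zero] at h1; linarith
    -- With this step the character equals `-1`, so the `p`-th difference multiplies the Fourier
    -- transform by `(-2) ^ p`, while the difference itself is at most `|t| ^ p * M`. Since `|ξ i| ≥
    -- 1`, the step has length at most one and the differences vanish outside the ball of radius `R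
    -- + p`.
    set t : ℝ := (2 * ξ i)⁻¹ with ht
    set e : Eu n := EuclideanSpace.single i (1 : ℝ) with he
    have htabs : |t| = (2 * |ξ i|)⁻¹ := by rw [ht, abs_inv, abs_mul, abs_two]
    have hth : ‖t • e‖ ≤ 1 := by
      rw [norm_smul, he, PiLp.norm_single, norm_one, mul_one, Real.norm_eq_abs, htabs]
      exact inv_le_one_of_one_le₀ (by linarith)
    have hb : ∀ y, ‖(fwdDiff (t • e))^[p] f y‖ ≤ |t| ^ p * M := by
      intro y
      have h2 := fwdDiff_iterate_line p f y e t 0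
      rw [zero_smul, add_zero] at h2
      rw [h2]
      refine norm_fwdDiff_iterate_le p (hf.line e y) (fun s => ?_) t 0
      rw [iteratedDeriv_line]
      exact hM _
    have hint2 : ∫ y, ‖(fwdDiff (t • e))^[p] f y‖ ≤ |t| ^ p * M * V := by
      have h3 : ∫ y in Metric.closedBall (0 : Eu n) (R + p), ‖(fwdDiff (t • e))^[p] f y‖ =
          ∫ y, ‖(fwdDiff (t • e))^[p] f y‖ := by
        refine setIntegral_eq_integral_of_forall_compl_eq_zero fun y hy => ?_
        rw [fwdDiff_iterate_support p hR' hth y (by simpa using hy), norm_zero]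
      rw [← h3]
      refine (le_abs_self _).trans ?_
      rw [← Real.norm_eq_abs]
      refine norm_setIntegral_le_of_norm_le_const (measure_closedBall_lt_top) fun y _ => ?_
      rw [norm_norm]
      exact hb y
    have h4 := (norm_fourier_le_integral ((fwdDiff (t • e))^[p] f) ξ).trans hint2
    have h5 : (Real.fourierChar (inner ℝ (t • e) ξ) : ℂ) = -1 := by
      have h6 : inner ℝ (t • e) ξ = 1 / 2 := by
        rw [inner_smul_left, he, EuclideanSpace.inner_single_left]
        simp [ht]
        field_simp
      rw [h6, Real.fourierChar_apply]
      have : (((2 * Real.pi * (1 / 2) : ℝ)) : ℂ) * Complex.I = Real.pi * Complex.I := by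
        push_cast; ring
      rw [this, Complex.exp_pi_mul_I]
    rw [fourier_fwdDiff_iterate hint, h5, norm_mul, norm_pow, htabs] at h4
    have h7 : ‖(-1 - 1 : ℂ)‖ = 2 := by norm_num
    rw [h7] at h4
    have h8 : 0 < |ξ i| := by linarith
    have h9 : |ξ i| ^ p * (2 ^ p * ‖𝓕 f ξ‖) ≤ |ξ i| ^ p * (((2 * |ξ i|)⁻¹) ^ p * M * V) :=
      mul_le_mul_of_nonneg_left h4 (by positivity)
    have h10 : |ξ i| ^ p * (((2 * |ξ i|)⁻¹) ^ p * M * V) = (1 / 2) ^ p * (M * V) := by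
      rw [← mul_assoc, ← mul_assoc, ← mul_pow, mul_assoc]
      congr 2
      field_simp
    rw [h10] at h9
    have h11 : |ξ i| ^ p * ‖𝓕 f ξ‖ ≤ |ξ i| ^ p * (2 ^ p * ‖𝓕 f ξ‖) :=
      mul_le_mul_of_nonneg_left (le_mul_of_one_le_left (norm_nonneg _)
        (one_le_pow₀ (by norm_num))) (by positivity)
    have h12 : (1 / 2 : ℝ) ^ p * (M * V) ≤ M * V :=
      mul_le_of_le_one_left (by positivity) (pow_le_one₀ (by norm_num) (by norm_num))
    linarith

theorem CurveSmooth.fourier_decay {f : Eu n → ℂ} (hf : CurveSmooth f)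
    (hs : HasCompactSupport f) (p : ℕ) : ∃ C, ∀ ξ : Eu n, ‖ξ‖ ^ p * ‖𝓕 f ξ‖ ≤ C := by
  cases p with
  | zero => exact ⟨_, fun ξ => by simpa using norm_fourier_le_integral f ξ⟩
  | succ p =>
    choose C hC using hf.fourier_decay_coord hs (p + 1)
    refine ⟨(Fintype.card (Fin n) : ℝ) ^ p * ∑ i, C i, fun ξ => ?_⟩
    have h1 : ‖ξ‖ ≤ ∑ i, |ξ i| := by
      conv_lhs => rw [← (EuclideanSpace.basisFun (Fin n) ℝ).sum_repr ξ]
      refine (norm_sum_le _ _).trans (le_of_eq (Finset.sum_congr rfl fun i _ => ?_))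
      simp [norm_smul]
    have h2 : (∑ i, |ξ i|) ^ (p + 1) ≤ (Fintype.card (Fin n) : ℝ) ^ p * ∑ i, |ξ i| ^ (p + 1) := by
      rw [Fintype.card]
      exact pow_sum_le_card_mul_sum_pow (fun i _ => abs_nonneg _) p
    calc ‖ξ‖ ^ (p + 1) * ‖𝓕 f ξ‖
        ≤ ((Fintype.card (Fin n) : ℝ) ^ p * ∑ i, |ξ i| ^ (p + 1)) * ‖𝓕 f ξ‖ :=
          mul_le_mul_of_nonneg_right ((pow_le_pow_left₀ (norm_nonneg _) h1 _).trans h2)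
            (norm_nonneg _)
      _ = (Fintype.card (Fin n) : ℝ) ^ p * ∑ i, |ξ i| ^ (p + 1) * ‖𝓕 f ξ‖ := by
          rw [mul_assoc, Finset.sum_mul]
      _ ≤ _ := mul_le_mul_of_nonneg_left (Finset.sum_le_sum fun i _ => hC i ξ) (by positivity)

/-- Rapid decay makes all moments of `𝓕 f` integrable, so `𝓕 (𝓕 f)` is smooth; by Fourier inversion
it is `f` up to a reflection. -/
theorem CurveSmooth.contDiff_of_hasCompactSupport {f : Eu n → ℂ} (hf : CurveSmooth f)
    (hs : HasCompactSupport f) : ContDiff ℝ ∞ f := by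
  have hcont := hf.continuous_of_bounded hs
  have hint : Integrable f := hcont.integrable_of_hasCompactSupport hs
  have hFc : Continuous (𝓕 f) :=
    VectorFourier.fourierIntegral_continuous Real.continuous_fourierChar
      (L := innerₗ (Eu n)) (by exact continuous_inner) hint
  have hF : ∀ k : ℕ, Integrable fun ξ : Eu n => ‖ξ‖ ^ k * ‖𝓕 f ξ‖ := by
    intro k
    obtain ⟨C, hC⟩ := hf.fourier_decay hs k
    -- The `n + 1` additional powers of `‖ξ‖` allow a comparison with the integrable weight `(1 +
    -- ‖ξ‖) ^ (-(n + 1))`.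
    obtain ⟨C', hC'⟩ := hf.fourier_decay hs (k + (n + 1))
    have h1 : Integrable fun ξ : Eu n => (2 ^ (n + 1) * (C + C')) * (1 + ‖ξ‖) ^ (-((n : ℝ) + 1)) :=
      (integrable_one_add_norm (by simp)).const_mul _
    refine h1.mono' ((continuous_norm.pow k).mul hFc.norm).aestronglyMeasurable
      (Eventually.of_forall fun ξ => ?_)
    rw [Real.norm_eq_abs, abs_of_nonneg (by positivity), Real.rpow_neg (by positivity)]
    rw [← div_eq_mul_inv, le_div_iff₀ (by positivity)]
    have e : (1 + ‖ξ‖) ^ ((n : ℝ) + 1) = (1 + ‖ξ‖) ^ (n + 1) := by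
      rw [← Real.rpow_natCast]; norm_cast
    rw [e]
    have h2 : (1 + ‖ξ‖) ^ (n + 1) ≤ 2 ^ (n + 1) * (1 + ‖ξ‖ ^ (n + 1)) := by
      rcases le_total ‖ξ‖ 1 with h | h
      · calc (1 + ‖ξ‖) ^ (n + 1) ≤ 2 ^ (n + 1) := pow_le_pow_left₀ (by positivity) (by linarith) _
          _ ≤ _ := le_mul_of_one_le_right (by positivity) (by
            have : 0 ≤ ‖ξ‖ ^ (n + 1) := by positivity
            linarith)
      · calc (1 + ‖ξ‖) ^ (n + 1) ≤ (2 * ‖ξ‖) ^ (n + 1) :=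
            pow_le_pow_left₀ (by positivity) (by linarith) _
          _ = 2 ^ (n + 1) * ‖ξ‖ ^ (n + 1) := mul_pow _ _ _
          _ ≤ _ := mul_le_mul_of_nonneg_left (by linarith) (by positivity)
    have h3 := hC ξ
    have h4 := hC' ξ
    rw [pow_add] at h4
    calc ‖ξ‖ ^ k * ‖𝓕 f ξ‖ * (1 + ‖ξ‖) ^ (n + 1)
        ≤ ‖ξ‖ ^ k * ‖𝓕 f ξ‖ * (2 ^ (n + 1) * (1 + ‖ξ‖ ^ (n + 1))) :=
          mul_le_mul_of_nonneg_left h2 (by positivity)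
      _ = 2 ^ (n + 1) * (‖ξ‖ ^ k * ‖𝓕 f ξ‖ + ‖ξ‖ ^ k * ‖ξ‖ ^ (n + 1) * ‖𝓕 f ξ‖) := by ring
      _ ≤ _ := mul_le_mul_of_nonneg_left (add_le_add h3 h4) (by positivity)
  have hFi : Integrable (𝓕 f) := by
    have := hF 0
    simp only [pow_zero, one_mul] at this
    exact (integrable_norm_iff hFc.aestronglyMeasurable).1 this
  have hinv := hcont.fourierInv_fourier_eq hint hFi
  have h5 : ContDiff ℝ ∞ (𝓕 (𝓕 f)) := Real.contDiff_fourier (N := ⊤) fun k _ => hF k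
  have h6 : f = fun x => 𝓕 (𝓕 f) (-x) := by
    conv_lhs => rw [← hinv]
    funext x
    exact Real.fourierInv_eq_fourier_neg _ _
  rw [h6]
  exact h5.comp contDiff_neg

end Fourier

/-! ### Localisation of the smoothness criterion to open sets. -/

section Boman

/-- A smooth function with values in `(-δ, δ)` which is the identity near `0`. -/
theorem exists_contDiff_eq_id {δ : ℝ} (hδ : 0 < δ) :
    ∃ ρ : ℝ → ℝ, ContDiff ℝ ∞ ρ ∧ (∀ s, |ρ s| < δ) ∧ ρ =ᶠ[𝓝 0] id := by
  let b : ContDiffBump (0 : ℝ) := ⟨δ / 4, δ / 2, by positivity, by linarith⟩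
  refine ⟨fun s => b s * s, b.contDiff.mul contDiff_id, fun s => ?_, ?_⟩
  · rw [abs_mul, abs_of_nonneg b.nonneg]
    rcases lt_or_ge |s| (δ / 2) with h | h
    · have := mul_le_of_le_one_left (abs_nonneg s) (b.le_one (x := s))
      linarith
    · rw [b.zero_of_le_dist (by simpa using h), zero_mul]
      exact hδ
  · filter_upwards [b.eventuallyEq_one] with s hs
    simp [hs]

variable {E : Type*} [NormedAddCommGroup E] [NormedSpace ℝ E]

theorem CurveSmooth.of_contDiffAt {f : E → ℂ} (h : ∀ γ : ℝ → E, ContDiff ℝ ∞ γ → ∀ t,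
    ContDiffAt ℝ ∞ (f ∘ γ) t) : CurveSmooth f := fun γ hγ => contDiff_iff_contDiffAt.2 (h γ hγ)

/-- If `f` is smooth along smooth curves in the open set `U` then it is smooth along curves near
parameters which are mapped to `U`. -/
theorem contDiffAt_comp_curve {U : Set E} (hU : IsOpen U) {f : E → ℂ}
    (hf : ∀ γ : ℝ → E, ContDiff ℝ ∞ γ → (∀ t, γ t ∈ U) → ContDiff ℝ ∞ (f ∘ γ))
    {γ : ℝ → E} (hγ : ContDiff ℝ ∞ γ) {t : ℝ} (ht : γ t ∈ U) : ContDiffAt ℝ ∞ (f ∘ γ) t := by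
  obtain ⟨δ, hδ, hδ'⟩ := Metric.eventually_nhds_iff.1
    (hγ.continuous.continuousAt.eventually (hU.mem_nhds ht))
  obtain ⟨ρ, h1, h2, h3⟩ := exists_contDiff_eq_id hδ
  -- The reparametrised curve stays in `U` for all times and coincides with `γ` near `t`.
  have h4 := hf (fun s => γ (t + ρ (s - t)))
    (hγ.comp (contDiff_const.add (h1.comp (contDiff_id.sub contDiff_const))))
    (fun s => hδ' (by simpa [Real.dist_eq] using h2 (s - t)))
  refine h4.contDiffAt.congr_of_eventuallyEq ?_
  have h5 : Tendsto (fun s : ℝ => s - t) (𝓝 t) (𝓝 0) := by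
    have : Continuous fun s : ℝ => s - t := by fun_prop
    simpa using this.tendsto t
  filter_upwards [h5.eventually h3] with s hs
  simp only [Function.comp_apply, hs, id, add_sub_cancel]

/-- **Boman's theorem**: a function on an open subset of a finite-dimensional space which is smooth
along smooth curves is smooth. -/
theorem contDiffOn_of_curves [FiniteDimensional ℝ E] {U : Set E} (hU : IsOpen U) {f : E → ℂ}
    (hf : ∀ γ : ℝ → E, ContDiff ℝ ∞ γ → (∀ t, γ t ∈ U) → ContDiff ℝ ∞ (f ∘ γ)) :
    ContDiffOn ℝ ∞ f U := by
  intro x hx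
  refine ContDiffAt.contDiffWithinAt ?_
  let e : E ≃L[ℝ] Eu (Module.finrank ℝ E) := toEuclidean
  have hU' : IsOpen (e.symm ⁻¹' U) := hU.preimage e.symm.continuous
  have hx' : e x ∈ e.symm ⁻¹' U := by simpa using hx
  obtain ⟨r, hr, hrU⟩ := Metric.isOpen_iff.1 hU' _ hx'
  let b : ContDiffBump (e x) := ⟨r / 4, r / 2, by positivity, by linarith⟩
  have hbs : tsupport b ⊆ e.symm ⁻¹' U := by
    rw [b.tsupport_eq]
    exact (Metric.closedBall_subset_ball (by change r / 2 < r; linarith)).trans hrU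
  -- The cut-off function is smooth along every curve of the whole space: near times in the support
  -- of the bump the curve lies in `U`, and near all other times the product vanishes.
  have hg : CurveSmooth (fun y => b y • f (e.symm y)) := by
    refine CurveSmooth.of_contDiffAt fun γ hγ t => ?_
    by_cases h : γ t ∈ tsupport b
    · have h1 : ContDiffAt ℝ ∞ (f ∘ fun t => e.symm (γ t)) t :=
        contDiffAt_comp_curve hU hf (e.symm.contDiff.comp hγ) (hbs h)
      exact ((b.contDiff.comp hγ).contDiffAt).smul h1
    · have h1 : ((fun y => b y • f (e.symm y)) ∘ γ) =ᶠ[𝓝 t] fun _ => 0 := by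
        filter_upwards [hγ.continuous.continuousAt.eventually
          (notMem_tsupport_iff_eventuallyEq.1 h)] with s hs
        have hs' : b (γ s) = 0 := hs
        simp [hs']
      exact contDiffAt_const.congr_of_eventuallyEq h1
  have h1 := hg.contDiff_of_hasCompactSupport (b.hasCompactSupport.smul_right)
  have h2 : ContDiffAt ℝ ∞ (fun y => b (e y) • f (e.symm (e y))) x :=
    (h1.comp e.contDiff).contDiffAt
  refine h2.congr_of_eventuallyEq ?_
  filter_upwards [e.continuous.continuousAt.eventually b.eventuallyEq_one] with y hy
  have hy' : b (e y) = 1 := hy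
  simp [hy']

end Boman

/-! ## Differentials of smooth maps -/

section Differential

variable {V W : Type*} [AddCommGroup V] [Module ℝ V] [TopologicalSpace V]
  [IsTopologicalAddGroup V] [ContinuousSMul ℝ V]
  [AddCommGroup W] [Module ℝ W] [TopologicalSpace W] [IsTopologicalAddGroup W]
  [ContinuousSMul ℝ W]

theorem HasCurveDeriv.of_smul {c : ℝ → V} {v : V} (h : ∀ t, c t = c 0 + t • v) :
    HasCurveDeriv c v 0 := by
  refine Tendsto.congr' ?_ tendsto_const_nhds
  filter_upwards [self_mem_nhdsWithin] with t ht
  have ht' : t ≠ 0 := ht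
  rw [zero_add, h t, add_sub_cancel_left, smul_smul, inv_mul_cancel₀ ht', one_smul]

/-- `differential` is a `limUnder`, with a meaningless default where no limit exists; this lemma is
the way to compute it. -/
theorem differential_eq [T2Space W] {f : V → W} {x v : V} {w : W}
    (h : HasCurveDeriv (fun t : ℝ => f (x + t • v)) w 0) : differential f x v = w := by
  refine Tendsto.limUnder_eq (Tendsto.congr (fun t => ?_) h)
  simp

theorem ConvSmooth.comp_clm {f : V → W} (hf : ConvSmooth f) {Z : Type*} [AddCommGroup Z]
    [Module ℝ Z] [TopologicalSpace Z] [IsTopologicalAddGroup Z] [ContinuousSMul ℝ Z]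
    (T : W →L[ℝ] Z) : ConvSmooth fun x => T (f x) :=
  fun c hc => (hf c hc).clm T

theorem ConvSmooth.clm_comp {Z : Type*} [AddCommGroup Z] [Module ℝ Z] [TopologicalSpace Z]
    [IsTopologicalAddGroup Z] [ContinuousSMul ℝ Z]
    {f : V → W} (hf : ConvSmooth f) (T : Z →L[ℝ] V) : ConvSmooth fun x => f (T x) :=
  fun _ hc => hf _ (hc.clm T)

theorem ConvSmooth.clm (T : V →L[ℝ] W) : ConvSmooth T := fun _ hc => hc.clm T

variable [T2Space V]

theorem isSmoothCurve_line (x v : V) : IsSmoothCurve fun t : ℝ => x + t • v :=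
  (IsSmoothCurve.const x).add ((IsSmoothCurve.const v).smul contDiff_id)

theorem ConvSmooth.hasCurveDeriv [T2Space W] {f : V → W} (hf : ConvSmooth f) (x v : V) :
    HasCurveDeriv (fun t : ℝ => f (x + t • v)) (differential f x v) 0 := by
  obtain ⟨d, -, hd⟩ := (hf _ (isSmoothCurve_line x v)).exists_deriv
  have h : HasCurveDeriv (fun t : ℝ => f (x + t • v)) (d 0) 0 := hd 0
  rwa [differential_eq h]

theorem ConvSmooth.differential_comp_clm [T2Space W] {f : V → W} (hf : ConvSmooth f) {Z : Type*}
    [AddCommGroup Z] [Module ℝ Z] [TopologicalSpace Z] [IsTopologicalAddGroup Z]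
    [ContinuousSMul ℝ Z] [T2Space Z] (T : W →L[ℝ] Z) (x v : V) :
    differential (fun y => T (f y)) x v = T (differential f x v) :=
  differential_eq ((hf.hasCurveDeriv x v).clm T)

theorem differential_linear [T2Space W] {T : V → W} (h1 : ∀ x y, T (x + y) = T x + T y)
    (h2 : ∀ (c : ℝ) x, T (c • x) = c • T x) (x v : V) : differential T x v = T v :=
  differential_eq (HasCurveDeriv.of_smul fun t => by simp [h1, h2])

theorem contDiff_of_curveSmooth {E : Type*} [NormedAddCommGroup E] [NormedSpace ℝ E]
    [FiniteDimensional ℝ E] {f : E → ℂ} (hf : CurveSmooth f) : ContDiff ℝ ∞ f :=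
  contDiffOn_univ.1 (contDiffOn_of_curves isOpen_univ fun _ hγ _ => hf _ hγ)

/-- Scalar smooth maps are smooth on two-dimensional smooth plots. -/
theorem ConvSmooth.contDiff_plot {s : V → ℂ} (hs : ConvSmooth s) {g : ℝ × ℝ → V}
    (hg : ∀ a b : ℝ → ℝ, ContDiff ℝ ∞ a → ContDiff ℝ ∞ b → IsSmoothCurve fun t => g (a t, b t)) :
    ContDiff ℝ ∞ fun p => s (g p) :=
  contDiff_of_curveSmooth fun _ hγ => isSmoothCurve_iff_contDiff.1
    (hs _ (hg _ _ (contDiff_fst.comp hγ) (contDiff_snd.comp hγ)))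

/-- The derivative along the diagonal is the sum of the partial derivatives. -/
theorem hasDerivAt_diag {g : ℝ × ℝ → ℂ} (hg : DifferentiableAt ℝ g (0, 0)) {a b : ℂ}
    (ha : HasDerivAt (fun t => g (t, 0)) a 0) (hb : HasDerivAt (fun t => g (0, t)) b 0) :
    HasDerivAt (fun t => g (t, t)) (a + b) 0 := by
  have h := hg.hasFDerivAt
  have h1 : HasDerivAt (fun t => g (t, 0)) (fderiv ℝ g (0, 0) (1, 0)) 0 :=
    HasFDerivAt.comp_hasDerivAt (f := fun t : ℝ => (t, (0 : ℝ))) (0 : ℝ) h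
      ((hasDerivAt_id (0 : ℝ)).prodMk (hasDerivAt_const (0 : ℝ) (0 : ℝ)))
  have h2 : HasDerivAt (fun t => g (0, t)) (fderiv ℝ g (0, 0) (0, 1)) 0 :=
    HasFDerivAt.comp_hasDerivAt (f := fun t : ℝ => ((0 : ℝ), t)) (0 : ℝ) h
      ((hasDerivAt_const (0 : ℝ) (0 : ℝ)).prodMk (hasDerivAt_id (0 : ℝ)))
  have h3 : HasDerivAt (fun t => g (t, t)) (fderiv ℝ g (0, 0) (1, 1)) 0 :=
    HasFDerivAt.comp_hasDerivAt (f := fun t : ℝ => (t, t)) (0 : ℝ) h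
      ((hasDerivAt_id (0 : ℝ)).prodMk (hasDerivAt_id (0 : ℝ)))
  rw [ha.unique h1, hb.unique h2, ← map_add]
  simpa using h3

/-- On the plane `x + a v + b w` Boman's theorem makes `s` a smooth function of two real variables,
whose derivative is linear. -/
theorem ConvSmooth.differential_add {s : V → ℂ} (hs : ConvSmooth s) (x v w : V) :
    differential s x (v + w) = differential s x v + differential s x w := by
  have hg : ContDiff ℝ ∞ fun p : ℝ × ℝ => s (x + p.1 • v + p.2 • w) :=
    hs.contDiff_plot fun a b ha hb => ((IsSmoothCurve.const x).add
      ((IsSmoothCurve.const v).smul ha)).add ((IsSmoothCurve.const w).smul hb)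
  have h1 := hasCurveDeriv_iff_hasDerivAt.1 (hs.hasCurveDeriv x v)
  have h2 := hasCurveDeriv_iff_hasDerivAt.1 (hs.hasCurveDeriv x w)
  have h3 := hasDerivAt_diag ((hg.differentiable (by simp)) _) (a := differential s x v)
    (b := differential s x w) (by simpa using h1) (by simpa using h2)
  refine differential_eq (hasCurveDeriv_iff_hasDerivAt.2 ?_)
  simpa [add_assoc] using h3

theorem ConvSmooth.differential_smul {s : V → ℂ} (hs : ConvSmooth s) (x v : V) (r : ℝ) :
    differential s x (r • v) = r • differential s x v := by
  have h1 := hs.hasCurveDeriv x v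
  have h2 : HasDerivAt (fun t : ℝ => t * r) r 0 := by
    simpa using (hasDerivAt_id (0 : ℝ)).mul_const r
  have h3 : HasCurveDeriv (fun t : ℝ => s (x + (t * r) • v)) (r • differential s x v) 0 :=
    HasCurveDeriv.comp (c := fun t : ℝ => s (x + t • v)) h2 (by simpa using h1)
  refine differential_eq ?_
  simpa [mul_smul] using h3

theorem ConvSmooth.differential_zero {s : V → ℂ} (hs : ConvSmooth s) (x : V) :
    differential s x 0 = 0 := by
  have := hs.differential_smul x 0 0
  simpa using this

theorem ConvSmooth.differential_sum {s : V → ℂ} (hs : ConvSmooth s) (x : V) {ι : Type*}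
    (I : Finset ι) (v : ι → V) :
    differential s x (∑ i ∈ I, v i) = ∑ i ∈ I, differential s x (v i) := by
  classical
  induction I using Finset.induction_on with
  | empty => simpa using hs.differential_zero x
  | insert a I ha ih => rw [Finset.sum_insert ha, Finset.sum_insert ha, hs.differential_add, ih]

variable {n : ℕ} {Ω : Opens (Eu n)}

/-- The differential of a smooth map is smooth. -/
theorem ConvSmooth.differential_curve {R : V → CInf Ω} (hR : ConvSmooth R) {c v : ℝ → V}
    (hc : IsSmoothCurve c) (hv : IsSmoothCurve v) :
    IsSmoothCurve fun s => differential R (c s) (v s) := by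
  set U : Set (ℝ × ℝ × Eu n) := Set.univ ×ˢ Set.univ ×ˢ (Ω : Set (Eu n)) with hU
  have hUo : IsOpen U := isOpen_univ.prod (isOpen_univ.prod Ω.isOpen)
  -- The differential is the derivative of `g` in its second variable at `0`. Boman's theorem makes
  -- `g` jointly smooth, and the passage from functions of `(s, x)` to curves then applies to this
  -- derivative.
  set g : ℝ × ℝ × Eu n → ℂ := fun p => R (c p.1 + p.2.1 • v p.1) p.2.2 with hgdef
  have hg : ContDiffOn ℝ ∞ g U := by
    refine contDiffOn_of_curves hUo fun γ hγ hγU => isSmoothCurve_iff_contDiff.1 ?_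
    have h1 : ContDiff ℝ ∞ fun t => (γ t).1 := contDiff_fst.comp hγ
    have h2 : ContDiff ℝ ∞ fun t => (γ t).2.1 := contDiff_fst.comp (contDiff_snd.comp hγ)
    have h3 : ContDiff ℝ ∞ fun t => (γ t).2.2 := contDiff_snd.comp (contDiff_snd.comp hγ)
    exact (hR _ ((hc.comp h1).add ((hv.comp h1).smul h2))).eval_curve h3 fun t => (hγU t).2.2
  have hg' := contDiffOn_dirDeriv hUo hg ((0 : ℝ), (1 : ℝ), (0 : Eu n))
  refine isSmoothCurve_of_contDiffOn
    (g := fun p => dirDeriv ((0 : ℝ), (1 : ℝ), (0 : Eu n)) g (p.1, 0, p.2)) ?_ fun s x hx => ?_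
  · exact hg'.comp (contDiff_fst.prodMk (contDiff_const.prodMk contDiff_snd)).contDiffOn
      fun p hp => ⟨Set.mem_univ _, Set.mem_univ _, hp.2⟩
  · have h1 := (hR.hasCurveDeriv (c s) (v s)).clm (SmoothMap.evalCLM ℝ x)
    have h2 : HasFDerivAt g _ (s, (0 : ℝ), x) := ((hg.contDiffAt (hUo.mem_nhds
      ⟨Set.mem_univ _, Set.mem_univ _, hx⟩)).differentiableAt (by simp)).hasFDerivAt
    have h3 : HasDerivAt (fun t : ℝ => g (s, t, x))
        (fderiv ℝ g (s, (0 : ℝ), x) (0, 1, 0)) 0 :=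
      HasFDerivAt.comp_hasDerivAt (f := fun t : ℝ => (s, t, x)) (0 : ℝ) h2 ((hasDerivAt_const (0 : ℝ) s).prodMk
        ((hasDerivAt_id (0 : ℝ)).prodMk (hasDerivAt_const (0 : ℝ) x)))
    exact h1.unique (hasCurveDeriv_iff_hasDerivAt.2 h3)

end Differential

/-! ## Hadamard's lemma for curves and the chain rule -/

section Hadamard

variable {V : Type*} [AddCommGroup V] [Module ℝ V] [TopologicalSpace V]
  [IsTopologicalAddGroup V] [ContinuousSMul ℝ V]

/-- For a curve with iterated derivatives `D`, the elements `∫₀ᵗ sᵏ D (k + 1) s ds`. -/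
def momentCurve (D : ℕ → ℝ → V) : ℕ → ℝ → V
  | 0, t => D 0 t - D 0 0
  | k + 1, t => t ^ (k + 1) • D (k + 1) t - ((k : ℝ) + 1) • momentCurve D k t

open Classical in
/-- The iterated derivatives of the difference quotient `t⁻¹ (D 0 t - D 0 0)`. -/
noncomputable def quotientCurve (D : ℕ → ℝ → V) (k : ℕ) (t : ℝ) : V :=
  if t = 0 then ((k : ℝ) + 1)⁻¹ • D (k + 1) 0 else (t ^ (k + 1))⁻¹ • momentCurve D k t

theorem momentCurve_zero (D : ℕ → ℝ → V) (k : ℕ) : momentCurve D k 0 = 0 := by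
  induction k with
  | zero => simp [momentCurve]
  | succ k ih => simp [momentCurve, ih]

/-- The recursion for `momentCurve` is integration by parts; verifying the derivative avoids
integrals, which need not exist in an incomplete space. -/
theorem hasCurveDeriv_momentCurve {D : ℕ → ℝ → V} (hD : ∀ k t, HasCurveDeriv (D k) (D (k + 1) t) t)
    (k : ℕ) (t : ℝ) : HasCurveDeriv (momentCurve D k) (t ^ k • D (k + 1) t) t := by
  induction k with
  | zero =>
    have := (hD 0 t).add (HasCurveDeriv.const (-D 0 0) t)
    have e : (fun s => D 0 s + -D 0 0) = momentCurve D 0 := by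
      funext s; rw [momentCurve, sub_eq_add_neg]
    rw [e] at this
    simpa using this
  | succ k ih =>
    have h1 := (hD (k + 1) t).smul (hasDerivAt_pow (k + 1) t)
    have h2 := ih.smul (hasDerivAt_const t (-((k : ℝ) + 1)))
    have h3 := h1.add h2
    have e : (fun s => s ^ (k + 1) • D (k + 1) s + -((k : ℝ) + 1) • momentCurve D k s) =
        momentCurve D (k + 1) := by
      funext s; rw [momentCurve, neg_smul, ← sub_eq_add_neg]
    rw [e] at h3
    convert h3 using 1
    push_cast
    simp only [zero_smul, zero_add]
    module

/-- Formally the value at `t` is `∫₀¹ rᵏ D (k + 1) (r t) dr`. In place of the integral, the mean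
value theorem is applied to the moment minus its leading term, with derivative `sᵏ (D (k + 1) s - D
(k + 1) 0)`. After division by `tᵏ` this stays in a convex neighbourhood of zero, because `0 ≤ s / t
≤ 1`. -/
theorem continuousAt_quotientCurve [LocallyConvexSpace ℝ V] {D : ℕ → ℝ → V}
    (hD : ∀ k t, HasCurveDeriv (D k) (D (k + 1) t) t) (k : ℕ) :
    ContinuousAt (quotientCurve D k) 0 := by
  have key : Tendsto (fun t => quotientCurve D k t - quotientCurve D k 0) (𝓝 0) (𝓝 0) := by
    intro N hN
    obtain ⟨C, hC, hCN, hC1, hC2⟩ := exists_convex_isClosed_nhds_zero hN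
    have hC0 : (0 : V) ∈ C := mem_of_mem_nhds hC
    have h1 : Tendsto (fun s => D (k + 1) s - D (k + 1) 0) (𝓝 0) (𝓝 0) := by
      have := (hD (k + 1) 0).continuousAt.tendsto.sub_const (D (k + 1) 0)
      rwa [sub_self] at this
    obtain ⟨δ, hδ, hδ'⟩ := Metric.eventually_nhds_iff.1 (h1 hC)
    refine Metric.eventually_nhds_iff.2 ⟨δ, hδ, fun t ht => hCN ?_⟩
    rw [Real.dist_0_eq_abs] at ht
    by_cases h0 : t = 0
    · beta_reduce
      rw [h0, sub_self]
      exact hC0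
    set q : ℝ → V := fun s => momentCurve D k s +
      (-(s ^ (k + 1) * ((k : ℝ) + 1)⁻¹)) • D (k + 1) 0 with hq
    have hk : ((k : ℝ) + 1) ≠ 0 := by positivity
    have hqd : ∀ s, HasCurveDeriv q (s ^ k • (D (k + 1) s - D (k + 1) 0)) s := by
      intro s
      have h2 : HasDerivAt (fun s : ℝ => -(s ^ (k + 1) * ((k : ℝ) + 1)⁻¹)) (-s ^ k) s := by
        have := ((hasDerivAt_pow (k + 1) s).mul_const ((k : ℝ) + 1)⁻¹).neg
        convert! this using 1
        push_cast
        field_simp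
      have h3 := (hasCurveDeriv_momentCurve hD k s).add
        ((HasCurveDeriv.const (D (k + 1) 0) s).smul h2)
      convert h3 using 1
      module
    have hq0 : q 0 = 0 := by simp [hq, momentCurve_zero]
    have hconv : Convex ℝ ((fun y : V => (t ^ k)⁻¹ • y) ⁻¹' C) :=
      hC1.linear_preimage (LinearMap.lsmul ℝ V (t ^ k)⁻¹)
    have hclosed : IsClosed ((fun y : V => (t ^ k)⁻¹ • y) ⁻¹' C) :=
      hC2.preimage (continuous_const_smul _)
    have hmem : ∀ s, 0 ≤ s / t → s / t ≤ 1 →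
        s ^ k • (D (k + 1) s - D (k + 1) 0) ∈ (fun y : V => (t ^ k)⁻¹ • y) ⁻¹' C := by
      intro s h3 h4
      have h5 : D (k + 1) s - D (k + 1) 0 ∈ C := by
        refine hδ' ?_
        rw [Real.dist_0_eq_abs]
        have : |s| = |s / t| * |t| := by rw [← abs_mul, div_mul_cancel₀ _ h0]
        rw [this, abs_of_nonneg h3]
        exact lt_of_le_of_lt (mul_le_of_le_one_left (abs_nonneg _) h4) ht
      change (t ^ k)⁻¹ • s ^ k • _ ∈ C
      rw [smul_smul, inv_mul_eq_div, ← div_pow]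
      exact hC1.smul_mem_of_zero_mem hC0 h5 ⟨pow_nonneg h3 _, pow_le_one₀ h3 h4⟩
    have hcont : ∀ a b : ℝ, ContinuousOn q (Set.Icc a b) := fun a b s _ =>
      (hqd s).continuousAt.continuousWithinAt
    have h6 : t⁻¹ • q t ∈ (fun y : V => (t ^ k)⁻¹ • y) ⁻¹' C := by
      rcases lt_or_gt_of_ne h0 with hneg | hpos
      · have := mean_value_mem hconv hclosed hneg (hcont _ _) (fun s _ => hqd s)
          (fun s hs => hmem s (div_nonneg_of_nonpos hs.2.le hneg.le)
            ((div_le_one_of_neg hneg).2 hs.1.le))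
        rw [hq0, zero_sub, zero_sub, inv_neg, neg_smul, smul_neg, neg_neg] at this
        exact this
      · have := mean_value_mem hconv hclosed hpos (hcont _ _) (fun s _ => hqd s)
          (fun s hs => hmem s (div_nonneg hs.1.le hpos.le) ((div_le_one hpos).2 hs.2.le))
        rw [hq0, sub_zero, sub_zero] at this
        exact this
    have e : quotientCurve D k t - quotientCurve D k 0 = (t ^ k)⁻¹ • t⁻¹ • q t := by
      rw [quotientCurve, if_neg h0, quotientCurve, if_pos rfl, hq, smul_smul, smul_add, smul_smul,
        sub_eq_add_neg, ← mul_inv, ← pow_succ]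
      congr 1
      rw [← neg_smul]
      congr 1
      have : t ^ (k + 1) ≠ 0 := pow_ne_zero _ h0
      field_simp
    beta_reduce
    rw [e]
    exact h6
  have := key.add_const (quotientCurve D k 0)
  simpa [ContinuousAt] using this

/-- Away from `0` this is the product rule. At `0` the mean value theorem places the slope in any
closed convex neighbourhood that contains the nearby values of the next quotient curve, which is
continuous there. -/
theorem hasCurveDeriv_quotientCurve [LocallyConvexSpace ℝ V] {D : ℕ → ℝ → V}
    (hD : ∀ k t, HasCurveDeriv (D k) (D (k + 1) t) t) (k : ℕ) (t : ℝ) :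
    HasCurveDeriv (quotientCurve D k) (quotientCurve D (k + 1) t) t := by
  have hne : ∀ t : ℝ, t ≠ 0 → ∀ k,
      HasCurveDeriv (quotientCurve D k) (quotientCurve D (k + 1) t) t := by
    intro t ht k
    have h1 : HasDerivAt (fun s : ℝ => (s ^ (k + 1))⁻¹)
        (-(((k + 1 : ℕ) : ℝ) * t ^ k) / (t ^ (k + 1)) ^ 2) t :=
      (hasDerivAt_pow (k + 1) t).inv (pow_ne_zero _ ht)
    have h2 := (hasCurveDeriv_momentCurve hD k t).smul h1
    have h3 : HasCurveDeriv (quotientCurve D k) _ t := h2.congr (by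
      filter_upwards [isOpen_ne.mem_nhds ht] with s hs
      rw [quotientCurve, if_neg hs])
    convert h3 using 1
    rw [quotientCurve, if_neg ht, momentCurve, smul_sub, smul_smul, smul_smul, smul_smul,
      sub_eq_neg_add, ← neg_smul]
    congr 2
    · push_cast
      field_simp
      ring
    · field_simp
      ring
  have hcont : ∀ k, Continuous (quotientCurve D k) := fun k =>
    continuous_iff_continuousAt.2 fun t => by
      by_cases ht : t = 0
      · rw [ht]; exact continuousAt_quotientCurve hD k
      · exact (hne t ht k).continuousAt
  by_cases ht : t = 0
  swap
  · exact hne t ht k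
  subst ht
  have key : Tendsto (fun t => t⁻¹ • (quotientCurve D k (0 + t) - quotientCurve D k 0) -
      quotientCurve D (k + 1) 0) (𝓝[≠] 0) (𝓝 0) := by
    intro N hN
    obtain ⟨C, hC, hCN, hC1, hC2⟩ := exists_convex_isClosed_nhds_zero hN
    have h1 : Tendsto (fun s => quotientCurve D (k + 1) s - quotientCurve D (k + 1) 0)
        (𝓝 0) (𝓝 0) := by
      have := ((hcont (k + 1)).tendsto 0).sub_const (quotientCurve D (k + 1) 0)
      rwa [sub_self] at this
    obtain ⟨δ, hδ, hδ'⟩ := Metric.eventually_nhds_iff.1 (h1 hC)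
    have h2 : ∀ᶠ s in 𝓝[≠] (0 : ℝ), dist s 0 < δ :=
      (Metric.eventually_nhds_iff.2 ⟨δ, hδ, fun _ h => h⟩ :
        ∀ᶠ s in 𝓝 (0 : ℝ), dist s 0 < δ).filter_mono nhdsWithin_le_nhds
    have hconv : Convex ℝ ((fun y : V => y + -quotientCurve D (k + 1) 0) ⁻¹' C) :=
      hC1.translate_preimage_left _
    have hclosed : IsClosed ((fun y : V => y + -quotientCurve D (k + 1) 0) ⁻¹' C) :=
      hC2.preimage (continuous_id.add continuous_const)
    have hmem : ∀ s, |s| < δ →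
        quotientCurve D (k + 1) s ∈ (fun y : V => y + -quotientCurve D (k + 1) 0) ⁻¹' C := by
      intro s hs
      have := hδ' (y := s) (by rwa [Real.dist_0_eq_abs])
      rw [Set.mem_preimage, ← sub_eq_add_neg]
      exact this
    rw [mem_map]
    filter_upwards [h2, self_mem_nhdsWithin] with s hs hs0
    have hs0' : s ≠ 0 := hs0
    rw [Real.dist_0_eq_abs] at hs
    rw [Set.mem_preimage]
    refine hCN ?_
    rw [zero_add, sub_eq_add_neg _ (quotientCurve D (k + 1) 0)]
    rcases lt_or_gt_of_ne hs0' with hneg | hpos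
    · have := mean_value_mem hconv hclosed hneg (hcont k).continuousOn
        (fun r hr => hne r hr.2.ne k) (fun r hr => hmem r (by
          rw [abs_of_neg hr.2]; rw [abs_of_neg hneg] at hs; linarith [hr.1]))
      rw [zero_sub, inv_neg, neg_smul, ← smul_neg, neg_sub] at this
      exact this
    · have := mean_value_mem hconv hclosed hpos (hcont k).continuousOn
        (fun r hr => hne r hr.1.ne' k) (fun r hr => hmem r (by
          rw [abs_of_pos hr.1]; rw [abs_of_pos hpos] at hs; linarith [hr.2]))
      rw [sub_zero] at this
      exact this
  have := key.add_const (quotientCurve D (k + 1) 0)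
  simpa [HasCurveDeriv] using this

/-- Hadamard's lemma for smooth curves in locally convex spaces. -/
theorem IsSmoothCurve.exists_quotient [LocallyConvexSpace ℝ V] {c : ℝ → V} (hc : IsSmoothCurve c) :
    ∃ q : ℝ → V, IsSmoothCurve q ∧ HasCurveDeriv c (q 0) 0 ∧ ∀ t, c t = c 0 + t • q t := by
  obtain ⟨D, rfl, hD⟩ := hc
  refine ⟨quotientCurve D 0, ⟨quotientCurve D, rfl, hasCurveDeriv_quotientCurve hD⟩, ?_, fun t => ?_⟩
  · have : quotientCurve D 0 0 = D 1 0 := by simp [quotientCurve]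
    rw [this]
    exact hD 0 0
  · by_cases ht : t = 0
    · simp [ht]
    · rw [quotientCurve, if_neg ht, smul_smul]
      simp [momentCurve, ht]

/-- The chain rule for scalar smooth maps. -/
theorem ConvSmooth.chain_rule [LocallyConvexSpace ℝ V] [T2Space V] {s : V → ℂ} (hs : ConvSmooth s)
    {c : ℝ → V} {c' : V} (hc : IsSmoothCurve c) (hc' : HasCurveDeriv c c' 0) :
    HasDerivAt (fun t => s (c t)) (differential s (c 0) c') 0 := by
  obtain ⟨q, hq, hq0, hcq⟩ := hc.exists_quotient
  obtain rfl : c' = q 0 := hc'.unique hq0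
  -- The diagonal of this function is `s ∘ c` by Hadamard's lemma. It is constant in the second
  -- variable when the first is `0`, so only the derivative along `q 0 = c'` contributes.
  have hg : ContDiff ℝ ∞ fun p : ℝ × ℝ => s (c 0 + p.1 • q p.2) :=
    hs.contDiff_plot fun a b ha hb => (IsSmoothCurve.const (c 0)).add ((hq.comp hb).smul ha)
  have h1 := hasCurveDeriv_iff_hasDerivAt.1 (hs.hasCurveDeriv (c 0) (q 0))
  have h3 := hasDerivAt_diag ((hg.differentiable (by simp)) _)
    (a := differential s (c 0) (q 0)) (b := 0) h1 (by simpa using hasDerivAt_const 0 (s (c 0)))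
  rw [add_zero] at h3
  simpa only [← hcq] using h3

end Hadamard

/-! ## Lie derivatives as continuous linear maps -/

section Lie

variable {n : ℕ} {Ω : Opens (Eu n)}

section General

variable {F : Type*} [AddCommGroup F] [Module ℝ F] [TopologicalSpace F]
  [IsTopologicalAddGroup F] [ContinuousSMul ℝ F] [T2Space F]

theorem lieDir_apply (X : VectorField Ω) (f : SmoothMap Ω F) (x : Eu n) :
    lieDir X f x = ∑ i, X x i • SmoothMap.pd i f x := by
  rw [lieDir, SmoothMap.sum_apply]
  rfl

theorem lieDir_congr (X : VectorField Ω) {f g : SmoothMap Ω F} {U : Opens (Eu n)} (hU : U ≤ Ω)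
    (h : ∀ x ∈ U, f x = g x) {x : Eu n} (hx : x ∈ U) : lieDir X f x = lieDir X g x := by
  simp only [lieDir_apply]
  exact Finset.sum_congr rfl fun i _ => by rw [SmoothMap.pd_congr hU h i hx]

theorem lieDir_postcomp {G : Type*} [AddCommGroup G] [Module ℝ G] [TopologicalSpace G]
    [IsTopologicalAddGroup G] [ContinuousSMul ℝ G] [T2Space G] (X : VectorField Ω) (T : F →L[ℝ] G)
    (f : SmoothMap Ω F) : lieDir X (f.postcomp T) = (lieDir X f).postcomp T := by
  refine DFunLike.ext _ _ fun x => ?_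
  simp only [lieDir_apply, SmoothMap.postcomp_apply, SmoothMap.pd_postcomp, map_sum, map_smul]

theorem lieDir_const (X : VectorField Ω) (v : F) : lieDir X (SmoothMap.const Ω v) = 0 := by
  refine DFunLike.ext _ _ fun x => ?_
  simp only [lieDir_apply, SmoothMap.pd_const, SmoothMap.zero_apply, smul_zero,
    Finset.sum_const_zero]

variable {𝕜 : Type*} [NormedField 𝕜] [Module 𝕜 F] [SMulCommClass ℝ 𝕜 F] [ContinuousSMul 𝕜 F]

variable (𝕜) in
/-- The directional derivative as a continuous linear map. -/
noncomputable def lieDirCLM (X : VectorField Ω) : SmoothMap Ω F →L[𝕜] SmoothMap Ω F where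
  toFun := lieDir X
  map_add' f g := DFunLike.ext _ _ fun x => by
    simp only [lieDir_apply, SmoothMap.add_apply, SmoothMap.pd_add, smul_add,
      Finset.sum_add_distrib]
  map_smul' c f := DFunLike.ext _ _ fun x => by
    have : SMulCommClass 𝕜 ℝ F := SMulCommClass.symm ℝ 𝕜 F
    simp only [lieDir_apply, SmoothMap.const_smul_apply, SmoothMap.pd_const_smul, Finset.smul_sum,
      RingHom.id_apply]
    exact Finset.sum_congr rfl fun i _ => smul_comm _ _ _
  cont := continuous_finsetSum _ fun i _ =>
    (SmoothMap.continuous_smul_left (component i X)).comp (SmoothMap.pdCLM ℝ i).continuous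

end General

theorem lieSK_apply (X : VectorField Ω) (φ : SK Ω) (x : Eu n) :
    lieSK X φ x = ∑ i, X x i • SmoothMap.pd i φ x + lieForm X (φ x) := by
  rw [lieSK, SmoothMap.add_apply, lieDir_apply, SmoothMap.postcomp_apply]
  rfl

/-- The Lie derivative of smoothing kernels as a continuous linear map. -/
noncomputable def lieSKCLM (X : VectorField Ω) : SK Ω →L[ℂ] SK Ω where
  toFun := lieSK X
  map_add' φ ψ := DFunLike.ext _ _ fun x => by
    simp only [lieSK_apply, SmoothMap.add_apply, SmoothMap.pd_add, smul_add,
      Finset.sum_add_distrib, map_add]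
    abel
  map_smul' c φ := DFunLike.ext _ _ fun x => by
    simp only [lieSK_apply, SmoothMap.const_smul_apply, SmoothMap.pd_const_smul, Finset.smul_sum,
      RingHom.id_apply, map_smul, smul_add]
    congr 1
    exact Finset.sum_congr rfl fun i _ => smul_comm _ _ _
  cont := (lieDirCLM ℝ X).continuous.add (SmoothMap.continuous_postcomp _)

theorem lieSK_congr (X : VectorField Ω) {φ ψ : SK Ω} {U : Opens (Eu n)} (hU : U ≤ Ω)
    (h : ∀ x ∈ U, φ x = ψ x) {x : Eu n} (hx : x ∈ U) : lieSK X φ x = lieSK X ψ x := by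
  simp only [lieSK_apply, h x hx]
  congr 1
  exact Finset.sum_congr rfl fun i _ => by rw [SmoothMap.pd_congr hU h i hx]

theorem lieHat_apply (X : VectorField Ω) (R : SK Ω → CInf Ω) (φ : SK Ω) (x : Eu n) :
    lieHat X R φ x = -differential R φ (lieSK X φ) x + lieDir X (R φ) x := rfl

end Lie

/-! ## Invariance of the spaces of nonlinear maps -/

section Invariance

variable {n : ℕ} {Ω : Opens (Eu n)}

theorem ConvSmooth.neg_add {V W : Type*} [AddCommGroup V] [Module ℝ V] [TopologicalSpace V]
    [AddCommGroup W] [Module ℝ W] [TopologicalSpace W] [IsTopologicalAddGroup W]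
    [ContinuousSMul ℝ W] {f g : V → W} (hf : ConvSmooth f) (hg : ConvSmooth g) :
    ConvSmooth fun x => -f x + g x := fun c hc =>
  ((hf c hc).clm (-ContinuousLinearMap.id ℝ W)).add (hg c hc)

theorem lieHat_mem_basE (X : VectorField Ω) {R : SK Ω → CInf Ω} (hR : R ∈ basE Ω) :
    lieHat X R ∈ basE Ω :=
  ConvSmooth.neg_add (fun _ hc => hR.differential_curve hc
    (hc.clm ((lieSKCLM X).restrictScalars ℝ))) (hR.comp_clm (lieDirCLM ℝ X))

theorem lieTilde_mem_basE (X : VectorField Ω) {R : SK Ω → CInf Ω} (hR : R ∈ basE Ω) :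
    lieTilde X R ∈ basE Ω := ConvSmooth.comp_clm hR (lieDirCLM ℝ X)

theorem hasCurveDeriv_differential_apply {V : Type*} [AddCommGroup V] [Module ℝ V]
    [TopologicalSpace V] [IsTopologicalAddGroup V] [ContinuousSMul ℝ V] [T2Space V]
    {R : V → CInf Ω} (hR : ConvSmooth R) (φ v : V) (x : Eu n) :
    HasCurveDeriv (fun t : ℝ => R (φ + t • v) x) (differential R φ v x) 0 :=
  (hR.hasCurveDeriv φ v).clm (SmoothMap.evalCLM ℝ x)

/-- The Lie derivative of kernels is local, so the lines `φ + t • lieSK X φ` and `ψ + t • lieSK X ψ`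
agree on `U`; hence so do the difference quotients of `R` there. -/
theorem lieHat_mem_basEloc (X : VectorField Ω) {R : SK Ω → CInf Ω} (hR : R ∈ basEloc Ω) :
    lieHat X R ∈ basEloc Ω := by
  refine ⟨lieHat_mem_basE X hR.1, fun U hU φ ψ h x hx => ?_⟩
  rw [lieHat_apply, lieHat_apply, lieDir_congr X hU (hR.2 U hU φ ψ h) hx]
  congr 2
  refine (hasCurveDeriv_differential_apply hR.1 φ (lieSK X φ) x).unique ?_
  refine (hasCurveDeriv_differential_apply hR.1 ψ (lieSK X ψ) x).congr (.of_forall fun t => ?_)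
  refine hR.2 U hU _ _ (fun y hy => ?_) x hx
  rw [SmoothMap.add_apply, SmoothMap.add_apply, SmoothMap.const_smul_apply,
    SmoothMap.const_smul_apply, h y hy, lieSK_congr X hU h hy]

theorem lieTilde_mem_basEloc (X : VectorField Ω) {R : SK Ω → CInf Ω} (hR : R ∈ basEloc Ω) :
    lieTilde X R ∈ basEloc Ω :=
  ⟨lieTilde_mem_basE X hR.1, fun U hU φ ψ h _ hx => lieDir_congr X hU (hR.2 U hU φ ψ h) hx⟩

theorem IsPointIndep.isPointLocal {R : SK Ω → CInf Ω} (hR : IsPointIndep R) : IsPointLocal R :=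
  fun x hx φ ψ h => hR x hx x hx φ ψ h

theorem IsPointLocal.isLocal {R : SK Ω → CInf Ω} (hR : IsPointLocal R) : IsLocal R :=
  fun _ hU φ ψ h x hx => hR x (hU hx) φ ψ (h x hx)

theorem basEpi_subset_basEploc : basEpi Ω ⊆ basEploc Ω := fun _ hR => ⟨hR.1, hR.2.isPointLocal⟩

theorem basEploc_subset_basEloc : basEploc Ω ⊆ basEloc Ω := fun _ hR => ⟨hR.1, hR.2.isLocal⟩

theorem basL_subset_basE : basL Ω ⊆ basE Ω := by
  rintro _ ⟨T, rfl⟩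
  exact ConvSmooth.clm (T.restrictScalars ℝ)

theorem lieHat_clm (X : VectorField Ω) (T : SK Ω →L[ℂ] CInf Ω) :
    lieHat X T = ⇑(-(T ∘L lieSKCLM X) + lieDirCLM ℂ X ∘L T) := by
  funext φ
  have h : differential T φ (lieSK X φ) = T (lieSK X φ) :=
    differential_linear (map_add T) (fun c φ => (T.restrictScalars ℝ).map_smul c φ) _ _
  rw [lieHat, h]
  rfl

theorem lieHat_mem_basL (X : VectorField Ω) {R : SK Ω → CInf Ω} (hR : R ∈ basL Ω) :
    lieHat X R ∈ basL Ω := by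
  obtain ⟨T, rfl⟩ := hR
  exact ⟨_, (lieHat_clm X T).symm⟩

theorem lieTilde_mem_basL (X : VectorField Ω) {R : SK Ω → CInf Ω} (hR : R ∈ basL Ω) :
    lieTilde X R ∈ basL Ω := by
  obtain ⟨T, rfl⟩ := hR
  exact ⟨lieDirCLM ℂ X ∘L T, rfl⟩

end Invariance

/-! ## Point-local and point-independent maps -/

section PointLocal

variable {n : ℕ} {Ω : Opens (Eu n)} {S : TestFn Ω → CInf Ω}

/-- Along a curve `γ` in `Ω`, `φ ∘ γ` is a smooth curve of test functions, `S` maps it to a smooth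
curve of functions, and evaluating that along `γ` is smooth. Boman's theorem concludes. -/
theorem isSmoothOn_ploc (hS : ConvSmooth S) (φ : SK Ω) : IsSmoothOn Ω fun x => S (φ x) x :=
  isSmoothOn_of_contDiffOn <| contDiffOn_of_curves Ω.isOpen fun _ hγ hγΩ =>
    isSmoothCurve_iff_contDiff.1 <|
      (hS _ ((IsSmoothCurve.const φ).eval_curve hγ hγΩ)).eval_curve hγ hγΩ

/-- The point-local map `φ⃗ ↦ [x ↦ S(φ⃗(x))(x)]`. -/
noncomputable def plocMap (hS : ConvSmooth S) (φ : SK Ω) : CInf Ω :=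
  SmoothMap.mk' (fun x => S (φ x) x) (isSmoothOn_ploc hS φ)

theorem plocMap_apply (hS : ConvSmooth S) (φ : SK Ω) {x : Eu n} (hx : x ∈ Ω) :
    plocMap hS φ x = S (φ x) x := SmoothMap.mk'_apply hx

theorem plocMap_mem (hS : ConvSmooth S) : plocMap hS ∈ basEploc Ω := by
  refine ⟨fun c hc => ?_, fun x hx φ ψ h => ?_⟩
  · refine isSmoothCurve_of_contDiffOn (g := fun p => S (c p.1 p.2) p.2) ?_ fun t x hx =>
      plocMap_apply hS _ hx
    refine contDiffOn_of_curves (isOpen_univ_prod Ω) fun γ hγ hγU =>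
      isSmoothCurve_iff_contDiff.1 ?_
    have h2 : ContDiff ℝ ∞ fun t => (γ t).2 := contDiff_snd.comp hγ
    have h3 : ∀ t, (γ t).2 ∈ Ω := fun t => (hγU t).2
    exact (hS _ ((hc.comp (contDiff_fst.comp hγ)).eval_curve h2 h3)).eval_curve h2 h3
  · rw [plocMap_apply hS _ hx, plocMap_apply hS _ hx, h]

/-- `S` is the restriction of `R` to constant kernels; point-locality says that these determine `R`.
-/
theorem isCorrespondence_ploc :
    IsCorrespondence (basEploc Ω) {S : TestFn Ω → CInf Ω | ConvSmooth S}
      (fun R S => ∀ φ, ∀ x ∈ Ω, R φ x = S (φ x) x) := by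
  refine ⟨fun R hR => ⟨fun v => R (SmoothMap.const Ω v),
      ⟨ConvSmooth.clm_comp hR.1 (SmoothMap.constCLM ℝ), fun φ x hx =>
        hR.2 x hx _ _ (SmoothMap.const_apply _ hx).symm⟩, fun S hS => ?_⟩,
    fun S hS => ⟨plocMap hS, ⟨plocMap_mem hS, fun φ x hx => plocMap_apply hS φ hx⟩, fun R hR => ?_⟩⟩
  · funext v
    refine SmoothMap.ext_on fun x hx => ?_
    rw [hS.2 _ x hx, SmoothMap.const_apply _ hx]
  · funext φ
    refine SmoothMap.ext_on fun x hx => ?_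
    rw [hR.2 φ x hx, plocMap_apply hS _ hx]

theorem hasCurveDeriv_pd {F : Type*} [AddCommGroup F] [Module ℝ F] [TopologicalSpace F]
    [IsTopologicalAddGroup F] [ContinuousSMul ℝ F] (f : SmoothMap Ω F) {γ : ℝ → Eu n} {i : Fin n}
    (hx : γ 0 ∈ Ω) (hγ : HasDerivAt γ (EuclideanSpace.single i (1 : ℝ)) 0) :
    HasCurveDeriv (fun t => f (γ t)) (SmoothMap.pd i f (γ 0)) 0 := by
  have h1 := f.hasPartialsAt_pd hx
  have h2 := HasPartialsAt.comp_curve h1 hγ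
  simpa using h2

/-- A straight line may leave `Ω`; compressing the parameter keeps the curve inside for all times
without changing it near `0`. -/
theorem exists_curve_mem {x : Eu n} (hx : x ∈ Ω) (v : Eu n) : ∃ γ : ℝ → Eu n,
    ContDiff ℝ ∞ γ ∧ (∀ t, γ t ∈ Ω) ∧ γ 0 = x ∧ HasDerivAt γ v 0 := by
  obtain ⟨δ, hδ, hball⟩ := Metric.isOpen_iff.1 Ω.isOpen x hx
  have hv : 0 < ‖v‖ + 1 := by positivity
  obtain ⟨ρ, hρ, hρδ, hρid⟩ := exists_contDiff_eq_id (div_pos hδ hv)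
  have h0 : ρ 0 = 0 := hρid.self_of_nhds
  refine ⟨fun t => x + ρ t • v, contDiff_const.add (hρ.smul contDiff_const), fun t => hball ?_,
    by simp [h0], ?_⟩
  · rw [mem_ball_iff_norm, add_sub_cancel_left, norm_smul, Real.norm_eq_abs]
    calc |ρ t| * ‖v‖ ≤ |ρ t| * (‖v‖ + 1) := by gcongr; linarith
      _ < δ / (‖v‖ + 1) * (‖v‖ + 1) := by gcongr; exact hρδ t
      _ = δ := div_mul_cancel₀ _ hv.ne'
  · have h1 : HasDerivAt ρ 1 0 := (hasDerivAt_id (0 : ℝ)).congr_of_eventuallyEq hρid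
    simpa using (h1.smul_const v).const_add x

/-- The point moves in two places. Separating them gives a function of two parameters, smooth by
Boman's theorem, whose derivative along the diagonal is the sum of a chain rule term and an ordinary
partial derivative. -/
theorem pd_ploc (hS : ConvSmooth S) {φ : SK Ω} {f : CInf Ω} (hf : ∀ x ∈ Ω, f x = S (φ x) x)
    (i : Fin n) {x : Eu n} (hx : x ∈ Ω) : SmoothMap.pd i f x =
      differential (fun v => S v x) (φ x) (SmoothMap.pd i φ x) + SmoothMap.pd i (S (φ x)) x := by
  obtain ⟨γ, hγ, hγΩ, rfl, hγ'⟩ := exists_curve_mem hx (EuclideanSpace.single i (1 : ℝ))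
  have hφ : IsSmoothCurve fun t => φ (γ t) := (IsSmoothCurve.const φ).eval_curve hγ hγΩ
  have hg : ContDiff ℝ ∞ fun p : ℝ × ℝ => S (φ (γ p.1)) (γ p.2) :=
    contDiff_of_curveSmooth fun η hη => isSmoothCurve_iff_contDiff.1 <|
      (hS _ (hφ.comp (contDiff_fst.comp hη))).eval_curve
        (hγ.comp (contDiff_snd.comp hη)) fun t => hγΩ _
  have h1 : ConvSmooth fun v => S v (γ 0) := hS.comp_clm (SmoothMap.evalCLM ℝ (γ 0))
  have h2 := h1.chain_rule hφ (hasCurveDeriv_pd φ hx hγ')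
  have h3 := hasCurveDeriv_iff_hasDerivAt.1 (hasCurveDeriv_pd (S (φ (γ 0))) hx hγ')
  have h4 := hasDerivAt_diag ((hg.differentiable (by simp)) _) h2 h3
  have h5 := hasCurveDeriv_iff_hasDerivAt.1 (hasCurveDeriv_pd f hx hγ')
  refine h5.unique (h4.congr_of_eventuallyEq (.of_forall fun t => hf _ (hγΩ t)))

theorem differential_eval (hS : ConvSmooth S) (φ v : TestFn Ω) (x : Eu n) :
    differential (fun w => S w x) φ v = differential S φ v x :=
  hS.differential_comp_clm (SmoothMap.evalCLM ℝ x) φ v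

/-- The terms `Xⁱ dS(φ(x))(∂ᵢφ(x))` occur with a minus sign from the directional part of `lieSK` and
with a plus sign from `pd_ploc`. They cancel, and only the part with `lieForm` and the derivative of
`S (φ x)` at the fixed test function remain. -/
theorem lieHat_ploc (X : VectorField Ω) {R : SK Ω → CInf Ω} (hR : R ∈ basE Ω) (hS : ConvSmooth S)
    (h : ∀ φ, ∀ x ∈ Ω, R φ x = S (φ x) x) (φ : SK Ω) {x : Eu n} (hx : x ∈ Ω) :
    lieHat X R φ x = lieHatPloc X S (φ x) x := by
  have hs : ConvSmooth fun v => S v x := hS.comp_clm (SmoothMap.evalCLM ℝ x)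
  have h1 : differential R φ (lieSK X φ) x =
      differential (fun v => S v x) (φ x) (lieSK X φ x) := by
    refine (hasCurveDeriv_differential_apply hR φ (lieSK X φ) x).unique ?_
    refine (hs.hasCurveDeriv (φ x) (lieSK X φ x)).congr (.of_forall fun t => ?_)
    beta_reduce
    rw [h _ x hx]
    rfl
  have h2 : lieDir X (R φ) x = ∑ i, X x i • differential (fun v => S v x) (φ x)
      (SmoothMap.pd i φ x) + lieDir X (S (φ x)) x := by
    rw [lieDir_apply, lieDir_apply, ← Finset.sum_add_distrib]
    exact Finset.sum_congr rfl fun i _ => by rw [pd_ploc hS (h φ) i hx, smul_add]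
  have h3 : lieHatPloc X S (φ x) x =
      -differential S (φ x) (lieForm X (φ x)) x + lieDir X (S (φ x)) x := rfl
  rw [lieHat_apply, h1, h2, h3, lieSK_apply, hs.differential_add, hs.differential_sum,
    ← differential_eval hS]
  simp only [hs.differential_smul]
  abel

theorem lieHatPloc_convSmooth (X : VectorField Ω) (hS : ConvSmooth S) :
    ConvSmooth (lieHatPloc X S) :=
  ConvSmooth.neg_add (fun _ hc => hS.differential_curve hc
    (hc.clm ((lieForm X).restrictScalars ℝ))) (hS.comp_clm (lieDirCLM ℝ X))

theorem lieHat_mem_basEploc (X : VectorField Ω) {R : SK Ω → CInf Ω} (hR : R ∈ basEploc Ω) :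
    lieHat X R ∈ basEploc Ω := by
  obtain ⟨S, ⟨hS, hRS⟩, -⟩ := isCorrespondence_ploc.1 R hR
  refine ⟨lieHat_mem_basE X hR.1, fun x hx φ ψ h => ?_⟩
  rw [lieHat_ploc X hR.1 hS hRS φ hx, lieHat_ploc X hR.1 hS hRS ψ hx, h]

theorem correspondenceCommutes_ploc (X : VectorField Ω) :
    CorrespondenceCommutes (basEploc Ω) {S : TestFn Ω → CInf Ω | ConvSmooth S}
      (fun R S => ∀ φ, ∀ x ∈ Ω, R φ x = S (φ x) x) (lieHat X) (lieHatPloc X) :=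
  ⟨isCorrespondence_ploc, fun _ hR => lieHat_mem_basEploc X hR,
    fun _ hS => lieHatPloc_convSmooth X hS,
    fun _ hR _ hS h φ _ hx => lieHat_ploc X hR.1 hS h φ hx⟩

/-- Scalar maps are treated as point-local maps with constant values, which reduces smoothness to
`plocMap`. The point `x₀` reads off the scalar. -/
theorem isCorrespondence_pi (hΩ : (Ω : Set (Eu n)).Nonempty) :
    IsCorrespondence (basEpi Ω) {S : TestFn Ω → ℂ | ConvSmooth S}
      (fun R S => ∀ φ, ∀ x ∈ Ω, R φ x = S (φ x)) := by
  obtain ⟨x₀, hx₀⟩ := hΩ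
  refine ⟨fun R hR => ⟨fun v => R (SmoothMap.const Ω v) x₀, ⟨?_, fun φ x hx =>
      hR.2 x hx x₀ hx₀ _ _ (SmoothMap.const_apply _ hx₀).symm⟩, fun S hS => ?_⟩, fun S hS => ?_⟩
  · exact ConvSmooth.comp_clm (ConvSmooth.clm_comp hR.1 (SmoothMap.constCLM ℝ))
      (SmoothMap.evalCLM ℝ x₀)
  · funext v
    rw [hS.2 _ x₀ hx₀, SmoothMap.const_apply _ hx₀]
  · have hS' : ConvSmooth fun v => SmoothMap.const Ω (S v) :=
      ConvSmooth.comp_clm hS (SmoothMap.constCLM ℝ)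
    have h : ∀ φ, ∀ x ∈ Ω, plocMap hS' φ x = S (φ x) := fun φ x hx => by
      rw [plocMap_apply hS' φ hx, SmoothMap.const_apply _ hx]
    refine ⟨plocMap hS', ⟨⟨(plocMap_mem hS').1, fun x hx y hy φ ψ e => ?_⟩, h⟩, fun R hR => ?_⟩
    · rw [h φ x hx, h ψ y hy, e]
    · funext φ
      exact SmoothMap.ext_on fun x hx => by rw [hR.2 φ x hx, h φ x hx]

theorem lieHatPloc_const (X : VectorField Ω) {S : TestFn Ω → ℂ} (hS : ConvSmooth S)
    (φ : TestFn Ω) {x : Eu n} (hx : x ∈ Ω) :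
    lieHatPloc X (fun v => SmoothMap.const Ω (S v)) φ x = lieHatPi X S φ := by
  have h : differential (fun v => SmoothMap.const Ω (S v)) φ (lieForm X φ) =
      SmoothMap.const Ω (differential S φ (lieForm X φ)) :=
    hS.differential_comp_clm (SmoothMap.constCLM ℝ) φ _
  rw [lieHatPloc, lieHatPi, h, lieDir_const, add_zero, SmoothMap.neg_apply,
    SmoothMap.const_apply _ hx]

theorem lieHat_pi (X : VectorField Ω) {R : SK Ω → CInf Ω} {S : TestFn Ω → ℂ} (hR : R ∈ basE Ω)
    (hS : ConvSmooth S) (h : ∀ φ, ∀ x ∈ Ω, R φ x = S (φ x)) (φ : SK Ω) {x : Eu n} (hx : x ∈ Ω) :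
    lieHat X R φ x = lieHatPi X S (φ x) := by
  have hS' : ConvSmooth fun v => SmoothMap.const Ω (S v) :=
    ConvSmooth.comp_clm hS (SmoothMap.constCLM ℝ)
  rw [← lieHatPloc_const X hS _ hx]
  exact lieHat_ploc X hR hS' (fun φ x hx => by rw [h φ x hx, SmoothMap.const_apply _ hx]) φ hx

theorem lieHat_mem_basEpi (hΩ : (Ω : Set (Eu n)).Nonempty) (X : VectorField Ω)
    {R : SK Ω → CInf Ω} (hR : R ∈ basEpi Ω) : lieHat X R ∈ basEpi Ω := by
  obtain ⟨S, ⟨hS, hRS⟩, -⟩ := (isCorrespondence_pi hΩ).1 R hR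
  refine ⟨lieHat_mem_basE X hR.1, fun x hx y hy φ ψ h => ?_⟩
  rw [lieHat_pi X hR.1 hS hRS φ hx, lieHat_pi X hR.1 hS hRS ψ hy, h]

theorem correspondenceCommutes_pi (hΩ : (Ω : Set (Eu n)).Nonempty) (X : VectorField Ω) :
    CorrespondenceCommutes (basEpi Ω) {S : TestFn Ω → ℂ | ConvSmooth S}
      (fun R S => ∀ φ, ∀ x ∈ Ω, R φ x = S (φ x)) (lieHat X) (lieHatPi X) := by
  refine ⟨isCorrespondence_pi hΩ, fun _ hR => lieHat_mem_basEpi hΩ X hR, fun S hS => ?_,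
    fun _ hR _ hS h φ _ hx => lieHat_pi X hR.1 hS h φ hx⟩
  obtain ⟨x₀, hx₀⟩ := hΩ
  have h := lieHatPloc_convSmooth X (ConvSmooth.comp_clm hS (SmoothMap.constCLM (Ω := Ω) ℝ))
  have h' := h.comp_clm (SmoothMap.evalCLM ℝ x₀)
  have e : lieHatPi X S = fun φ => SmoothMap.evalCLM ℝ x₀
      (lieHatPloc X (fun v => SmoothMap.constCLM (Ω := Ω) ℝ (S v)) φ) :=
    funext fun φ => (lieHatPloc_const X hS φ hx₀).symm
  change ConvSmooth _
  rw [e]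
  exact h'

end PointLocal

/-! ## The strong topology on distributions -/

section Strong

variable {n : ℕ} {Ω : Opens (Eu n)}

open Bornology in
theorem tendsto_distr_zero_iff {α : Type*} {l : Filter α} {f : α → Distr Ω} :
    Tendsto f l (𝓝 0) ↔ ∀ B : Set (TestFn Ω), IsVonNBounded ℂ B → ∀ ε > 0,
      ∀ᶠ a in l, ∀ v ∈ B, ‖f a v‖ < ε := by
  rw [(ContinuousLinearMap.hasBasis_nhds_zero_of_basis (σ := RingHom.id ℂ) (E := TestFn Ω)
    (Metric.nhds_basis_ball (x := (0 : ℂ)))).tendsto_right_iff]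
  simp only [Prod.forall, and_imp, Set.mem_ofPred_eq, mem_ball_zero_iff]
  exact ⟨fun h B hB ε hε => h B ε hB hε, fun h B ε hB hε => h B hB ε hε⟩

theorem continuous_distr_apply (v : TestFn Ω) : Continuous fun u : Distr Ω => u v :=
  continuous_eval_const v

/-- A convergent sequence of test functions is bounded, and strong convergence is uniform on bounded
sets. Countable generation of the filter reduces the claim to sequences. -/
theorem tendsto_distr_apply_zero {α : Type*} {l : Filter α} [l.IsCountablyGenerated]
    {u : α → Distr Ω} {v : α → TestFn Ω} {v₀ : TestFn Ω} (hu : Tendsto u l (𝓝 0))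
    (hv : Tendsto v l (𝓝 v₀)) : Tendsto (fun a => u a (v a)) l (𝓝 0) := by
  refine tendsto_of_seq_tendsto fun s hs => ?_
  have hB : Bornology.IsVonNBounded ℂ (Set.range (v ∘ s)) :=
    (hv.comp hs).isVonNBounded_range ℂ
  rw [Metric.tendsto_nhds]
  intro ε hε
  filter_upwards [tendsto_distr_zero_iff.1 (hu.comp hs) _ hB ε hε] with k hk
  rw [dist_zero_right]
  exact hk _ ⟨k, rfl⟩

/-! ### Joint continuity of the evaluation of a distribution-valued kernel. -/

section Joint

variable {Y : Type*} [TopologicalSpace Y] {S : Y → Distr Ω}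

/-- The linear map `v ↦ [y ↦ ⟨S(y), v⟩]`. -/
noncomputable def kernelMap (hS : Continuous S) : TestFn Ω →ₗ[ℂ] C(Y, ℂ) where
  toFun v := ⟨fun y => S y v, (continuous_distr_apply v).comp hS⟩
  map_add' v w := by ext y; exact map_add (S y) v w
  map_smul' c v := by ext y; exact map_smul (S y) c v

/-- For compact `K` the image `S '' K` is compact, hence bounded in the strong dual, hence uniformly
bounded on `B`. Boundedness is then tested with the scalars `(k + 1)⁻¹`. -/
theorem kernelMap_bounded (hS : Continuous S) {B : Set (TestFn Ω)}
    (hB : Bornology.IsVonNBounded ℂ B) : Bornology.IsVonNBounded ℂ (kernelMap hS '' B) := by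
  refine Bornology.isVonNBounded_of_smul_tendsto_zero (ι := ℕ) (l := atTop) (𝕜 := ℂ)
    (ε := fun k : ℕ => ((((k : ℝ) + 1)⁻¹ : ℝ) : ℂ)) (.of_forall fun k => ?_) fun w hw => ?_
  · rw [Complex.ofReal_ne_zero]
    positivity
  choose v hv hvw using hw
  refine (SmoothMap.tendsto_continuousMap_iff (F := ℂ) (X := Y) (u := atTop) (g := 0)).2 ?_
  intro K hK N hN
  obtain ⟨ε, hε, hεN⟩ := Metric.mem_nhds_iff.1 hN
  have h1 : ∀ᶠ u in 𝓝 (0 : Distr Ω), ∀ v ∈ B, ‖u v‖ < 1 :=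
    tendsto_distr_zero_iff.1 tendsto_id B hB 1 one_pos
  have h2 : Bornology.IsVonNBounded ℂ (S '' K) := (hK.image hS).isVonNBounded ℂ
  obtain ⟨r, hr, hr'⟩ := (h2 h1).exists_pos
  have h3 := hr' (r : ℂ) (by simp [abs_of_pos hr])
  have h4 : ∀ y ∈ K, ∀ v ∈ B, ‖S y v‖ ≤ r := by
    intro y hy v hv
    obtain ⟨u, hu, huy⟩ := h3 ⟨y, hy, rfl⟩
    beta_reduce at huy
    rw [← huy, _root_.smul_apply, norm_smul, Complex.norm_real, Real.norm_eq_abs,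
      abs_of_pos hr]
    exact mul_le_of_le_one_right hr.le (hu v hv).le
  obtain ⟨m, hm⟩ := exists_nat_gt (r / ε)
  filter_upwards [eventually_ge_atTop m] with k hk y hy
  refine hεN ?_
  rw [mem_ball_zero_iff]
  have h5 : ((fun k : ℕ => ((((k : ℝ) + 1)⁻¹ : ℝ) : ℂ)) • w) k y - (0 : C(Y, ℂ)) y =
      ((((k : ℝ) + 1)⁻¹ : ℝ) : ℂ) * S y (v k) := by
    simp only [Pi.smul_apply', ← hvw, ContinuousMap.smul_apply, ContinuousMap.zero_apply, sub_zero,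
      smul_eq_mul]
    rfl
  rw [h5, norm_mul, Complex.norm_real, Real.norm_eq_abs, abs_of_pos (by positivity)]
  have h6 : r / ε < k + 1 := hm.trans_le (by have : (m : ℝ) ≤ k := by exact_mod_cast hk
                                             linarith)
  calc ((k : ℝ) + 1)⁻¹ * ‖S y (v k)‖ ≤ ((k : ℝ) + 1)⁻¹ * r := by
        gcongr
        exact h4 y hy _ (hv k)
    _ < ε := by
        rw [inv_mul_lt_iff₀ (by positivity), mul_comm]
        exact (div_lt_iff₀' hε).1 h6 |>.trans_eq (by ring)

instance {K : Compacts (Eu n)} : FirstCountableTopology 𝓓^{⊤}_{K}(Eu n, ℂ) :=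
  (ContDiffMapSupportedIn.withSeminorms ℝ (Eu n) ℂ ⊤ K).firstCountableTopology

/-- Continuity on `𝓓(Ω)` is tested on the subspaces of functions supported in a fixed compact set.
These are first countable, so there bounded linear maps are continuous. -/
theorem continuous_kernelMap (hS : Continuous S) : Continuous (kernelMap hS) := by
  rw [TestFunction.continuous_iff_continuous_comp]
  intro K hK
  refine LinearMap.continuous_of_locally_bounded
    (kernelMap hS ∘ₗ (TestFunction.ofSupportedInCLM ℂ hK).toLinearMap) fun s hs => ?_
  have h := kernelMap_bounded hS (hs.image (TestFunction.ofSupportedInCLM ℂ hK))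
  rwa [Set.image_image] at h

theorem continuous_kernel_apply [LocallyCompactSpace Y] (hS : Continuous S) :
    Continuous fun p : Y × TestFn Ω => S p.1 p.2 := by
  have h : Continuous fun p : Y × TestFn Ω => kernelMap hS p.2 p.1 :=
    ((continuous_kernelMap hS).comp continuous_snd).eval continuous_fst
  exact h

end Joint

/-- The product rule for the pairing of distributions and test functions. -/
theorem HasPartialsAt.pairing {S : Eu n → Distr Ω} {p : Fin n → Distr Ω} {φ : Eu n → TestFn Ω}
    {q : Fin n → TestFn Ω} {x : Eu n} (hS : HasPartialsAt S p x) (hφ : HasPartialsAt φ q x) :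
    HasPartialsAt (fun y => S y (φ y)) (fun i => p i (φ x) + S x (q i)) x := by
  -- The increment splits into the remainder of `S` paired with `φ (x + h)`, `S x` paired with the
  -- remainder of `φ`, and mixed terms `p i (φ (x + h) - φ x)` with coefficients `‖h‖⁻¹ * h i` of
  -- modulus at most one.
  have h1 : Tendsto (fun h => φ (x + h)) (𝓝[≠] 0) (𝓝 (φ x)) := by
    simpa using hφ.tendsto_sub.add_const (φ x)
  have t1 := tendsto_distr_apply_zero hS h1
  have t2 : Tendsto (fun h : Eu n => S x (‖h‖⁻¹ • (φ (x + h) - φ x - ∑ i, h i • q i))) (𝓝[≠] 0)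
      (𝓝 0) := by
    have := ((S x).continuous.tendsto 0).comp hφ
    rwa [map_zero] at this
  have t3 : ∀ i : Fin n, Tendsto (fun h : Eu n => (‖h‖⁻¹ * h i) • p i (φ (x + h) - φ x))
      (𝓝[≠] 0) (𝓝 0) := by
    intro i
    have h2 : Tendsto (fun h => p i (φ (x + h) - φ x)) (𝓝[≠] 0) (𝓝 0) := by
      have := ((p i).continuous.tendsto 0).comp hφ.tendsto_sub
      rwa [map_zero] at this
    refine squeeze_zero_norm (fun h => ?_) (tendsto_zero_iff_norm_tendsto_zero.1 h2)
    rw [norm_smul]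
    refine mul_le_of_le_one_left (norm_nonneg _) ?_
    rw [norm_mul, norm_inv, norm_norm]
    exact inv_mul_le_one_of_le₀ (PiLp.norm_apply_le h i) (norm_nonneg _)
  have t4 := (t1.add t2).add (tendsto_finsetSum Finset.univ fun i _ => t3 i)
  simp only [Finset.sum_const_zero, add_zero] at t4
  refine t4.congr fun h => ?_
  have hr : ∀ (u : Distr Ω) (r : ℝ) (v : TestFn Ω), u (r • v) = r • u v := fun u r v =>
    (u.restrictScalars ℝ).map_smul r v
  have hd : ∀ (u : Distr Ω) (r : ℝ) (v : TestFn Ω), (r • u) v = r • u v := fun _ _ _ => rfl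
  simp only [hr, hd, map_sub, map_sum, _root_.sub_apply, _root_.sum_apply,
    mul_smul, ← Finset.smul_sum, smul_sub, smul_add, Finset.sum_add_distrib,
    Finset.sum_sub_distrib]
  abel

end Strong

/-! ## Kernels -/

section Kernels

variable {n : ℕ} {Ω : Opens (Eu n)}

theorem SmoothMap.hasPartialsAt_iteratedPd {F : Type*} [AddCommGroup F] [Module ℝ F]
    [TopologicalSpace F] (f : SmoothMap Ω F) (l : List (Fin n)) {x : Eu n} (hx : x ∈ Ω) :
    HasPartialsAt (SmoothMap.iteratedPd l f) (fun i => SmoothMap.iteratedPd (i :: l) f x) x :=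
  (SmoothMap.iteratedPd l f).hasPartialsAt_pd hx

/-- The derivatives of `x ↦ ⟨S(x), φ⃗(x)⟩` according to the Leibniz rule. -/
noncomputable def leibnizPairing (S : SmoothMap Ω (Distr Ω)) (φ : SK Ω) (l : List (Fin n))
    (y : Eu n) : ℂ :=
  ((leibnizList l).map fun a =>
    SmoothMap.iteratedPd a.1 S y (SmoothMap.iteratedPd a.2 φ y)).sum

theorem leibnizPairing_nil (S : SmoothMap Ω (Distr Ω)) (φ : SK Ω) (y : Eu n) :
    leibnizPairing S φ [] y = S y (φ y) := by
  simp [leibnizPairing, leibnizList, SmoothMap.iteratedPd_nil]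

theorem hasPartialsAt_leibniz (S : SmoothMap Ω (Distr Ω)) (φ : SK Ω) (l : List (Fin n)) {x : Eu n}
    (hx : x ∈ Ω) :
    HasPartialsAt (leibnizPairing S φ l) (fun i => leibnizPairing S φ (i :: l) x) x := by
  have h := HasPartialsAt.list_sum (leibnizList l) fun a _ =>
    (S.hasPartialsAt_iteratedPd a.1 hx).pairing (φ.hasPartialsAt_iteratedPd a.2 hx)
  have e : ∀ i, leibnizPairing S φ (i :: l) x = ((leibnizList l).map fun a =>
      SmoothMap.iteratedPd (i :: a.1) S x (SmoothMap.iteratedPd a.2 φ x) +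
        SmoothMap.iteratedPd a.1 S x (SmoothMap.iteratedPd (i :: a.2) φ x)).sum := fun i => by
    rw [leibnizPairing, leibnizList, List.map_append, List.sum_append, List.map_map, List.map_map,
      List.sum_map_add]
    rfl
  simp only [e]
  exact h

theorem isSmoothOn_kernelPairing (S : SmoothMap Ω (Distr Ω)) (φ : SK Ω) :
    IsSmoothOn Ω fun x => S x (φ x) :=
  ⟨leibnizPairing S φ, funext fun y => leibnizPairing_nil S φ y,
    fun l _ hx => hasPartialsAt_leibniz S φ l hx⟩

/-- The smooth function `x ↦ ⟨S(x), φ⃗(x)⟩`. -/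
noncomputable def kernelPairing (S : SmoothMap Ω (Distr Ω)) (φ : SK Ω) : CInf Ω :=
  SmoothMap.mk' (fun x => S x (φ x)) (isSmoothOn_kernelPairing S φ)

theorem kernelPairing_apply (S : SmoothMap Ω (Distr Ω)) (φ : SK Ω) {x : Eu n} (hx : x ∈ Ω) :
    kernelPairing S φ x = S x (φ x) := SmoothMap.mk'_apply hx

theorem iteratedPd_kernelPairing (S : SmoothMap Ω (Distr Ω)) (φ : SK Ω) (l : List (Fin n))
    {x : Eu n} (hx : x ∈ Ω) :
    SmoothMap.iteratedPd l (kernelPairing S φ) x = leibnizPairing S φ l x := by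
  refine SmoothMap.iteratedPd_apply_eq (D := leibnizPairing S φ) (fun y hy => ?_)
    (fun l y hy => hasPartialsAt_leibniz S φ l hy) l x hx
  rw [kernelPairing_apply S φ hy, leibnizPairing_nil]

/-- The point-local operator with kernel `S`. -/
noncomputable def kernelCLM (S : SmoothMap Ω (Distr Ω)) : SK Ω →L[ℂ] CInf Ω where
  toFun := kernelPairing S
  map_add' φ ψ := SmoothMap.ext_on fun x hx => by
    rw [SmoothMap.add_apply, kernelPairing_apply S _ hx, kernelPairing_apply S _ hx,
      kernelPairing_apply S _ hx, SmoothMap.add_apply, map_add]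
  map_smul' c φ := SmoothMap.ext_on fun x hx => by
    rw [RingHom.id_apply, SmoothMap.const_smul_apply, kernelPairing_apply S _ hx,
      kernelPairing_apply S _ hx, SmoothMap.const_smul_apply, map_smul]
  cont := by
    have : LocallyCompactSpace Ω := Ω.isOpen.locallyCompactSpace
    refine SmoothMap.continuous_of_uncurry fun l => ?_
    have h : Continuous fun p : SK Ω × Ω => leibnizPairing S p.1 l p.2 := by
      refine continuous_list_sum _ fun a _ => ?_
      have h1 := continuous_kernel_apply (SmoothMap.iteratedPd a.1 S).toContinuousMap.continuous
      exact h1.comp (continuous_snd.prodMk (SmoothMap.continuous_iteratedPd_apply a.2))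
    refine h.congr fun p => ?_
    exact (iteratedPd_kernelPairing S p.1 l p.2.2).symm

theorem kernelCLM_apply (S : SmoothMap Ω (Distr Ω)) (φ : SK Ω) {x : Eu n} (hx : x ∈ Ω) :
    kernelCLM S φ x = S x (φ x) := kernelPairing_apply S φ hx

end Kernels

/-! ## Bounded sets of smooth functions -/

section BoundedSets

variable {n : ℕ} {Ω : Opens (Eu n)}

theorem exists_bound_iteratedPd {A : Set (CInf Ω)} (hA : Bornology.IsVonNBounded ℂ A)
    {K : Set (Eu n)} (hK : IsCompact K) (hKΩ : K ⊆ Ω) (l : List (Fin n)) :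
    ∃ M : ℝ, 0 ≤ M ∧ ∀ f ∈ A, ∀ y ∈ K, ‖SmoothMap.iteratedPd l f y‖ ≤ M := by
  have hK' : IsCompact ((↑) ⁻¹' K : Set Ω) :=
    Topology.IsInducing.subtypeVal.isCompact_preimage_iff (by simpa using hKΩ) |>.2 hK
  have h0 : SmoothMap.iteratedPd l (0 : CInf Ω) = 0 := by
    have := (SmoothMap.derivMap ℂ l : CInf Ω →ₗ[ℂ] C(Ω, ℂ)).map_zero
    refine SmoothMap.ext_on fun x hx => ?_
    exact DFunLike.congr_fun this (⟨x, hx⟩ : Ω)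
  have h1 : ∀ᶠ f in 𝓝 (0 : CInf Ω), ∀ x ∈ ((↑) ⁻¹' K : Set Ω),
      (SmoothMap.iteratedPd l f).toContinuousMap x -
        (SmoothMap.iteratedPd l (0 : CInf Ω)).toContinuousMap x ∈ Metric.ball (0 : ℂ) 1 :=
    SmoothMap.tendsto_continuousMap_iff.1 (SmoothMap.tendsto_iff.1 tendsto_id l) _ hK' _
      (Metric.ball_mem_nhds _ one_pos)
  obtain ⟨r, hr, hr'⟩ := (hA h1).exists_pos
  refine ⟨r, hr.le, fun f hf y hy => ?_⟩
  obtain ⟨g, hg, hgf⟩ := hr' (r : ℂ) (by simp [abs_of_pos hr]) hf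
  beta_reduce at hgf
  have h2 := hg ⟨y, hKΩ hy⟩ hy
  rw [h0, mem_ball_zero_iff] at h2
  have h3 : ‖SmoothMap.iteratedPd l g y‖ < 1 := by
    have e : (0 : CInf Ω).toContinuousMap ⟨y, hKΩ hy⟩ = 0 := rfl
    rw [e, sub_zero] at h2
    exact h2
  have h4 : SmoothMap.iteratedPd l ((r : ℂ) • g) y = (r : ℂ) • SmoothMap.iteratedPd l g y :=
    DFunLike.congr_fun ((SmoothMap.derivMap ℂ l : CInf Ω →ₗ[ℂ] C(Ω, ℂ)).map_smul (r : ℂ) g)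
      (⟨y, hKΩ hy⟩ : Ω)
  rw [← hgf, h4, norm_smul, Complex.norm_real, Real.norm_eq_abs, abs_of_pos hr]
  exact mul_le_of_le_one_right hr.le h3.le

/-- The continuous linear map with prescribed values on the standard basis. -/
noncomputable def ofPartials (p : Fin n → ℂ) : Eu n →L[ℝ] ℂ :=
  ∑ i, (EuclideanSpace.proj i : Eu n →L[ℝ] ℝ).smulRight (p i)

theorem ofPartials_apply (p : Fin n → ℂ) (h : Eu n) : ofPartials p h = ∑ i, h i • p i := by
  simp [ofPartials]

theorem norm_ofPartials_sub_le {p q : Fin n → ℂ} {C : ℝ} (h : ∀ i, ‖p i - q i‖ ≤ C) (hC : 0 ≤ C) :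
    ‖ofPartials p - ofPartials q‖ ≤ n * C := by
  refine ContinuousLinearMap.opNorm_le_bound _ (by positivity) fun v => ?_
  rw [_root_.sub_apply, ofPartials_apply, ofPartials_apply, ← Finset.sum_sub_distrib]
  refine (norm_sum_le _ _).trans ?_
  calc ∑ i, ‖v i • p i - v i • q i‖ ≤ ∑ _i : Fin n, ‖v‖ * C := by
        refine Finset.sum_le_sum fun i _ => ?_
        rw [← smul_sub, norm_smul]
        exact mul_le_mul (PiLp.norm_apply_le v i) (h i) (norm_nonneg _) (norm_nonneg _)
    _ = n * C * ‖v‖ := by simp; ring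

/-- First-order Taylor approximation, uniformly on bounded sets of smooth functions. -/
theorem exists_taylor_bound {A : Set (CInf Ω)} (hA : Bornology.IsVonNBounded ℂ A) {x : Eu n}
    (hx : x ∈ Ω) : ∃ r > 0, ∃ C : ℝ, 0 ≤ C ∧ ∀ f ∈ A, ∀ h : Eu n, ‖h‖ ≤ r →
      ‖f (x + h) - f x - ∑ i, h i • SmoothMap.pd i f x‖ ≤ C * ‖h‖ * ‖h‖ := by
  obtain ⟨r, hr, hball⟩ := Metric.nhds_basis_closedBall.mem_iff.1 (Ω.isOpen.mem_nhds hx)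
  choose M hM0 hM using fun a : Fin n × Fin n => exists_bound_iteratedPd hA
    (isCompact_closedBall x r) hball [a.1, a.2]
  -- `N` bounds all second partial derivatives on the ball for every `f ∈ A`. Two applications of
  -- the mean value inequality, first to `∂ᵢf` and then to `f` minus its linear part, give the
  -- quadratic bound.
  set N : ℝ := ∑ a, M a with hN
  have hN0 : 0 ≤ N := Finset.sum_nonneg fun a _ => hM0 a
  have hMN : ∀ a, M a ≤ N := fun a => Finset.single_le_sum (fun a _ => hM0 a) (Finset.mem_univ a)
  have hfd : ∀ g : CInf Ω, ∀ y ∈ Ω, HasFDerivAt g (ofPartials fun i => SmoothMap.pd i g y) y :=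
    fun g y hy => (g.hasPartialsAt_pd hy).hasFDerivAt
  have h0 : ofPartials (fun _ : Fin n => 0) = 0 := by ext; simp [ofPartials_apply]
  have h1 : ∀ f ∈ A, ∀ i, ∀ y ∈ Metric.closedBall x r,
      ‖SmoothMap.pd i f y - SmoothMap.pd i f x‖ ≤ n * N * ‖y - x‖ := by
    intro f hf i y hy
    refine (convex_closedBall x r).norm_image_sub_le_of_norm_hasFDerivWithin_le
      (f := SmoothMap.pd i f) (fun z hz => (hfd _ z (hball hz)).hasFDerivWithinAt) (fun z hz => ?_)
      (Metric.mem_closedBall_self hr.le) hy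
    have := norm_ofPartials_sub_le (p := fun j => SmoothMap.pd j (SmoothMap.pd i f) z)
      (q := fun _ => 0) (C := N) (fun j => by
        rw [sub_zero]
        exact (hM (j, i) f hf z hz).trans (hMN _)) hN0
    rwa [h0, sub_zero] at this
  refine ⟨r, hr, n * (n * N), by positivity, fun f hf h hh => ?_⟩
  have hsub : Metric.closedBall x ‖h‖ ⊆ Metric.closedBall x r := Metric.closedBall_subset_closedBall hh
  have h2 := (convex_closedBall x ‖h‖).norm_image_sub_le_of_norm_hasFDerivWithin_le
    (f := fun y => f y - ofPartials (fun i => SmoothMap.pd i f x) y)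
    (C := n * (n * N * ‖h‖)) (x := x) (y := x + h)
    (fun z hz => ((hfd f z (hball (hsub hz))).sub
      (ofPartials fun i => SmoothMap.pd i f x).hasFDerivAt).hasFDerivWithinAt)
    (fun z hz => norm_ofPartials_sub_le (fun i => (h1 f hf i z (hsub hz)).trans (by
      gcongr
      exact mem_closedBall_iff_norm.1 hz)) (by positivity))
    (Metric.mem_closedBall_self (norm_nonneg h)) (by simp)
  rw [(ofPartials fun i => SmoothMap.pd i f x).map_add, ofPartials_apply _ h] at h2
  rw [add_sub_cancel_left] at h2
  calc _ = ‖f (x + h) - (ofPartials (fun i => SmoothMap.pd i f x) x +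
        ∑ i, h i • SmoothMap.pd i f x) - (f x - ofPartials (fun i => SmoothMap.pd i f x) x)‖ := by
        congr 1; ring
    _ ≤ _ := h2.trans_eq (by ring)

/-- Iterated partial derivatives as continuous linear maps. -/
noncomputable def iteratedPdCLM : List (Fin n) → CInf Ω →L[ℂ] CInf Ω
  | [] => ContinuousLinearMap.id ℂ _
  | i :: l => SmoothMap.pdCLM ℂ i ∘L iteratedPdCLM l

/-- The derivatives of the kernel of an operator. -/
noncomputable def operatorKernel (T : SK Ω →L[ℂ] CInf Ω) (l : List (Fin n)) (x : Eu n) : Distr Ω :=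
  SmoothMap.evalCLM ℂ x ∘L iteratedPdCLM l ∘L T ∘L SmoothMap.constCLM ℂ

/-- Convergence in the strong topology must be uniform over a bounded set `B` of test functions. The
operator maps the constant kernels with values in `B` to a bounded set of smooth functions, on which
the Taylor remainder is uniform. -/
theorem hasPartialsAt_operatorKernel (T : SK Ω →L[ℂ] CInf Ω) (l : List (Fin n)) {x : Eu n}
    (hx : x ∈ Ω) : HasPartialsAt (operatorKernel T l) (fun i => operatorKernel T (i :: l) x) x := by
  refine tendsto_distr_zero_iff.2 fun B hB ε hε => ?_
  obtain ⟨r, hr, C, hC, h⟩ := exists_taylor_bound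
    (hB.image (iteratedPdCLM l ∘L T ∘L SmoothMap.constCLM ℂ)) hx
  have h1 : ∀ᶠ h in 𝓝[≠] (0 : Eu n), ‖h‖ < min r (ε / (C + 1)) :=
    nhdsWithin_le_nhds (by
      filter_upwards [Metric.ball_mem_nhds (0 : Eu n)
        (lt_min hr (div_pos hε (by positivity : 0 < C + 1)))] with h hh
      exact mem_ball_zero_iff.1 hh)
  filter_upwards [h1, self_mem_nhdsWithin] with k hk hk0 v hv
  have hk0' : 0 < ‖k‖ := norm_pos_iff.2 hk0
  have h2 := h _ ⟨v, hv, rfl⟩ k (hk.le.trans (min_le_left _ _))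
  have h3 : (‖k‖⁻¹ • (operatorKernel T l (x + k) - operatorKernel T l x -
      ∑ i, k i • operatorKernel T (i :: l) x)) v = ‖k‖⁻¹ • (operatorKernel T l (x + k) v -
      operatorKernel T l x v - ∑ i, k i • operatorKernel T (i :: l) x v) := by
    have hd : ∀ (u : Distr Ω) (r : ℝ) (v : TestFn Ω), (r • u) v = r • u v := fun _ _ _ => rfl
    simp only [hd, _root_.sub_apply, _root_.sum_apply]
  rw [h3, norm_smul, norm_inv, norm_norm, inv_mul_lt_iff₀ hk0']
  refine h2.trans_lt ?_
  have h4 : (C + 1) * ‖k‖ < ε := (lt_div_iff₀' (by positivity)).1 (hk.trans_le (min_le_right _ _))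
  nlinarith

theorem isSmoothOn_operatorKernel (T : SK Ω →L[ℂ] CInf Ω) :
    IsSmoothOn Ω (operatorKernel T []) :=
  ⟨operatorKernel T, rfl, fun l _ hx => hasPartialsAt_operatorKernel T l hx⟩

/-- The kernel `x ↦ [v ↦ T(v)(x)]` of an operator. -/
noncomputable def kernelOf (T : SK Ω →L[ℂ] CInf Ω) : SmoothMap Ω (Distr Ω) :=
  SmoothMap.mk' (operatorKernel T []) (isSmoothOn_operatorKernel T)

theorem kernelOf_apply (T : SK Ω →L[ℂ] CInf Ω) {x : Eu n} (hx : x ∈ Ω) (v : TestFn Ω) :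
    kernelOf T x v = T (SmoothMap.const Ω v) x := by
  rw [kernelOf, SmoothMap.mk'_apply hx]
  rfl

end BoundedSets

/-! ## Linear point-local operators -/

section LinearPointLocal

variable {n : ℕ} {Ω : Opens (Eu n)}

theorem isCorrespondence_Lploc :
    IsCorrespondence (basLploc Ω) (Set.univ : Set (SmoothMap Ω (Distr Ω)))
      (fun R S => ∀ φ, ∀ x ∈ Ω, R φ x = S x (φ x)) := by
  refine ⟨?_, fun S _ => ⟨kernelCLM S, ⟨⟨⟨_, rfl⟩, fun x hx φ ψ h => ?_⟩, fun φ x hx =>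
    kernelCLM_apply S φ hx⟩, fun R hR => ?_⟩⟩
  · rintro _ ⟨⟨T, rfl⟩, hT⟩
    refine ⟨kernelOf T, ⟨trivial, fun φ x hx => ?_⟩, fun S hS => ?_⟩
    · rw [kernelOf_apply T hx]
      exact hT x hx _ _ (SmoothMap.const_apply _ hx).symm
    · refine SmoothMap.ext_on fun x hx => ?_
      ext v
      rw [kernelOf_apply T hx, hS.2 _ x hx, SmoothMap.const_apply _ hx]
  · rw [kernelCLM_apply S _ hx, kernelCLM_apply S _ hx, h]
  · funext φ
    exact SmoothMap.ext_on fun x hx => by rw [hR.2 φ x hx, kernelCLM_apply S _ hx]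

theorem lieHat_mem_basLploc (X : VectorField Ω) {R : SK Ω → CInf Ω} (hR : R ∈ basLploc Ω) :
    lieHat X R ∈ basLploc Ω :=
  ⟨lieHat_mem_basL X hR.1, (lieHat_mem_basEploc X ⟨basL_subset_basE hR.1, hR.2⟩).2⟩

theorem lieHat_mem_basLloc (X : VectorField Ω) {R : SK Ω → CInf Ω} (hR : R ∈ basLloc Ω) :
    lieHat X R ∈ basLloc Ω :=
  ⟨lieHat_mem_basL X hR.1, (lieHat_mem_basEloc X ⟨basL_subset_basE hR.1, hR.2⟩).2⟩

theorem lieHat_mem_basLpi (hΩ : (Ω : Set (Eu n)).Nonempty) (X : VectorField Ω)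
    {R : SK Ω → CInf Ω} (hR : R ∈ basLpi Ω) : lieHat X R ∈ basLpi Ω :=
  ⟨lieHat_mem_basL X hR.1, (lieHat_mem_basEpi hΩ X ⟨basL_subset_basE hR.1, hR.2⟩).2⟩

theorem pd_kernel {S : SmoothMap Ω (Distr Ω)} {φ : SK Ω} {f : CInf Ω}
    (hf : ∀ x ∈ Ω, f x = S x (φ x)) (i : Fin n) {x : Eu n} (hx : x ∈ Ω) :
    SmoothMap.pd i f x = SmoothMap.pd i S x (φ x) + S x (SmoothMap.pd i φ x) := by
  have h := (S.hasPartialsAt_pd hx).pairing (φ.hasPartialsAt_pd hx)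
  refine SmoothMap.pd_apply_eq hx (h.congr ?_) i
  filter_upwards [Ω.isOpen.mem_nhds hx] with y hy
  exact (hf y hy).symm

/-- The cancellation is that of the nonlinear case: the terms `Xⁱ ⟨S(x), ∂ᵢφ(x)⟩` from `lieSK` and
from the product rule annihilate each other. -/
theorem lieHat_kernel (X : VectorField Ω) (T : SK Ω →L[ℂ] CInf Ω) {S : SmoothMap Ω (Distr Ω)}
    (h : ∀ φ, ∀ x ∈ Ω, T φ x = S x (φ x)) (φ : SK Ω) {x : Eu n} (hx : x ∈ Ω) :
    lieHat X T φ x = lieHatKer X S x (φ x) := by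
  have h1 : lieHat X T φ x = -S x (lieSK X φ x) + lieDir X (T φ) x := by
    rw [← h _ x hx, lieHat_clm]
    rfl
  have hr : ∀ (u : Distr Ω) (r : ℝ) (v : TestFn Ω), u (r • v) = r • u v := fun u r v =>
    (u.restrictScalars ℝ).map_smul r v
  have h2 : lieHatKer X S x (φ x) = -S x (lieForm X (φ x)) +
      ∑ i, X x i • SmoothMap.pd i S x (φ x) := by
    rw [lieHatKer, SmoothMap.add_apply, SmoothMap.neg_apply, lieDir_apply,
      SmoothMap.postcomp_apply, _root_.add_apply, _root_.sum_apply]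
    rfl
  rw [h1, h2, lieSK_apply, lieDir_apply, map_add, map_sum]
  simp only [pd_kernel (h φ) _ hx, hr, smul_add, Finset.sum_add_distrib]
  abel

theorem correspondenceCommutes_Lploc (X : VectorField Ω) :
    CorrespondenceCommutes (basLploc Ω) (Set.univ : Set (SmoothMap Ω (Distr Ω)))
      (fun R S => ∀ φ, ∀ x ∈ Ω, R φ x = S x (φ x)) (lieHat X) (lieHatKer X) := by
  refine ⟨isCorrespondence_Lploc, fun _ hR => lieHat_mem_basLploc X hR, fun _ _ => trivial, ?_⟩
  rintro _ ⟨⟨T, rfl⟩, -⟩ S - h φ x hx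
  exact lieHat_kernel X T h φ hx

/-- The embedding of a distribution as a continuous linear map. -/
noncomputable def iotaCLM (u : Distr Ω) : SK Ω →L[ℂ] CInf Ω where
  toFun := iota u
  map_add' φ ψ := SmoothMap.ext_on fun x _ => map_add u (φ x) (ψ x)
  map_smul' c φ := SmoothMap.ext_on fun x _ => map_smul u c (φ x)
  cont := SmoothMap.continuous_postcomp _

theorem iota_apply (u : Distr Ω) (φ : SK Ω) (x : Eu n) : iota u φ x = u (φ x) := rfl

/-- Applying `u` pointwise commutes with the directional derivative, so the directional part of
`lieSK` cancels against `lieDir`. -/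
theorem lieHat_iota (X : VectorField Ω) (u : Distr Ω) :
    lieHat X (iota u) = iota (lieHatDistr X u) := by
  funext φ
  refine SmoothMap.ext_on fun x _ => ?_
  have h1 : lieHat X (iota u) φ x = -u (lieSK X φ x) + lieDir X (iota u φ) x := by
    change lieHat X (iotaCLM u) φ x = _
    rw [lieHat_clm]
    rfl
  have h2 : lieDir X (iota u φ) x = u (lieDir X φ x) := by
    rw [iota, pairing, lieDir_postcomp]
    rfl
  have h3 : iota (lieHatDistr X u) φ x = -u (lieForm X (φ x)) := rfl
  rw [h1, h2, h3, lieSK, SmoothMap.add_apply, SmoothMap.postcomp_apply, map_add]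
  simp

theorem isCorrespondence_Lpi (hΩ : (Ω : Set (Eu n)).Nonempty) :
    IsCorrespondence (basLpi Ω) (Set.univ : Set (Distr Ω))
      (fun R u => ∀ φ, ∀ x ∈ Ω, R φ x = u (φ x)) := by
  obtain ⟨x₀, hx₀⟩ := hΩ
  refine ⟨?_, fun u _ => ⟨iota u, ⟨⟨⟨iotaCLM u, rfl⟩, fun x hx y hy φ ψ h => ?_⟩, fun φ x hx => rfl⟩,
    fun R hR => ?_⟩⟩
  · rintro _ ⟨⟨T, rfl⟩, hT⟩
    refine ⟨SmoothMap.evalCLM ℂ x₀ ∘L T ∘L SmoothMap.constCLM ℂ, ⟨trivial, fun φ x hx => ?_⟩,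
      fun u hu => ?_⟩
    · exact hT x hx x₀ hx₀ _ _ (SmoothMap.const_apply _ hx₀).symm
    · ext v
      have := hu.2 (SmoothMap.const Ω v) x₀ hx₀
      rw [SmoothMap.const_apply _ hx₀] at this
      exact this.symm
  · rw [iota_apply, iota_apply, h]
  · funext φ
    exact SmoothMap.ext_on fun x hx => hR.2 φ x hx

theorem correspondenceCommutes_Lpi (hΩ : (Ω : Set (Eu n)).Nonempty) (X : VectorField Ω) :
    CorrespondenceCommutes (basLpi Ω) (Set.univ : Set (Distr Ω))
      (fun R u => ∀ φ, ∀ x ∈ Ω, R φ x = u (φ x)) (lieHat X) (lieHatDistr X) := by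
  refine ⟨isCorrespondence_Lpi hΩ, fun _ hR => lieHat_mem_basLpi hΩ X hR, fun _ _ => trivial, ?_⟩
  intro R _ u _ h φ x hx
  obtain rfl : R = iota u := funext fun φ => SmoothMap.ext_on fun x hx => h φ x hx
  rw [lieHat_iota]
  rfl

end LinearPointLocal

/-! ## Point evaluation of test functions and symmetry of derivatives -/

section Symmetry

variable {n : ℕ} {Ω : Opens (Eu n)}

/-- The Dirac distribution at `y`. -/
noncomputable def dirac (y : Eu n) : Distr Ω where
  toFun φ := φ y
  map_add' _ _ := rfl
  map_smul' _ _ := rfl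
  cont := continuous_eval_const y

theorem pd_eqOn_dirDeriv (f : CInf Ω) (i : Fin n) :
    Set.EqOn (SmoothMap.pd i f) (dirDeriv (EuclideanSpace.single i (1 : ℝ)) f) Ω := fun x hx => by
  rw [dirDeriv, (f.hasPartialsAt_pd hx).hasFDerivAt.fderiv]
  simp

theorem pd_comm_scalar (i j : Fin n) (f : CInf Ω) :
    SmoothMap.pd i (SmoothMap.pd j f) = SmoothMap.pd j (SmoothMap.pd i f) := by
  have h : ∀ i j, ∀ x ∈ Ω, SmoothMap.pd i (SmoothMap.pd j f) x =
      dirDeriv (EuclideanSpace.single i (1 : ℝ)) (dirDeriv (EuclideanSpace.single j (1 : ℝ)) f) x :=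
    fun i j x hx => (pd_eqOn_dirDeriv _ i hx).trans
      (dirDeriv_congr Ω.isOpen (pd_eqOn_dirDeriv f j) _ hx)
  refine SmoothMap.ext_on fun x hx => ?_
  rw [h i j x hx, h j i x hx]
  exact dirDeriv_comm (f := ⇑f) Ω.isOpen f.smooth.contDiffOn _ _ hx

/-- Point evaluations separate test functions, which reduces the claim to the scalar symmetry of
second derivatives. -/
theorem pd_comm (i j : Fin n) (φ : SK Ω) :
    SmoothMap.pd i (SmoothMap.pd j φ) = SmoothMap.pd j (SmoothMap.pd i φ) := by
  refine SmoothMap.ext_on fun x _ => TestFunction.ext fun y => ?_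
  have h := pd_comm_scalar i j (φ.postcomp ((dirac y : Distr Ω).restrictScalars ℝ))
  simp only [SmoothMap.pd_postcomp] at h
  exact DFunLike.congr_fun h x

end Symmetry

/-! ## Dilations -/

section Dilation

variable {n : ℕ} {F : Type*} [AddCommGroup F] [Module ℝ F] [TopologicalSpace F]
  [IsTopologicalAddGroup F] [ContinuousSMul ℝ F]

theorem HasPartialsAt.finset_sum {ι : Type*} (s : Finset ι) {f : ι → Eu n → F}
    {p : ι → Fin n → F} {x : Eu n} (h : ∀ a ∈ s, HasPartialsAt (f a) (p a) x) :
    HasPartialsAt (fun y => ∑ a ∈ s, f a y) (fun i => ∑ a ∈ s, p a i) x := by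
  have := HasPartialsAt.list_sum s.toList fun a ha => h a (Finset.mem_toList.1 ha)
  simpa only [Finset.sum_map_toList] using this

/-- The dilation with centre `x₀` and factor `s`. -/
def dilation (x₀ : Eu n) (s : ℝ) (x : Eu n) : Eu n := x₀ + s • (x - x₀)

theorem HasPartialsAt.comp_dilation {f : Eu n → F} {p : Fin n → F} {x₀ x : Eu n} {s : ℝ}
    (hf : HasPartialsAt f p (dilation x₀ s x)) :
    HasPartialsAt (fun y => f (dilation x₀ s y)) (fun i => s • p i) x := by
  by_cases hs : s = 0
  · subst hs
    simpa [dilation] using HasPartialsAt.const (f x₀) x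
  have h1 : Tendsto (fun h : Eu n => s • h) (𝓝[≠] 0) (𝓝[≠] 0) := by
    refine tendsto_nhdsWithin_iff.2 ⟨?_, ?_⟩
    · have : Continuous fun h : Eu n => s • h := continuous_const_smul s
      have := this.tendsto 0
      rw [smul_zero] at this
      exact this.mono_left nhdsWithin_le_nhds
    · filter_upwards [self_mem_nhdsWithin] with h hh
      exact smul_ne_zero hs hh
  have h2 := (Tendsto.comp hf h1).const_smul |s|
  rw [smul_zero] at h2
  refine h2.congr fun h => ?_
  have e1 : dilation x₀ s (x + h) = dilation x₀ s x + s • h := by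
    simp only [dilation, add_sub_right_comm, smul_add, add_assoc]
  have e2 : ∀ i, h i • s • p i = (s • h) i • p i := fun i => by
    rw [smul_smul, PiLp.smul_apply, smul_eq_mul, mul_comm]
  simp only [Function.comp_def, e1, e2, smul_smul]
  congr 1
  rw [norm_smul, mul_inv, Real.norm_eq_abs, ← mul_assoc, mul_inv_cancel₀ (abs_ne_zero.2 hs),
    one_mul]

theorem hasPartialsAt_coord (x₀ x : Eu n) (i : Fin n) :
    HasPartialsAt (fun y : Eu n => (y - x₀) i) (fun j => if i = j then (1 : ℝ) else 0) x := by
  have h : HasFDerivAt (fun y : Eu n => (y - x₀) i) (EuclideanSpace.proj i : Eu n →L[ℝ] ℝ) x :=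
    (EuclideanSpace.proj i : Eu n →L[ℝ] ℝ).hasFDerivAt.sub_const (x₀ i)
  have h' := HasFDerivAt.hasPartialsAt h
  simpa [Pi.single_apply] using h'

/-- The derivative with respect to `s` of the dilated derivatives `s ^ |l| • D l (x₀ + s (x - x₀))`
of a function with iterated partial derivatives `D`. -/
noncomputable def dilationDeriv (x₀ : Eu n) (D : List (Fin n) → Eu n → F) (l : List (Fin n))
    (s : ℝ) (x : Eu n) : F :=
  ((l.length : ℝ) * s ^ (l.length - 1)) • D l (dilation x₀ s x) +
    s ^ l.length • ∑ i, (x - x₀) i • D (i :: l) (dilation x₀ s x)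

variable {D : List (Fin n) → Eu n → F}
  (hD : ∀ l x, HasPartialsAt (D l) (fun i => D (i :: l) x) x)
include hD

theorem hasPartialsAt_dilate (x₀ : Eu n) (s : ℝ) (l : List (Fin n)) (k : ℕ) (x : Eu n) :
    HasPartialsAt (fun y => s ^ k • D l (dilation x₀ s y))
      (fun i => s ^ (k + 1) • D (i :: l) (dilation x₀ s x)) x := by
  have := ((hD l (dilation x₀ s x)).comp_dilation).const_smul (s ^ k)
  simpa only [smul_smul, pow_succ] using this

/-- Differentiating the factor `(x - x₀) i` creates one more copy of `D (j :: l)`, which raises the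
coefficient from `l.length` to `l.length + 1`; `hcomm` moves `j` past `i` in the other terms. -/
theorem hasPartialsAt_dilationDeriv (hcomm : ∀ i j l x, D (i :: j :: l) x = D (j :: i :: l) x)
    (x₀ : Eu n) (s : ℝ) (l : List (Fin n)) (x : Eu n) :
    HasPartialsAt (dilationDeriv x₀ D l s) (fun j => dilationDeriv x₀ D (j :: l) s x) x := by
  have h1 := ((hD l (dilation x₀ s x)).comp_dilation).const_smul
    ((l.length : ℝ) * s ^ (l.length - 1))
  have h2 := (HasPartialsAt.finset_sum Finset.univ fun i _ => (hasPartialsAt_coord x₀ x i).smul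
    ((hD (i :: l) (dilation x₀ s x)).comp_dilation)).const_smul (s ^ l.length)
  have h3 := h1.add h2
  refine Eq.mp ?_ h3
  congr 1
  funext j
  -- For the empty list the truncated exponent is harmless, since the coefficient `l.length` is
  -- zero.
  have e1 : ((l.length : ℝ) * s ^ (l.length - 1)) * s = (l.length : ℝ) * s ^ l.length := by
    rcases Nat.eq_zero_or_pos l.length with h | h
    · simp [h]
    · rw [mul_assoc, ← pow_succ, Nat.sub_add_cancel h]
  have e2 : ∀ i, (x - x₀) i • s • D (j :: i :: l) (dilation x₀ s x) =
      s • (x - x₀) i • D (i :: j :: l) (dilation x₀ s x) := fun i => by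
    rw [hcomm j i, smul_comm]
  have e3 : ∑ i, ((if i = j then (1 : ℝ) else 0) • D (i :: l) (dilation x₀ s x) +
      (x - x₀) i • s • D (j :: i :: l) (dilation x₀ s x)) = D (j :: l) (dilation x₀ s x) +
      s • ∑ i, (x - x₀) i • D (i :: j :: l) (dilation x₀ s x) := by
    rw [Finset.sum_add_distrib, Finset.smul_sum]
    congr 1
    · simp
    · exact Finset.sum_congr rfl fun i _ => e2 i
  have e4 : dilationDeriv x₀ D (j :: l) s x =
      (((l.length : ℝ) + 1) * s ^ l.length) • D (j :: l) (dilation x₀ s x) +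
        (s ^ l.length * s) • ∑ i, (x - x₀) i • D (i :: j :: l) (dilation x₀ s x) := by
    rw [dilationDeriv, List.length_cons, Nat.add_sub_cancel, Nat.cast_succ, pow_succ]
  rw [e4, e3, smul_smul, e1]
  module

variable {Ω : Opens (Eu n)}

/-- The dilates `x ↦ D [] (x₀ + s (x - x₀))`. -/
noncomputable def dilate (Ω : Opens (Eu n)) (x₀ : Eu n) (s : ℝ) (l : List (Fin n)) :
    SmoothMap Ω F :=
  SmoothMap.mk' (fun x => D l (dilation x₀ s x))
    ⟨fun l' x => s ^ l'.length • D (l' ++ l) (dilation x₀ s x), funext fun x => by simp,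
      fun l' x _ => hasPartialsAt_dilate hD x₀ s (l' ++ l) l'.length x⟩

theorem dilate_apply (x₀ : Eu n) (s : ℝ) (l : List (Fin n)) {x : Eu n} (hx : x ∈ Ω) :
    dilate hD Ω x₀ s l x = D l (dilation x₀ s x) := SmoothMap.mk'_apply hx

/-- This plays the role of Hadamard's lemma for vector-valued functions without integration: the
derivative in the dilation factor has coefficients `(x - x₀) i`, which vanish at the centre. -/
theorem exists_hasCurveDeriv_dilate [T2Space F] [LocallyConvexSpace ℝ F]
    (hcomm : ∀ i j l x, D (i :: j :: l) x = D (j :: i :: l) x) (x₀ : Eu n) :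
    ∃ d : ℝ → SmoothMap Ω F,
      (∀ s, ∀ x ∈ Ω, d s x = ∑ i, (x - x₀) i • D [i] (dilation x₀ s x)) ∧
      ∀ s, HasCurveDeriv (fun s => dilate hD Ω x₀ s []) (d s) s := by
  have hsm : ∀ s, IsSmoothOn Ω (dilationDeriv x₀ D [] s) := fun s =>
    ⟨fun l => dilationDeriv x₀ D l s, rfl, fun l x _ =>
      hasPartialsAt_dilationDeriv hD hcomm x₀ s l x⟩
  have hd : ∀ s l, ∀ x ∈ Ω, SmoothMap.iteratedPd l (SmoothMap.mk' _ (hsm s)) x =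
      dilationDeriv x₀ D l s x := fun s l x hx =>
    SmoothMap.iteratedPd_apply_eq (D := fun l => dilationDeriv x₀ D l s)
      (fun y hy => SmoothMap.mk'_apply hy)
      (fun l x _ => hasPartialsAt_dilationDeriv hD hcomm x₀ s l x) l x hx
  have hc : ∀ s l, ∀ x ∈ Ω, SmoothMap.iteratedPd l (dilate hD Ω x₀ s []) x =
      s ^ l.length • D l (dilation x₀ s x) := fun s l x hx => by
    refine SmoothMap.iteratedPd_apply_eq (D := fun l x => s ^ l.length • D l (dilation x₀ s x))
      (fun y hy => ?_) (fun l x _ => hasPartialsAt_dilate hD x₀ s l l.length x) l x hx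
    rw [dilate_apply hD x₀ s [] hy]
    simp
  have hDc : ∀ l, Continuous (D l) := fun l =>
    continuous_iff_continuousAt.2 fun x => (hD l x).continuousAt
  refine ⟨fun s => SmoothMap.mk' _ (hsm s), fun s x hx => ?_, fun s => ?_⟩
  · rw [SmoothMap.mk'_apply hx]
    simp [dilationDeriv]
  · refine hasCurveDeriv_smoothMap (c := fun s => dilate hD Ω x₀ s [])
      (d := fun s => SmoothMap.mk' _ (hsm s)) (fun l x hx t => ?_)
      (SmoothMap.continuous_of_uncurry (F := F) fun l => ?_) s
    · rw [hd t l x hx]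
      simp only [hc _ l x hx]
      have h1 : HasDerivAt (fun s : ℝ => dilation x₀ s x) (x - x₀) t := by
        simpa [dilation] using ((hasDerivAt_id t).smul_const (x - x₀)).const_add x₀
      exact (HasPartialsAt.comp_curve (γ := fun s => dilation x₀ s x) (hD l _) h1).smul
        (hasDerivAt_pow l.length t)
    · have h2 : Continuous fun p : ℝ × Ω => dilation x₀ p.1 p.2 := by
        unfold dilation
        fun_prop
      have h3 : Continuous fun p : ℝ × Ω => dilationDeriv x₀ D l p.1 p.2 := by
        unfold dilationDeriv
        refine ((continuous_const.mul (continuous_fst.pow _)).smul ((hDc l).comp h2)).add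
          ((continuous_fst.pow _).smul (continuous_finsetSum _ fun i _ =>
            Continuous.smul ?_ ((hDc _).comp h2)))
        fun_prop
      exact h3.congr fun p => (hd p.1 l p.2 p.2.2).symm

end Dilation

/-! ## Operators which are linear over the smooth functions -/

section CInfLinear

variable {n : ℕ} {Ω : Opens (Eu n)}

theorem iteratedPd_eq_zero {K : Set (Eu n)} (hK : IsClosed K) {ψ : SK Ω} (hψ : ∀ y ∉ K, ψ y = 0)
    (l : List (Fin n)) : ∀ y ∉ K, SmoothMap.iteratedPd l ψ y = 0 := by
  induction l with
  | nil => exact hψ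
  | cons i l ih =>
    intro y hy
    by_cases hyΩ : y ∈ Ω
    · have h := SmoothMap.pd_congr (U := Ω ⊓ ⟨Kᶜ, hK.isOpen_compl⟩) inf_le_left
        (f := SmoothMap.iteratedPd l ψ) (g := 0) (fun x hx => ih x hx.2) i ⟨hyΩ, hy⟩
      rw [SmoothMap.iteratedPd_cons, h]
      exact SmoothMap.pd_apply_eq hyΩ (f := 0) (HasPartialsAt.zero y) i
    · exact SmoothMap.apply_of_notMem _ hyΩ

/-- Dilated points may leave `Ω`, so the extension by zero has to be differentiable on the whole
space; a closed set in `Ω` containing the support ensures this. -/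
theorem hasPartialsAt_iteratedPd_of_support {K : Set (Eu n)} (hK : IsClosed K) (hKΩ : K ⊆ Ω)
    {ψ : SK Ω} (hψ : ∀ y ∉ K, ψ y = 0) (l : List (Fin n)) (x : Eu n) :
    HasPartialsAt (SmoothMap.iteratedPd l ψ) (fun i => SmoothMap.iteratedPd (i :: l) ψ x) x := by
  by_cases hx : x ∈ Ω
  · exact ψ.hasPartialsAt_iteratedPd l hx
  · have hxK : x ∉ K := fun h => hx (hKΩ h)
    simp only [iteratedPd_eq_zero hK hψ _ x hxK]
    refine (HasPartialsAt.zero x).congr ?_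
    filter_upwards [hK.isOpen_compl.mem_nhds hxK] with y hy
    exact (iteratedPd_eq_zero hK hψ l y hy).symm

/-- Let `ψ_s` be the dilate of `ψ` about `x₀`. By linearity over smooth functions, the derivative of
`T(ψ_s)(x₀)` in `s` is a combination with the coefficients `(x - x₀) i` taken at `x₀`, hence zero.
At `s = 1` the value is `T ψ x₀`; at `s = 0` the dilate is the constant `ψ x₀ = 0`. -/
theorem apply_eq_zero_of_support {T : SK Ω →L[ℂ] CInf Ω}
    (hT : ∀ (f : CInf Ω) (φ : SK Ω), T (f • φ) = f • T φ) {K : Set (Eu n)} (hK : IsClosed K)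
    (hKΩ : K ⊆ Ω) {ψ : SK Ω} (hψ : ∀ y ∉ K, ψ y = 0) {x₀ : Eu n} (hx₀ : x₀ ∈ Ω) (h0 : ψ x₀ = 0) :
    T ψ x₀ = 0 := by
  have hD := hasPartialsAt_iteratedPd_of_support hK hKΩ hψ
  have hcomm : ∀ i j l x, SmoothMap.iteratedPd (i :: j :: l) ψ x =
      SmoothMap.iteratedPd (j :: i :: l) ψ x := fun i j l x =>
    DFunLike.congr_fun (pd_comm i j (SmoothMap.iteratedPd l ψ)) x
  obtain ⟨d, hd, hcd⟩ := exists_hasCurveDeriv_dilate (Ω := Ω)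
    (D := fun l => ⇑(SmoothMap.iteratedPd l ψ)) hD hcomm x₀
  have hm : ∀ i : Fin n, IsSmoothOn Ω fun x : Eu n => (((x - x₀) i : ℝ) : ℂ) := fun i => by
    refine isSmoothOn_of_contDiffOn (Complex.ofRealCLM.contDiff.comp ?_).contDiffOn
    exact (EuclideanSpace.proj i : Eu n →L[ℝ] ℝ).contDiff.comp (contDiff_id.sub contDiff_const)
  have hsum : ∀ s, d s = ∑ i, SmoothMap.mk' _ (hm i) •
      dilate (D := fun l => ⇑(SmoothMap.iteratedPd l ψ)) hD Ω x₀ s [i] := fun s => by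
    refine SmoothMap.ext_on fun x hx => ?_
    rw [hd s x hx, SmoothMap.sum_apply]
    refine Finset.sum_congr rfl fun i _ => ?_
    rw [SmoothMap.smul_apply, SmoothMap.mk'_apply hx, dilate_apply hD x₀ s [i] hx]
    exact TestFunction.ext fun y => by simp
  have hTd : ∀ s, T (d s) x₀ = 0 := fun s => by
    rw [hsum, map_sum, SmoothMap.sum_apply]
    refine Finset.sum_eq_zero fun i _ => ?_
    rw [hT, SmoothMap.smul_apply, SmoothMap.mk'_apply hx₀]
    simp
  have hg : ∀ s, HasDerivAt (fun s => T (dilate (D := fun l => ⇑(SmoothMap.iteratedPd l ψ)) hD Ω x₀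
      s []) x₀) 0 s := fun s => by
    have h := (hcd s).clm ((SmoothMap.evalCLM ℂ x₀ ∘L T).restrictScalars ℝ)
    have h' := hasCurveDeriv_iff_hasDerivAt.1 h
    have e : (SmoothMap.evalCLM ℂ x₀ ∘L T).restrictScalars ℝ (d s) = 0 := hTd s
    rwa [e] at h'
  have h1 : dilate (D := fun l => ⇑(SmoothMap.iteratedPd l ψ)) hD Ω x₀ 1 [] = ψ :=
    SmoothMap.ext_on fun x hx => by
      rw [dilate_apply hD x₀ 1 [] hx, SmoothMap.iteratedPd_nil]
      simp [dilation]
  have h2 : dilate (D := fun l => ⇑(SmoothMap.iteratedPd l ψ)) hD Ω x₀ 0 [] = 0 :=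
    SmoothMap.ext_on fun x hx => by
      rw [dilate_apply hD x₀ 0 [] hx, SmoothMap.iteratedPd_nil]
      simp [dilation, h0, SmoothMap.zero_apply]
  have h3 := is_const_of_deriv_eq_zero (fun s => (hg s).differentiableAt)
    (fun s => (hg s).deriv) 1 0
  beta_reduce at h3
  rwa [h1, h2, map_zero, SmoothMap.zero_apply] at h3

/-- A cut-off equal to one at `x₀` gives the support condition, and linearity over smooth functions
shows that it does not change the value at `x₀`. -/
theorem apply_eq_zero_of_apply_eq_zero {T : SK Ω →L[ℂ] CInf Ω}
    (hT : ∀ (f : CInf Ω) (φ : SK Ω), T (f • φ) = f • T φ) {x₀ : Eu n} (hx₀ : x₀ ∈ Ω) {φ : SK Ω}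
    (h0 : φ x₀ = 0) : T φ x₀ = 0 := by
  obtain ⟨χ, hχ, hsupp, hχ1⟩ := exists_cutoff (Ω := Ω) (isCompact_singleton (x := x₀))
    (Set.singleton_subset_iff.2 hx₀)
  have hsm : IsSmoothOn Ω fun x => (χ x : ℂ) :=
    isSmoothOn_of_contDiffOn (Complex.ofRealCLM.contDiff.comp hχ).contDiffOn
  have h1 : (SmoothMap.mk' _ hsm : CInf Ω) x₀ = 1 := by
    rw [SmoothMap.mk'_apply hx₀, hχ1 x₀ rfl, Complex.ofReal_one]
  have h := apply_eq_zero_of_support hT (isClosed_tsupport χ) hsupp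
    (ψ := (SmoothMap.mk' _ hsm : CInf Ω) • φ) (fun y hy => ?_) hx₀
    (by rw [SmoothMap.smul_apply, h0, smul_zero])
  · rwa [hT, SmoothMap.smul_apply, h1, one_smul] at h
  · rw [SmoothMap.smul_apply]
    by_cases hyΩ : y ∈ Ω
    · rw [SmoothMap.mk'_apply hyΩ, image_eq_zero_of_notMem_tsupport hy, Complex.ofReal_zero,
        zero_smul]
    · rw [SmoothMap.apply_of_notMem φ hyΩ, smul_zero]

theorem basLploc_eq_basLCinf : basLploc Ω = basLCinf Ω := by
  ext R
  refine ⟨fun hR => ⟨hR.1, ?_⟩, fun hR => ⟨hR.1, ?_⟩⟩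
  · obtain ⟨⟨T, rfl⟩, hT⟩ := hR
    intro f φ
    refine SmoothMap.ext_on fun x hx => ?_
    -- At the point `x`, multiplication by `f` and by the constant `f x` have the same value, so
    -- point-locality reduces to complex linearity.
    have h := hT x hx (f • φ) (f x • φ) (by
      rw [SmoothMap.smul_apply, SmoothMap.const_smul_apply])
    rw [h, map_smul, SmoothMap.const_smul_apply, SmoothMap.smul_apply]
  · obtain ⟨⟨T, rfl⟩, hT⟩ := hR
    intro x hx φ ψ h
    have h1 := apply_eq_zero_of_apply_eq_zero hT hx (φ := φ - ψ) (by
      rw [SmoothMap.sub_apply, h, sub_self])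
    rw [map_sub, SmoothMap.sub_apply] at h1
    exact sub_eq_zero.1 h1

theorem correspondenceCommutes_LCinf (X : VectorField Ω) :
    CorrespondenceCommutes (basLploc Ω) (basLCinf Ω) (fun R S => R = S) (lieHat X) (lieHat X) := by
  rw [← basLploc_eq_basLCinf]
  exact ⟨⟨fun R hR => ⟨R, ⟨hR, rfl⟩, fun S hS => hS.2.symm⟩,
    fun R hR => ⟨R, ⟨hR, rfl⟩, fun S hS => hS.2⟩⟩, fun R hR => lieHat_mem_basLploc X hR,
    fun R hR => lieHat_mem_basLploc X hR, fun R _ S _ h => h ▸ rfl⟩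

end CInfLinear

/-! ## The Lie derivative of test functions -/

section TestFunctions

variable {n : ℕ} {Ω : Opens (Eu n)}

/-- Partial derivatives of test functions. -/
noncomputable abbrev pdTest (i : Fin n) : TestFn Ω →L[ℂ] TestFn Ω :=
  TestFunction.lineDerivCLM ℂ (EuclideanSpace.single i (1 : ℝ))

theorem differentiable_testFn (φ : TestFn Ω) : Differentiable ℝ φ :=
  φ.contDiff.differentiable (by simp)

theorem pdTest_apply (i : Fin n) (φ : TestFn Ω) (y : Eu n) :
    pdTest i φ y = fderiv ℝ φ y (EuclideanSpace.single i 1) := by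
  rw [pdTest, TestFunction.lineDerivCLM_apply_of_le (by simp),
    (differentiable_testFn φ y).lineDeriv_eq_fderiv]

theorem lieForm_apply (X : VectorField Ω) (φ : TestFn Ω) (y : Eu n) :
    lieForm X φ y = ∑ i, X y i • pdTest i φ y + divergence X y • φ y := by
  have h : lieForm X φ = ∑ i, mulTestFnCLM (component i X) (pdTest i φ) +
      mulTestFnCLM (divergence X) φ := by
    rw [lieForm, _root_.add_apply, _root_.sum_apply]
    rfl
  have h' : (dirac y : Distr Ω) (lieForm X φ) = _ := congrArg _ h
  rw [map_add, map_sum] at h'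
  exact h'

theorem pdTest_mul (f : RealCInf Ω) (φ : TestFn Ω) (i : Fin n) {y : Eu n} (hy : y ∈ Ω) :
    pdTest i (mulTestFn f φ) y = SmoothMap.pd i f y • φ y + f y • pdTest i φ y := by
  have h := (f.hasPartialsAt_pd hy).hasFDerivAt.smul (differentiable_testFn φ y).hasFDerivAt
  have h' : HasFDerivAt (mulTestFn f φ) _ y := h
  rw [pdTest_apply, pdTest_apply, h'.fderiv]
  simp [add_comm]

theorem lieForm_mul (X : VectorField Ω) (f : RealCInf Ω) (φ : TestFn Ω) {y : Eu n} (hy : y ∈ Ω) :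
    lieForm X (mulTestFn f φ) y = f y • lieForm X φ y + lieDir X f y • φ y := by
  have h : ∑ i, X y i • pdTest i (mulTestFn f φ) y =
      lieDir X f y • φ y + f y • ∑ i, X y i • pdTest i φ y := by
    rw [lieDir_apply, Finset.sum_smul, Finset.smul_sum, ← Finset.sum_add_distrib]
    refine Finset.sum_congr rfl fun i _ => ?_
    rw [pdTest_mul f φ i hy, smul_add, smul_assoc, smul_comm (f y)]
  have h' : mulTestFn f φ y = f y • φ y := rfl
  rw [lieForm_apply, lieForm_apply, h, h']
  module

theorem divergence_smul (X : VectorField Ω) (f : RealCInf Ω) (y : Eu n) :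
    divergence (f • X) y = f y * divergence X y + lieDir X f y := by
  have h : ∀ i, component i (f • X) = f • component i X := fun i => DFunLike.ext _ _ fun y => rfl
  rw [divergence, divergence, SmoothMap.sum_apply, SmoothMap.sum_apply, lieDir_apply,
    Finset.mul_sum, ← Finset.sum_add_distrib]
  refine Finset.sum_congr rfl fun i _ => ?_
  rw [h, SmoothMap.pd_smul, SmoothMap.add_apply, SmoothMap.smul_apply, SmoothMap.smul_apply,
    smul_eq_mul, smul_eq_mul, smul_eq_mul, add_comm, mul_comm (SmoothMap.pd i f y)]
  rfl

/-- The extra term comes from the divergence of `f • X`; it is the obstruction to linearity of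
`lieHat` in the vector field. -/
theorem lieForm_smul (X : VectorField Ω) (f : RealCInf Ω) (φ : TestFn Ω) (y : Eu n) :
    lieForm (f • X) φ y = f y • lieForm X φ y + lieDir X f y • φ y := by
  rw [lieForm_apply, lieForm_apply, divergence_smul, smul_add, Finset.smul_sum, add_smul, mul_smul,
    add_assoc]
  congr 1
  refine Finset.sum_congr rfl fun i _ => ?_
  rw [SmoothMap.smul_apply, PiLp.smul_apply, smul_eq_mul, mul_smul]

theorem exists_testFn {y : Eu n} (hy : y ∈ Ω) : ∃ φ : TestFn Ω, φ y = 1 := by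
  obtain ⟨b, hb1, hb2, hb3, -, hb5⟩ := exists_contDiff_tsupport_subset (n := ⊤)
    (Ω.isOpen.mem_nhds hy)
  have hs : tsupport (fun z => (b z : ℂ)) ⊆ tsupport b :=
    closure_mono fun z hz h => hz (by simp [h])
  exact ⟨⟨fun z => b z, Complex.ofRealCLM.contDiff.comp hb3,
    hb2.comp_left (g := fun r : ℝ => (r : ℂ)) Complex.ofReal_zero, hs.trans hb1⟩,
    by change (b y : ℂ) = 1; rw [hb5, Complex.ofReal_one]⟩

/-- The linear function `z ↦ ⟨X y, z⟩` has derivative `‖X y‖²` along `X` at a point `y` where `X`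
does not vanish. -/
theorem exists_lieDir_ne_zero {X : VectorField Ω} (hX : X ≠ 0) :
    ∃ y ∈ Ω, ∃ f : RealCInf Ω, lieDir X f y ≠ 0 := by
  obtain ⟨y, hy, hXy⟩ : ∃ y ∈ Ω, X y ≠ 0 := by
    by_contra! h
    exact hX (SmoothMap.ext_on h)
  have hsm : IsSmoothOn Ω fun z : Eu n => innerSL ℝ (X y) z :=
    isSmoothOn_of_contDiffOn (innerSL ℝ (X y)).contDiff.contDiffOn
  refine ⟨y, hy, SmoothMap.mk' _ hsm, ?_⟩
  have h : ∀ i, SmoothMap.pd i (SmoothMap.mk' _ hsm) y = X y i := fun i => by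
    have h1 := HasFDerivAt.hasPartialsAt ((innerSL ℝ (X y)).hasFDerivAt (x := y))
    have h2 : HasPartialsAt (SmoothMap.mk' _ hsm)
        (fun i => innerSL ℝ (X y) (EuclideanSpace.single i 1)) y := by
      refine h1.congr ?_
      filter_upwards [Ω.isOpen.mem_nhds hy] with z hz
      exact (SmoothMap.mk'_apply hz).symm
    rw [SmoothMap.pd_apply_eq hy h2 i]
    simp [EuclideanSpace.inner_single_right]
  have h3 : lieDir X (SmoothMap.mk' _ hsm) y = inner ℝ (X y) (X y) := by
    rw [lieDir_apply, PiLp.inner_apply]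
    exact Finset.sum_congr rfl fun i _ => by rw [h i]; rfl
  rw [h3]
  exact inner_self_ne_zero.2 hXy

end TestFunctions

/-! ## Embedded distributions and functions -/

section Embeddings

variable {n : ℕ} {Ω : Opens (Eu n)}

theorem lieHat_sigma (X : VectorField Ω) (f : CInf Ω) :
    lieHat X (sigma f) = sigma (lieDir X f) := by
  funext φ
  have h : differential (sigma f) φ (lieSK X φ) = 0 := differential_eq (HasCurveDeriv.const f 0)
  rw [lieHat, h, neg_zero, zero_add]
  rfl

theorem iota_mem_basE (u : Distr Ω) : iota u ∈ basE Ω := basL_subset_basE ⟨iotaCLM u, rfl⟩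

/-- For the Dirac distribution at `y` and the constant kernel `φ` with `φ y = 1`, the two sides
differ at `y` by the derivative of `f` along `X`. -/
theorem exists_lieHat_smul_ne {X : VectorField Ω} (hX : X ≠ 0) :
    ∃ f : RealCInf Ω, ∃ R ∈ basE Ω, lieHat (f • X) R ≠ fun φ => f • lieHat X R φ := by
  obtain ⟨y, hy, f, hf⟩ := exists_lieDir_ne_zero hX
  obtain ⟨φ, hφ⟩ := exists_testFn hy
  refine ⟨f, iota (dirac y), iota_mem_basE _, fun h => hf ?_⟩
  have h1 := DFunLike.congr_fun (congrFun h (SmoothMap.const Ω φ)) y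
  simp only [lieHat_iota] at h1
  rw [SmoothMap.smul_apply, iota_apply, iota_apply, SmoothMap.const_apply _ hy] at h1
  have h2 : -lieForm (f • X) φ y = f y • -lieForm X φ y := h1
  rw [lieForm_smul, hφ, smul_neg, neg_inj, add_eq_left] at h2
  simpa using h2

/-- On constant kernels `lieTilde X (iota u)` vanishes. Equality for the Dirac distribution at `y`
would force `lieForm X ψ y = 0` for all `ψ`, which the product rule for `f` times `φ` refutes. -/
theorem exists_lieTilde_iota_ne {X : VectorField Ω} (hX : X ≠ 0) :
    ∃ u : Distr Ω, lieTilde X (iota u) ≠ iota (lieHatDistr X u) := by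
  obtain ⟨y, hy, f, hf⟩ := exists_lieDir_ne_zero hX
  obtain ⟨φ, hφ⟩ := exists_testFn hy
  refine ⟨dirac y, fun h => hf ?_⟩
  have key : ∀ ψ : TestFn Ω, lieForm X ψ y = 0 := fun ψ => by
    have h1 := DFunLike.congr_fun (congrFun h (SmoothMap.const Ω ψ)) y
    have h2 : pairing (dirac y) (SmoothMap.const Ω ψ) = SmoothMap.const Ω (ψ y) :=
      SmoothMap.ext_on fun x hx => by
        rw [pairing, SmoothMap.postcomp_apply, SmoothMap.const_apply _ hx,
          SmoothMap.const_apply _ hx]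
        rfl
    rw [lieTilde, iota, h2, lieDir_const, iota_apply, SmoothMap.const_apply _ hy,
      SmoothMap.zero_apply] at h1
    have h3 : (0 : ℂ) = -lieForm X ψ y := h1
    exact neg_eq_zero.1 h3.symm
  have h4 := lieForm_mul X f φ hy
  rw [key, key, hφ, smul_zero, zero_add] at h4
  simpa using h4.symm

theorem lieTilde_add (X Y : VectorField Ω) (R : SK Ω → CInf Ω) :
    lieTilde (X + Y) R = fun φ => lieTilde X R φ + lieTilde Y R φ := by
  funext φ
  refine DFunLike.ext _ _ fun x => ?_
  simp only [lieTilde, SmoothMap.add_apply, lieDir_apply, PiLp.add_apply, add_smul,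
    Finset.sum_add_distrib]

theorem lieTilde_smul (X : VectorField Ω) (f : RealCInf Ω) (R : SK Ω → CInf Ω) :
    lieTilde (f • X) R = fun φ => f • lieTilde X R φ := by
  funext φ
  refine DFunLike.ext _ _ fun x => ?_
  simp only [lieTilde, SmoothMap.smul_apply, lieDir_apply, PiLp.smul_apply, smul_eq_mul, mul_smul,
    Finset.smul_sum]

end Embeddings

/-! ## Regular distributions -/

section Regular

open MeasureTheory

variable {n : ℕ} {Ω : Opens (Eu n)}

theorem integrable_mul_testFn (η : TestFn Ω) {g : Eu n → ℂ} (hg : ContinuousOn g Ω) :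
    Integrable fun x => η x * g x := by
  have hc : Continuous fun x => η x * g x := continuous_iff_continuousAt.2 fun x => by
    by_cases hx : x ∈ Ω
    · exact η.continuous.continuousAt.mul (hg.continuousAt (Ω.isOpen.mem_nhds hx))
    · refine (continuousAt_const (y := (0 : ℂ))).congr ?_
      filter_upwards [notMem_tsupport_iff_eventuallyEq.1 fun h => hx (η.tsupport_subset h)] with y hy
      rw [hy, Pi.zero_apply, zero_mul]
  exact hc.integrable_of_hasCompactSupport η.hasCompactSupport.mul_right

theorem integrable_testFn_mul (η : TestFn Ω) (g : CInf Ω) : Integrable fun x => η x * g x :=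
  integrable_mul_testFn η (g := ⇑g) g.smooth.contDiffOn.continuousOn

theorem toDistr_sub (f g : CInf Ω) : toDistr (f - g) = toDistr f - toDistr g := by
  ext φ
  rw [_root_.sub_apply, toDistr_apply, toDistr_apply, toDistr_apply, ← integral_sub
    (integrable_testFn_mul φ f) (integrable_testFn_mul φ g)]
  simp only [SmoothMap.sub_apply, mul_sub]

theorem integral_mul_pd (ψ : TestFn Ω) (g : CInf Ω) (i : Fin n) :
    ∫ x, ψ x * SmoothMap.pd i g x = -∫ x, pdTest i ψ x * g x := by
  -- Off `Ω` the function `pd i g` is zero by convention and need not equal the Fréchet derivative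
  -- of the extension by zero; there the factor `ψ x` vanishes.
  have h0 : ∀ x, ψ x * fderiv ℝ g x (EuclideanSpace.single i 1) = ψ x * SmoothMap.pd i g x := by
    intro x
    by_cases hx : x ∈ Ω
    · rw [pd_eqOn_dirDeriv g i hx]
      rfl
    · rw [image_eq_zero_of_notMem_tsupport fun h => hx (ψ.tsupport_subset h), zero_mul, zero_mul]
  have hg : ContDiffOn ℝ ∞ g Ω := g.smooth.contDiffOn
  have h := integral_mul_fderiv_eq_neg_fderiv_mul_of_integrable (μ := (volume : Measure (Eu n)))
    (f := ψ) (g := g) (v := EuclideanSpace.single i (1 : ℝ))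
    (by simpa only [← pdTest_apply] using integrable_testFn_mul (pdTest i ψ) g)
    (by simpa only [h0] using integrable_testFn_mul ψ (SmoothMap.pd i g))
    (integrable_testFn_mul ψ g)
    (fun x _ => differentiable_testFn ψ x)
    (fun x hx => (hg.contDiffAt (Ω.isOpen.mem_nhds (ψ.tsupport_subset hx))).differentiableAt
      (by simp))
  simpa only [h0, ← pdTest_apply] using h

/-- Integration by parts moves `Xⁱ ∂ᵢ` to the test function, and `∑ᵢ ∂ᵢ(Xⁱ φ)` is exactly `lieForm X
φ`. -/
theorem toDistr_lieDir (X : VectorField Ω) (g : CInf Ω) :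
    toDistr (lieDir X g) = lieHatDistr X (toDistr g) := by
  ext φ
  have h1 : ∀ i, Integrable fun x => mulTestFn (component i X) φ x * SmoothMap.pd i g x := fun i =>
    integrable_testFn_mul _ (SmoothMap.pd i g)
  have h2 : ∀ i, Integrable fun x => pdTest i (mulTestFn (component i X) φ) x * g x := fun i =>
    integrable_testFn_mul _ g
  have h3 : ∀ x, φ x * lieDir X g x =
      ∑ i, mulTestFn (component i X) φ x * SmoothMap.pd i g x := fun x => by
    rw [lieDir_apply, Finset.mul_sum]
    refine Finset.sum_congr rfl fun i _ => ?_
    have e : mulTestFn (component i X) φ x = X x i • φ x := rfl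
    rw [e, mul_smul_comm, smul_mul_assoc]
  have h4 : ∀ x, ∑ i, pdTest i (mulTestFn (component i X) φ) x * g x = lieForm X φ x * g x := by
    intro x
    by_cases hx : x ∈ Ω
    · rw [← Finset.sum_mul, lieForm_apply, divergence, SmoothMap.sum_apply, Finset.sum_smul,
        ← Finset.sum_add_distrib]
      congr 1
      refine Finset.sum_congr rfl fun i _ => ?_
      rw [pdTest_mul _ _ _ hx, add_comm]
      rfl
    · simp [SmoothMap.apply_of_notMem g hx]
  have h5 : lieHatDistr X (toDistr g) φ = -toDistr g (lieForm X φ) := rfl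
  rw [h5, toDistr_apply, toDistr_apply]
  simp only [h3, ← h4]
  rw [integral_finsetSum _ fun i _ => h1 i, integral_finsetSum _ fun i _ => h2 i,
    ← Finset.sum_neg_distrib]
  exact Finset.sum_congr rfl fun i _ => integral_mul_pd _ g i

theorem continuous_lieHatDistr (X : VectorField Ω) : Continuous (lieHatDistr X) :=
  ((lieForm X).precomp ℂ).continuous.neg

/-- The first term is `L̂_X` applied to `Φ_k u`, the second is `Φ_k` applied to `L̂_X u`. Both tend
to `L̂_X u`, the former by strong continuity of `L̂_X`. -/
theorem tendsto_lieTilde_sub_lieHat (X : VectorField Ω) (u : Distr Ω) {φ : ℕ → SK Ω}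
    (hφ : OperatorsTendToId φ) :
    Tendsto (fun k => toDistr (lieTilde X (iota u) (φ k) - lieHat X (iota u) (φ k)))
      atTop (𝓝 0) := by
  have h : ∀ v : Distr Ω, Tendsto (fun k => toDistr (pairing v (φ k))) atTop (𝓝 v) := fun v =>
    (hφ {v} (Bornology.isVonNBounded_singleton v)).tendsto_at rfl
  have h1 := (((continuous_lieHatDistr X).tendsto u).comp (h u)).sub (h (lieHatDistr X u))
  rw [sub_self] at h1
  refine h1.congr fun k => ?_
  rw [lieHat_iota, toDistr_sub, lieTilde, toDistr_lieDir]
  rfl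

end Regular

end Colombeau

theorem mainTheorem7 {n : ℕ} (Ω : Opens (Eu n)) (hΩ : (Ω : Set (Eu n)).Nonempty)
    (X : VectorField Ω) :
    -- the spaces of the inclusion diagram are invariant under `L̂_X`
    ((∀ R ∈ basE Ω, lieHat X R ∈ basE Ω) ∧
      (∀ R ∈ basEloc Ω, lieHat X R ∈ basEloc Ω) ∧
      (∀ R ∈ basEploc Ω, lieHat X R ∈ basEploc Ω) ∧
      (∀ R ∈ basEpi Ω, lieHat X R ∈ basEpi Ω) ∧
      (∀ R ∈ basL Ω, lieHat X R ∈ basL Ω) ∧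
      (∀ R ∈ basLloc Ω, lieHat X R ∈ basLloc Ω) ∧
      (∀ R ∈ basLploc Ω, lieHat X R ∈ basLploc Ω) ∧
      (∀ R ∈ basLpi Ω, lieHat X R ∈ basLpi Ω)) ∧
    -- the isomorphisms commute with the Lie derivatives `L̂_X`
    (CorrespondenceCommutes (basEploc Ω) {S : TestFn Ω → CInf Ω | ConvSmooth S}
        (fun R S => ∀ φ, ∀ x ∈ Ω, R φ x = S (φ x) x) (lieHat X) (lieHatPloc X) ∧
      CorrespondenceCommutes (basEpi Ω) {S : TestFn Ω → ℂ | ConvSmooth S}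
        (fun R S => ∀ φ, ∀ x ∈ Ω, R φ x = S (φ x)) (lieHat X) (lieHatPi X) ∧
      CorrespondenceCommutes (basLploc Ω) (basLCinf Ω) (fun R S => R = S)
        (lieHat X) (lieHat X) ∧
      CorrespondenceCommutes (basLploc Ω) (Set.univ : Set (SmoothMap Ω (Distr Ω)))
        (fun R S => ∀ φ, ∀ x ∈ Ω, R φ x = S x (φ x)) (lieHat X) (lieHatKer X) ∧
      CorrespondenceCommutes (basLpi Ω) (Set.univ : Set (Distr Ω))
        (fun R u => ∀ φ, ∀ x ∈ Ω, R φ x = u (φ x)) (lieHat X) (lieHatDistr X)) ∧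
    -- mapping properties of `L̃_X`
    ((∀ R ∈ basEpi Ω, lieTilde X R ∈ basEloc Ω) ∧
      (∀ R ∈ basEploc Ω, lieTilde X R ∈ basEloc Ω) ∧
      (∀ R ∈ basEloc Ω, lieTilde X R ∈ basEloc Ω) ∧
      (∀ R ∈ basE Ω, lieTilde X R ∈ basE Ω) ∧
      (∀ R ∈ basL Ω, lieTilde X R ∈ basL Ω)) ∧
    -- `L̂_X` commutes with `ι` and `σ` and is not `C^∞`-linear in `X`
    ((∀ u : Distr Ω, lieHat X (iota u) = iota (lieHatDistr X u)) ∧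
      (∀ f : CInf Ω, lieHat X (sigma f) = sigma (lieDir X f)) ∧
      (X ≠ 0 → ∃ f : RealCInf Ω, ∃ R ∈ basE Ω,
        lieHat (f • X) R ≠ fun φ => f • lieHat X R φ)) ∧
    -- `L̃_X` commutes with `σ` but not with `ι`, and is `C^∞`-linear in `X`
    ((∀ f : CInf Ω, lieTilde X (sigma f) = sigma (lieDir X f)) ∧
      (X ≠ 0 → ∃ u : Distr Ω, lieTilde X (iota u) ≠ iota (lieHatDistr X u)) ∧
      (∀ (Y : VectorField Ω) (R : SK Ω → CInf Ω),
        lieTilde (X + Y) R = fun φ => lieTilde X R φ + lieTilde Y R φ) ∧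
      (∀ (f : RealCInf Ω) (R : SK Ω → CInf Ω),
        lieTilde (f • X) R = fun φ => f • lieTilde X R φ)) ∧
    -- the two Lie derivatives of an embedded distribution are associated
    (∀ (u : Distr Ω) (φ : ℕ → SK Ω), OperatorsTendToId φ →
      Tendsto (fun k => toDistr (lieTilde X (iota u) (φ k) - lieHat X (iota u) (φ k)))
        atTop (𝓝 0)) := by
  refine ⟨⟨fun _ hR => lieHat_mem_basE X hR, fun _ hR => lieHat_mem_basEloc X hR,
    fun _ hR => lieHat_mem_basEploc X hR, fun _ hR => lieHat_mem_basEpi hΩ X hR,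
    fun _ hR => lieHat_mem_basL X hR, fun _ hR => lieHat_mem_basLloc X hR,
    fun _ hR => lieHat_mem_basLploc X hR, fun _ hR => lieHat_mem_basLpi hΩ X hR⟩,
    ⟨correspondenceCommutes_ploc X, correspondenceCommutes_pi hΩ X,
      correspondenceCommutes_LCinf X, correspondenceCommutes_Lploc X,
      correspondenceCommutes_Lpi hΩ X⟩,
    ⟨fun _ hR => lieTilde_mem_basEloc X (basEploc_subset_basEloc (basEpi_subset_basEploc hR)),
      fun _ hR => lieTilde_mem_basEloc X (basEploc_subset_basEloc hR),
      fun _ hR => lieTilde_mem_basEloc X hR, fun _ hR => lieTilde_mem_basE X hR,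
      fun _ hR => lieTilde_mem_basL X hR⟩,
    ⟨lieHat_iota X, lieHat_sigma X, exists_lieHat_smul_ne⟩,
    ⟨fun _ => rfl, exists_lieTilde_iota_ne, lieTilde_add X, lieTilde_smul X⟩,
    fun u _ hφ => tendsto_lieTilde_sub_lieHat X u hφ⟩
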